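/- **Setting.** There are $n$ jobs $J_1,\dots,J_n$, available at time $0$, with processing times $p_j\ge 0$, to be processed on one serial-batch machine with batch capacity $b$, where $1\le b<n$. The jobs are partitioned into batches of at most $b$ jobs. Before each batch the machine needs a constant setup time $s\ge 0$; the jobs of a batch are processed sequentially, so a batch $B$ has processing time $p(B)=\sum_{J_j\in B}p_j$, and the completion time $C_j$ of every job of $B$ is the completion time $C(B)=S(B)+p(B)$ of the batch, where $S(B)$ is its start time. Batches are numbered $B_1,\dots,B_n$ from left to right, the nonempty ones being the last ones; an empty batch has no setup and no processing time. A schedule (a partition into batches together with start times) is feasible if every nonempty batch starts at least $s$ after time $0$ and at least $s$ after the completion of each earlier nonempty batch. Each job has a cost function $f_j:\mathbb R\to\mathbb R$ that is non-decreasing on $[0,\infty)$. Let $C_{\max}(\sigma)=\max_j C_j(\sigma)$ and $f_{\max}(\sigma)=\max_j f_j(C_j(\sigma))$. A feasible schedule $\sigma$ is Pareto optimal if no feasible $\sigma'$ satisfies $C_{\max}(\sigma')\le C_{\max}(\sigma)$ and $f_{\max}(\sigma')\le f_{\max}(\sigma)$ with at least one strict inequality; then $(C_{\max}(\sigma),f_{\max}(\sigma))$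 is a Pareto optimal point. Running time is the number of elementary operations of a random access machine on natural and real numbers: arithmetic and comparison of natural numbers, addition and comparison of real numbers, access to memory, and evaluation of a value $f_j(t)$ take one operation each. **Algorithm MAIN1.** Every job $J_j$ carries an index, initially $n$ (jobs with index $i$ form the set $\mathcal J_i$ of a family $\mathcal J_1,\dots,\mathcal J_n$). Put $y=+\infty$, $u=0$, $\Omega=\varnothing$. For $i=n,n-1,\dots,1$, form $B_i$ from the $b$ (or all, if there are fewer) jobs with largest processing times among the jobs of index at least $i$ not yet assigned; fail if $B_i=\varnothing$ but some job has an index smaller than $i$. Then iterate the following. 1. *(Auxiliary procedure.)* Compute $S(B_i)$ and $C(B_i)$ for $i=1,\dots,n$ without idle time. Keeping these values fixed, for $i=n,\dots,1$ check $f_j(C(B_i))<y$ for each job $J_j$ in the current $B_i$. If it is violated, set the index of $J_j$ to $i-1$, remove $J_j$ from $B_i$, and let $E$ be the set of the jobs $J_{j'}$ in $B_1,\dots,B_{i-1}$ with $f_{j'}(C(B_i))<y$. If $E=\varnothing$: fail if $B_i$ has become empty or if $B_{i-1},\dots,B_1$ are all full; otherwise let $e\le i-1$ be the largest index with $|B_e|<b$.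 If $E\ne\varnothing$: move a job of $E$ with largest processing time from its batch $B_e$ to $B_i$. In both cases start with the current job $J_j$, and for $c=i-1,\dots,e+1$ put the current job into $B_c$ and take out a job of $B_c$ with smallest processing time as the new current job; finally put the current job into $B_e$. If an adjustment has been made, repeat this procedure with recomputed times; otherwise it returns the current schedule $\sigma_{u+1}$. 2. If a schedule $\sigma_{u+1}$ has been returned: if $u>0$ and $C_{\max}(\sigma_u)<C_{\max}(\sigma_{u+1})$, include $(C_{\max}(\sigma_u),f_{\max}(\sigma_u),\sigma_u)$ into $\Omega$; set $\pi^*=\sigma_{u+1}$ and $y=f_{\max}(\sigma_{u+1})$, increase $u$ by one, and continue with 1 from the current batches and indices. 3. If the procedure has failed: include $(C_{\max}(\sigma_u),f_{\max}(\sigma_u),\sigma_u)$ into $\Omega$, and return $\Omega$ and $\pi^*$. **Theorem 2.** There is a constant $K$ such that on every instance as above Algorithm MAIN1 halts after at most $K n^3$ elementary operations, and the returned set $\Omega$ consists of all Pareto optimal points for $1|s\text{-batch},b<n|(C_{\max},f_{\max})$, each occurring exactly once and together with a corresponding Pareto optimal schedule. Consequently, $1|s\text{-batch},b<n|f_{\max}$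 is solved in $O(n^3)$ time as well: the schedule $\pi^*$ returned by the same run is feasible and minimizes $f_{\max}$ over all feasible schedules. -/

import Mathlib

open scoped BigOperators

namespace SBatch

/-! ### The scheduling problem -/

/-- An instance of the bounded serial-batch problem: `n` jobs, batch capacity `b < n`, a constant
setup time `s`, processing times `p j`, and regular (non-decreasing) cost functions `f j`.
All data are real; every job is available at time zero. -/
structure Instance where
  n : ℕ
  b : ℕ
  s : ℝ
  p : Fin n → ℝ
  f : Fin n → ℝ → ℝ
  one_le_b : 1 ≤ b
  b_lt_n : b < n
  s_nonneg : 0 ≤ s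
  p_nonneg : ∀ j, 0 ≤ p j
  f_regular : ∀ j, MonotoneOn (f j) (Set.Ici 0)

/-- A schedule: a partition of the jobs into batches (job `j` is in batch `batch j`) and the start
times of the batches. Batches are numbered `1, …, n` from the earliest to the latest. -/
structure Schedule (n : ℕ) where
  batch : Fin n → ℕ
  start : ℕ → ℝ

namespace Schedule

/-- The set of jobs in batch `i`. -/
def jobs {n : ℕ} (σ : Schedule n) (i : ℕ) : Finset (Fin n) :=
  Finset.univ.filter (fun j => σ.batch j = i)

/-- Processing time of batch `i`: the jobs of a batch are processed sequentially. -/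
def ptime (I : Instance) (σ : Schedule I.n) (i : ℕ) : ℝ :=
  ∑ j ∈ σ.jobs i, I.p j

/-- Completion time of job `j`, namely the completion time of its batch. -/
def compl (I : Instance) (σ : Schedule I.n) (j : Fin I.n) : ℝ :=
  σ.start (σ.batch j) + σ.ptime I (σ.batch j)

/-- The makespan. -/
noncomputable def Cmax (I : Instance) (σ : Schedule I.n) : ℝ :=
  ⨆ j, σ.compl I j

/-- The maximum cost. -/
noncomputable def fmax (I : Instance) (σ : Schedule I.n) : ℝ :=
  ⨆ j, I.f j (σ.compl I j)

/-- Feasibility. The nonempty batches carry the last numbers (the first ones may be empty), no batch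
has more than `b` jobs, and every nonempty batch starts only after a setup of length `s` that
itself begins when the machine is free. Idle time is allowed. -/
structure Feasible (I : Instance) (σ : Schedule I.n) : Prop where
  batch_mem : ∀ j, 1 ≤ σ.batch j ∧ σ.batch j ≤ I.n
  last_nonempty : ∀ i k, i ≤ k → k ≤ I.n → (σ.jobs i).Nonempty → (σ.jobs k).Nonempty
  capacity : ∀ i, (σ.jobs i).card ≤ I.b
  setup_first : ∀ i, (σ.jobs i).Nonempty → I.s ≤ σ.start i
  setup_between : ∀ i k, i < k → (σ.jobs i).Nonempty → (σ.jobs k).Nonempty →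
    σ.start i + σ.ptime I i + I.s ≤ σ.start k

/-- Pareto optimality with respect to makespan and maximum cost. -/
def ParetoOptimal (I : Instance) (σ : Schedule I.n) : Prop :=
  σ.Feasible I ∧
    ¬ ∃ τ : Schedule I.n, τ.Feasible I ∧ τ.Cmax I ≤ σ.Cmax I ∧ τ.fmax I ≤ σ.fmax I ∧
      (τ.Cmax I < σ.Cmax I ∨ τ.fmax I < σ.fmax I)

end Schedule

/-! ### The machine: a unit-cost random access machine on natural and real numbers

Natural numbers (indices, counters) can be added, subtracted and compared; real numbers can be added
and compared, and a value `f_j(t)` of a cost function is one elementary operation. -/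

/-- Registers for natural numbers. -/
inductive NVar
  | numJobs | cap
  | i | r | j | q | e | c | cur | z | x | tmp
  | found | fail | adj | done | yFin | u | k
  deriving DecidableEq

/-- Arrays of natural numbers. -/
inductive NArr
  | pos | csf | size | slot | bestPos | omPos
  deriving DecidableEq

/-- Registers for real numbers. -/
inductive RVar
  | setup | y | cmax | fmax | prevC | prevF
  deriving DecidableEq

/-- Arrays of real numbers. -/
inductive RArr
  | p | S | C | bestS | omC | omF | omS
  deriving DecidableEq

/-- Memory contents. Arrays have two indices; a one-dimensional array uses row `0` only. -/
structure State where
  nv : NVar → ℕ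
  na : NArr → ℕ → ℕ → ℕ
  rv : RVar → ℝ
  ra : RArr → ℕ → ℕ → ℝ

/-- Expressions for natural numbers. -/
inductive NExp
  | lit (m : ℕ)
  | var (v : NVar)
  | read (a : NArr) (i j : NExp)
  | add (e₁ e₂ : NExp)
  | sub (e₁ e₂ : NExp)

/-- Expressions for real numbers; `cost j t` is the value `f_j(t)`. -/
inductive RExp
  | zero
  | var (v : RVar)
  | read (a : RArr) (i j : NExp)
  | add (e₁ e₂ : RExp)
  | cost (j : NExp) (t : RExp)

/-- Tests. -/
inductive BExp
  | nlt (e₁ e₂ : NExp)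
  | neq (e₁ e₂ : NExp)
  | rlt (e₁ e₂ : RExp)
  | not (b : BExp)
  | and (b₁ b₂ : BExp)
  | or (b₁ b₂ : BExp)

/-- Programs. `neq` above is equality of natural numbers; `loop b c` is "while `b` do `c`". -/
inductive Cmd
  | skip
  | nset (v : NVar) (e : NExp)
  | nput (a : NArr) (i j e : NExp)
  | rset (v : RVar) (e : RExp)
  | rput (a : RArr) (i j : NExp) (e : RExp)
  | seq (c₁ c₂ : Cmd)
  | cond (b : BExp) (c₁ c₂ : Cmd)
  | loop (b : BExp) (c : Cmd)

def NExp.eval (st : State) : NExp → ℕ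
  | .lit m => m
  | .var v => st.nv v
  | .read a i j => st.na a (i.eval st) (j.eval st)
  | .add e₁ e₂ => e₁.eval st + e₂.eval st
  | .sub e₁ e₂ => e₁.eval st - e₂.eval st

/-- Number of elementary operations of an expression. -/
def NExp.ops : NExp → ℕ
  | .lit _ => 1
  | .var _ => 1
  | .read _ i j => i.ops + j.ops + 1
  | .add e₁ e₂ => e₁.ops + e₂.ops + 1
  | .sub e₁ e₂ => e₁.ops + e₂.ops + 1

noncomputable def RExp.eval (f : ℕ → ℝ → ℝ) (st : State) : RExp → ℝ
  | .zero => 0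
  | .var v => st.rv v
  | .read a i j => st.ra a (i.eval st) (j.eval st)
  | .add e₁ e₂ => e₁.eval f st + e₂.eval f st
  | .cost j t => f (j.eval st) (t.eval f st)

def RExp.ops : RExp → ℕ
  | .zero => 1
  | .var _ => 1
  | .read _ i j => i.ops + j.ops + 1
  | .add e₁ e₂ => e₁.ops + e₂.ops + 1
  | .cost j t => j.ops + t.ops + 1

def BExp.holds (f : ℕ → ℝ → ℝ) (st : State) : BExp → Prop
  | .nlt e₁ e₂ => e₁.eval st < e₂.eval st
  | .neq e₁ e₂ => e₁.eval st = e₂.eval st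
  | .rlt e₁ e₂ => e₁.eval f st < e₂.eval f st
  | .not b => ¬ b.holds f st
  | .and b₁ b₂ => b₁.holds f st ∧ b₂.holds f st
  | .or b₁ b₂ => b₁.holds f st ∨ b₂.holds f st

def BExp.ops : BExp → ℕ
  | .nlt e₁ e₂ => e₁.ops + e₂.ops + 1
  | .neq e₁ e₂ => e₁.ops + e₂.ops + 1
  | .rlt e₁ e₂ => e₁.ops + e₂.ops + 1
  | .not b => b.ops + 1
  | .and b₁ b₂ => b₁.ops + b₂.ops + 1
  | .or b₁ b₂ => b₁.ops + b₂.ops + 1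

namespace State

def setN (st : State) (v : NVar) (m : ℕ) : State :=
  { st with nv := fun v' => if v' = v then m else st.nv v' }

def setR (st : State) (v : RVar) (m : ℝ) : State :=
  { st with rv := fun v' => if v' = v then m else st.rv v' }

def putN (st : State) (a : NArr) (i j : ℕ) (m : ℕ) : State :=
  { st with na := fun a' i' j' => if a' = a ∧ i' = i ∧ j' = j then m else st.na a' i' j' }

def putR (st : State) (a : RArr) (i j : ℕ) (m : ℝ) : State :=
  { st with ra := fun a' i' j' => if a' = a ∧ i' = i ∧ j' = j then m else st.ra a' i' j' }

end State

/-- `Exec f c st st' t`: with the cost functions `f`, the program `c` started in memory `st` halts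
in memory `st'` after exactly `t` elementary operations. (The execution is deterministic.) -/
inductive Exec (f : ℕ → ℝ → ℝ) : Cmd → State → State → ℕ → Prop
  | skip (st : State) : Exec f .skip st st 1
  | nset (st : State) (v : NVar) (e : NExp) :
      Exec f (.nset v e) st (st.setN v (e.eval st)) (e.ops + 1)
  | nput (st : State) (a : NArr) (i j e : NExp) :
      Exec f (.nput a i j e) st (st.putN a (i.eval st) (j.eval st) (e.eval st))
        (i.ops + j.ops + e.ops + 1)
  | rset (st : State) (v : RVar) (e : RExp) :
      Exec f (.rset v e) st (st.setR v (e.eval f st)) (e.ops + 1)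
  | rput (st : State) (a : RArr) (i j : NExp) (e : RExp) :
      Exec f (.rput a i j e) st (st.putR a (i.eval st) (j.eval st) (e.eval f st))
        (i.ops + j.ops + e.ops + 1)
  | seq {c₁ c₂ : Cmd} {st₁ st₂ st₃ : State} {t₁ t₂ : ℕ} :
      Exec f c₁ st₁ st₂ t₁ → Exec f c₂ st₂ st₃ t₂ → Exec f (.seq c₁ c₂) st₁ st₃ (t₁ + t₂)
  | cond_true {b : BExp} {c₁ c₂ : Cmd} {st st' : State} {t : ℕ} :
      b.holds f st → Exec f c₁ st st' t → Exec f (.cond b c₁ c₂) st st' (b.ops + 1 + t)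
  | cond_false {b : BExp} {c₁ c₂ : Cmd} {st st' : State} {t : ℕ} :
      ¬ b.holds f st → Exec f c₂ st st' t → Exec f (.cond b c₁ c₂) st st' (b.ops + 1 + t)
  | loop_done {b : BExp} {c : Cmd} {st : State} :
      ¬ b.holds f st → Exec f (.loop b c) st st (b.ops + 1)
  | loop_step {b : BExp} {c : Cmd} {st₁ st₂ st₃ : State} {t₁ t₂ : ℕ} :
      b.holds f st₁ → Exec f c st₁ st₂ t₁ → Exec f (.loop b c) st₂ st₃ t₂ →
      Exec f (.loop b c) st₁ st₃ (b.ops + 1 + t₁ + t₂)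

/-! ### Abbreviations for writing programs -/

instance (m : ℕ) : OfNat NExp m := ⟨NExp.lit m⟩
instance : Coe NVar NExp := ⟨NExp.var⟩
instance : Coe RVar RExp := ⟨RExp.var⟩

abbrev NVar.set (v : NVar) (e : NExp) : Cmd := .nset v e
abbrev RVar.set (v : RVar) (e : RExp) : Cmd := .rset v e
abbrev NArr.get (a : NArr) (i : NExp) : NExp := .read a 0 i
abbrev NArr.get2 (a : NArr) (i j : NExp) : NExp := .read a i j
abbrev NArr.put (a : NArr) (i e : NExp) : Cmd := .nput a 0 i e
abbrev NArr.put2 (a : NArr) (i j e : NExp) : Cmd := .nput a i j e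
abbrev RArr.get (a : RArr) (i : NExp) : RExp := .read a 0 i
abbrev RArr.put (a : RArr) (i : NExp) (e : RExp) : Cmd := .rput a 0 i e
abbrev RArr.put2 (a : RArr) (i j : NExp) (e : RExp) : Cmd := .rput a i j e

infixr:50 " ;; " => Cmd.seq
infixl:65 " +' " => NExp.add
infixl:65 " -' " => NExp.sub
infix:55 " <' " => BExp.nlt
infix:55 " ==' " => BExp.neq
infix:55 " <ᵣ " => BExp.rlt
infixl:65 " +ᵣ " => RExp.add
infixr:53 " &&' " => BExp.and
infixr:52 " ||' " => BExp.or

/-- "for `v = 0, …, bound - 1` do `body`" -/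
abbrev forUp (v : NVar) (bound : NExp) (body : Cmd) : Cmd :=
  v.set 0 ;; .loop (v <' bound) (body ;; v.set (v +' 1))

/-- "if `b` then `c`" -/
abbrev when (b : BExp) (c : Cmd) : Cmd := .cond b c .skip

/-! ### Algorithm MAIN1

Jobs are numbered `0, …, n - 1` in memory, batches `1, …, n`. The current (tentative) schedule `σ`
is held as follows: `size i` is the number of jobs in batch `B_i`, which are `slot i 0, …,
slot i (size i - 1)`; `pos j` is the number of the batch that contains job `j`; `S i` and `C i` are
the start and completion times of `B_i`. The candidate set family is held as `csf j = i` for job `j`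
in the `i`-th set. The bound `y` is `+∞` as long as `yFin = 0`. "Return the empty schedule" is
`fail = 1`. -/

section Program

open NVar NArr RVar RArr

/-- The test `f_job (C(B_bat)) < y`. -/
abbrev okAt (job bat : NExp) : BExp :=
  yFin ==' 0 ||' .cost job (C.get bat) <ᵣ y

/-- Form the batches greedily: for `i = n, …, 1`, batch `B_i` takes jobs with largest processing
times among the unassigned jobs (`pos = 0`) of the sets with index at least `i`, until it is full or
no such job is left. If `B_i` stays empty although some set with a smaller index is nonempty, then
fail. -/
def formBatches : Cmd :=
  forUp j numJobs (pos.put j 0) ;;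
  i.set numJobs ;;
  .loop (0 <' i &&' fail ==' 0) (
    size.put i 0 ;;
    found.set 1 ;;
    .loop (size.get i <' cap &&' found ==' 1) (
      found.set 0 ;;
      forUp q numJobs (
        when (pos.get q ==' 0 &&' .not (csf.get q <' i) &&'
            (found ==' 0 ||' p.get x <ᵣ p.get q))
          (found.set 1 ;; x.set q)) ;;
      when (found ==' 1) (
        pos.put x i ;;
        slot.put2 i (size.get i) x ;;
        size.put i (size.get i +' 1))) ;;
    when (size.get i ==' 0)
      (forUp q numJobs (when (csf.get q <' i) (fail.set 1))) ;;
    i.set (i -' 1))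

/-- Schedule the batches without idle time: `S(B_i) = C(B_{i-1}) + s(B_i)`,
`C(B_i) = S(B_i) + p(B_i)`, where `C(B_0) = 0` and an empty batch has no setup. -/
def schedBatches : Cmd :=
  C.put 0 .zero ;;
  i.set 1 ;;
  .loop (.not (numJobs <' i)) (
    .cond (size.get i ==' 0)
      (S.put i (C.get (i -' 1)))
      (S.put i (C.get (i -' 1) +ᵣ setup)) ;;
    C.put i (S.get i) ;;
    forUp r (size.get i) (C.put i (C.get i +ᵣ p.get (slot.get2 i r))) ;;
    i.set (i +' 1))

/-- Right-to-left adjustment of the batches `B_{i-1}, …, B_e`, started with the job `j`: each batch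
`B_c` with `c > e` takes over the current job and hands on a shortest one; the last current job is
put into `B_e`. -/
def shift : Cmd :=
  cur.set j ;;
  c.set (i -' 1) ;;
  .loop (e <' c) (
    z.set 0 ;;
    forUp q (size.get c)
      (when (p.get (slot.get2 c q) <ᵣ p.get (slot.get2 c z)) (z.set q)) ;;
    when (p.get (slot.get2 c z) <ᵣ p.get cur) (
      tmp.set (slot.get2 c z) ;;
      slot.put2 c z cur ;;
      pos.put cur c ;;
      cur.set tmp) ;;
    c.set (c -' 1)) ;;
  slot.put2 e (size.get e) cur ;;
  size.put e (size.get e +' 1) ;;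
  pos.put cur e

/-- No job of an earlier batch fits into `B_i`: remove `j` from `B_i`, and find the largest
`e ≤ i - 1` for which `B_e` is not full. -/
def caseOne : Cmd :=
  slot.put2 i r (slot.get2 i (size.get i -' 1)) ;;
  size.put i (size.get i -' 1) ;;
  .cond (size.get i ==' 0)
    (fail.set 1)
    (e.set (i -' 1) ;;
     .loop (0 <' e &&' .not (size.get e <' cap)) (e.set (e -' 1)) ;;
     .cond (e ==' 0) (fail.set 1) shift)

/-- The job `x` of the earlier batch `B_e` fits into `B_i`: it replaces `j` there. -/
def caseTwo : Cmd :=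
  e.set (pos.get x) ;;
  slot.put2 i r x ;;
  pos.put x i ;;
  z.set 0 ;;
  .loop (.not (slot.get2 e z ==' x)) (z.set (z +' 1)) ;;
  slot.put2 e z (slot.get2 e (size.get e -' 1)) ;;
  size.put e (size.get e -' 1) ;;
  shift

/-- The job `j` in `B_i` violates `f_j(C(B_i)) < y`: move it to the set with index `i - 1` and
adjust the schedule. The search is for a longest job `x` of `B_1, …, B_{i-1}` with
`f_x(C(B_i)) < y`. -/
def repair : Cmd :=
  adj.set 1 ;;
  csf.put j (i -' 1) ;;
  found.set 0 ;;
  forUp q numJobs (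
    when (pos.get q <' i &&' okAt q i &&' (found ==' 0 ||' p.get x <ᵣ p.get q))
      (found.set 1 ;; x.set q)) ;;
  .cond (found ==' 0) caseOne caseTwo

/-- For `i = n, …, 1`, check the inequality `f_j(C(B_i)) < y` for each job `j` in `B_i`. -/
def adjust : Cmd :=
  adj.set 0 ;;
  i.set numJobs ;;
  .loop (0 <' i &&' fail ==' 0) (
    r.set 0 ;;
    .loop (r <' size.get i &&' fail ==' 0) (
      j.set (slot.get2 i r) ;;
      .cond (okAt j i) (r.set (r +' 1)) repair) ;;
    i.set (i -' 1))

/-- Algorithm IMPROAUX1, from the scheduling of the already formed batches on: schedule and adjust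
until no adjustment has been made, or fail. -/
def improAux : Cmd :=
  adj.set 1 ;;
  .loop (adj ==' 1 &&' fail ==' 0) (schedBatches ;; adjust)

/-- Makespan and maximum cost of the current schedule. -/
def evalSched : Cmd :=
  forUp q numJobs (
    when (q ==' 0 ||' cmax <ᵣ C.get (pos.get q)) (cmax.set (C.get (pos.get q))) ;;
    when (q ==' 0 ||' fmax <ᵣ .cost q (C.get (pos.get q)))
      (fmax.set (.cost q (C.get (pos.get q)))))

/-- `k := k + 1`, `π_k := σ_u`, and include `(C_max(π_k), f_max(π_k), π_k)` into `Ω`. -/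
def record : Cmd :=
  k.set (k +' 1) ;;
  omC.put k prevC ;;
  omF.put k prevF ;;
  forUp q numJobs (omPos.put2 k q (bestPos.get q)) ;;
  forUp q (numJobs +' 1) (omS.put2 k q (bestS.get q))

/-- `π* := σ_{u+1}`, `y := f_max(σ_{u+1})`, `u := u + 1`. -/
def keep : Cmd :=
  forUp q numJobs (bestPos.put q (pos.get q)) ;;
  forUp q (numJobs +' 1) (bestS.put q (S.get q)) ;;
  prevC.set cmax ;;
  prevF.set fmax ;;
  y.set fmax ;;
  yFin.set 1 ;;
  u.set (u +' 1)

/-- Algorithm MAIN1. The schedule `σ_u` of the previous iteration is the one last kept as `π*`. -/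
def main1 : Cmd :=
  u.set 0 ;;
  yFin.set 0 ;;
  k.set 0 ;;
  fail.set 0 ;;
  done.set 0 ;;
  forUp q numJobs (csf.put q numJobs) ;;
  formBatches ;;
  .loop (done ==' 0) (
    improAux ;;
    .cond (fail ==' 0)
      (evalSched ;;
       when (0 <' u &&' prevC <ᵣ cmax) record ;;
       keep)
      (record ;;
       done.set 1))

end Program

/-! ### Input, output and running time -/

/-- The cost functions as seen by the machine. -/
noncomputable def Instance.costs (I : Instance) (j : ℕ) (t : ℝ) : ℝ :=
  if h : j < I.n then I.f ⟨j, h⟩ t else 0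

/-- Initial memory: `n`, `b`, `s` and the processing times; all other cells are zero. -/
noncomputable def Instance.load (I : Instance) : State where
  nv := fun v => match v with
    | .numJobs => I.n
    | .cap => I.b
    | _ => 0
  na := fun _ _ _ => 0
  rv := fun v => match v with
    | .setup => I.s
    | _ => 0
  ra := fun a i j => match a with
    | .p => if h : i = 0 ∧ j < I.n then I.p ⟨j, h.2⟩ else 0
    | _ => 0

namespace State

/-- Number of triples in the returned set `Ω`. -/
def omegaCount (st : State) : ℕ := st.nv .k

/-- The objective vector in the `k`-th triple of `Ω`. -/
def omegaPoint (st : State) (k : ℕ) : ℝ × ℝ := (st.ra .omC 0 k, st.ra .omF 0 k)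

/-- The schedule in the `k`-th triple of `Ω`. -/
def omegaSched (st : State) (n k : ℕ) : Schedule n where
  batch := fun j => st.na .omPos k j
  start := fun i => st.ra .omS k i

/-- The returned schedule `π*`. -/
def piStar (st : State) (n : ℕ) : Schedule n where
  batch := fun j => st.na .bestPos 0 j
  start := fun i => st.ra .bestS 0 i

end State

/-- The returned set `Ω` consists of all Pareto optimal points, each exactly once and with a
corresponding Pareto optimal schedule. -/
def IsParetoSet (I : Instance) (out : State) : Prop :=
  (∀ k, 1 ≤ k → k ≤ out.omegaCount →
    (out.omegaSched I.n k).ParetoOptimal I ∧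
    out.omegaPoint k = ((out.omegaSched I.n k).Cmax I, (out.omegaSched I.n k).fmax I)) ∧
  ∀ σ : Schedule I.n, σ.ParetoOptimal I →
    ∃! k, 1 ≤ k ∧ k ≤ out.omegaCount ∧ out.omegaPoint k = (σ.Cmax I, σ.fmax I)

/-- The returned schedule `π*` is feasible and has minimum maximum cost. -/
def IsMaxCostOptimum (I : Instance) (out : State) : Prop :=
  (out.piStar I.n).Feasible I ∧
    ∀ σ : Schedule I.n, σ.Feasible I → (out.piStar I.n).fmax I ≤ σ.fmax I

/-- The program `P` halts on every instance, after `O(n³)` elementary operations, with an output that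
meets the specification `spec`. -/
def SolvesInCubicTime (P : Cmd) (spec : Instance → State → Prop) : Prop :=
  ∃ K : ℕ, ∀ I : Instance, ∃ (out : State) (t : ℕ),
    Exec I.costs P I.load out t ∧ t ≤ K * I.n ^ 3 ∧ spec I out

end SBatch

/-!
# Correctness and running time of Algorithm MAIN1

Fix a bound `y` and ask for a schedule of minimum makespan among those with all costs below `y`.
The algorithm maintains, for every job `j`, a number `D j` such that `j` is in one of the batches
`1, …, D j` in *every* such schedule, together with batches that are packed greedily under these
numbers (`Greedy`): a job is earlier than `D j` allows only if the later batches up to `D j` are full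
of jobs that are at least as long. An exchange argument (`card_late_le`, `sum_le_sum_of_card_filter_le`)
shows that greedy packing minimizes the completion time of every batch position simultaneously among
all assignments below `D` (`Greedy.finish_le`). Hence, if job `j` in batch `i` violates
`f_j(C(B_i)) < y`, then `j` cannot be in batch `i` or a later one in any schedule with costs below
`y`, and `D j` may be lowered to `i - 1`. Restoring greediness is the task of the chain of exchanges
to the left (`Chain`, `wp_shift`). When no violation is left, the current schedule itself has costs
below `y`, and it has minimum makespan.

The bounds `D` are ghost data and not exactly the candidate set indices in memory: at a violation in
batch `i` the proof also lowers `D x` for every job `x` of an earlier batch with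
`f_x(C(B_i)) ≥ y`, so that jobs which the repair passes over need no separate treatment.

If the algorithm fails because there is no room on the left, then counting jobs shows that no
schedule has costs below `y`. The subtle failure is that of an emptied batch `i`, when all jobs up
to batch `i` have bounds smaller than `i`. From a schedule with costs below `y`, take the part with these jobs,
move it to the right until its last job is in batch `i`, and let the current later batches follow.
The moved jobs keep their costs below `y`, so that the bounds have to hold for the combined
assignment, but its job in batch `i` exceeds its bound (`Instance.Bounds.not_good_of_bounds_lt`).
To make this argument available, the invariant `Instance.Bounds.confines` speaks of assignments that
keep the costs below `y` only in the first batches.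

For the main loop, every found schedule has minimum makespan among the schedules with costs below
the previous maximum cost. So it dominates everything in between, and the previous schedule is
Pareto optimal exactly if the new makespan is larger (`wp_improve`); when the search fails, the last
schedule is optimal for the maximum cost (`wp_conclude`).

The time is bounded with the potential `∑ j, D j ≤ n²`. Every repair takes `O(n)` operations and
lowers it; a call of the auxiliary procedure takes `O(n)` operations beyond that paid for by the
decrease of the potential (`wp_improAux`). From the second iteration on, the bound `y` is attained
by the current schedule, so each iteration decreases the potential and there are `O(n²)` of them.

Programs are treated with weakest preconditions: `WP f c st Q` says that `c`, started in `st`, halts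
in a memory and after a number of operations that satisfy `Q`.
-/

namespace SBatch

open Finset

/-! ### Packing jobs into late batches -/

/-- If, for every threshold `t`, the set `G` has at least as many elements of weight at least `t` as
the set `A`, then `G` is at least as heavy as `A`. -/
theorem sum_le_sum_of_card_filter_le {p : ℕ → ℝ} (A G : Finset ℕ) (hp : ∀ x ∈ G, 0 ≤ p x)
    (h : ∀ t, #{x ∈ A | t ≤ p x} ≤ #{x ∈ G | t ≤ p x}) :
    ∑ x ∈ A, p x ≤ ∑ x ∈ G, p x := by
  induction hm : #A generalizing A G with
  | zero =>
    rw [card_eq_zero] at hm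
    subst hm
    simpa using sum_nonneg hp
  | succ m ih =>
    obtain ⟨x, hx, hmax⟩ := exists_max_image A p (card_pos.mp (by omega))
    have hpos : 0 < #{y ∈ G | p x ≤ p y} :=
      lt_of_lt_of_le (card_pos.mpr ⟨x, by simp [hx]⟩) (h (p x))
    obtain ⟨g₀, hg₀⟩ := card_pos.mp hpos
    rw [mem_filter] at hg₀
    obtain ⟨g, hg, hgmax⟩ := exists_max_image G p ⟨g₀, hg₀.1⟩
    have hxg : p x ≤ p g := hg₀.2.trans (hgmax g₀ hg₀.1)
    rw [← add_sum_erase A p hx, ← add_sum_erase G p hg]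
    refine add_le_add hxg (ih _ _ (fun y hy => hp y (mem_of_mem_erase hy)) (fun t => ?_)
      (by rw [card_erase_of_mem hx]; omega))
    by_cases ht : t ≤ p x
    · rw [filter_erase, filter_erase, card_erase_of_mem (by simp [hx, ht]),
        card_erase_of_mem (by simp [hg, ht.trans hxg])]
      exact Nat.sub_le_sub_right (h t) 1
    · rw [filter_eq_empty_iff.mpr]
      · simp
      · intro y hy hty
        exact ht (hty.trans (hmax y (mem_of_mem_erase hy)))

/-- The jobs with number below `n` that the assignment `a` puts into batch `k`. -/
def batchOf (n : ℕ) (a : ℕ → ℕ) (k : ℕ) : Finset ℕ := {x ∈ range n | a x = k}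

theorem mem_batchOf {n : ℕ} {a : ℕ → ℕ} {k x : ℕ} : x ∈ batchOf n a k ↔ x < n ∧ a x = k := by
  simp [batchOf]

/-- Cardinality form of the optimality of greedy packing. If `pos` leaves a job of `J` below a batch
`c` that the bound `D` would allow only when batch `c` has `b` jobs, then no assignment below `D`
with capacity `b` puts more jobs of `J` into the batches from `k` on. -/
theorem card_late_le {J : Finset ℕ} {n b : ℕ} {pos D a : ℕ → ℕ}
    (hfull : ∀ j ∈ J, ∀ c, pos j < c → c ≤ D j → b ≤ #{x ∈ J | pos x = c})
    (hcap : ∀ c, #{x ∈ J | a x = c} ≤ b) (haD : ∀ j ∈ J, a j ≤ D j) (hD : ∀ j ∈ J, D j ≤ n)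
    (k : ℕ) : #{x ∈ J | k ≤ a x} ≤ #{x ∈ J | k ≤ pos x} := by
  have hsplit : ∀ (f : ℕ → ℕ) (m : ℕ),
      #{x ∈ J | m ≤ f x} = #{x ∈ J | f x = m} + #{x ∈ J | m + 1 ≤ f x} := by
    intro f m
    rw [← card_union_of_disjoint]
    · congr 1
      ext x
      simp only [mem_filter, mem_union]
      grind
    · rw [disjoint_filter]
      intro x _ h1 h2
      omega
  obtain hk | hk := lt_or_ge n k
  · rw [filter_eq_empty_iff.mpr]
    · simp
    · intro x hx h
      have := haD x hx
      have := hD x hx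
      omega
  · induction hd : n - k generalizing k with
    | zero =>
      by_cases h : ∃ j ∈ J, pos j < k ∧ k ≤ D j
      · obtain ⟨j, hj, h1, h2⟩ := h
        rw [hsplit a, hsplit pos]
        have := hfull j hj k h1 h2
        have := hcap k
        have : #{x ∈ J | k + 1 ≤ a x} = 0 := by
          rw [card_eq_zero, filter_eq_empty_iff]
          intro x hx h
          have := haD x hx
          have := hD x hx
          omega
        omega
      · push Not at h
        refine card_le_card fun x hx => ?_
        simp only [mem_filter] at hx ⊢
        refine ⟨hx.1, ?_⟩
        by_contra hlt
        exact absurd (h x hx.1 (by omega)) (by have := haD x hx.1; omega)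
    | succ d ih =>
      by_cases h : ∃ j ∈ J, pos j < k ∧ k ≤ D j
      · obtain ⟨j, hj, h1, h2⟩ := h
        rw [hsplit a, hsplit pos]
        have := hfull j hj k h1 h2
        have := hcap k
        have := ih (k + 1) (by omega) (by omega)
        omega
      · push Not at h
        refine card_le_card fun x hx => ?_
        simp only [mem_filter] at hx ⊢
        refine ⟨hx.1, ?_⟩
        by_contra hlt
        exact absurd (h x hx.1 (by omega)) (by have := haD x hx.1; omega)

/-- The jobs are packed as late as the bounds `D` allow: whenever a job could be moved to a later
batch without exceeding its bound, that batch is full and has no shorter job. The number of jobs in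
batch `k` is `sz k`. -/
structure Greedy (n b : ℕ) (p : ℕ → ℝ) (D sz pos : ℕ → ℕ) : Prop where
  one_le : ∀ j < n, 1 ≤ pos j
  le_bound : ∀ j < n, pos j ≤ D j
  bound_le : ∀ j < n, D j ≤ n
  cap : ∀ k, 1 ≤ k → k ≤ n → sz k ≤ b
  full : ∀ j < n, ∀ k, pos j < k → k ≤ D j → sz k = b ∧ ∀ x < n, pos x = k → p j ≤ p x

/-- An assignment of the jobs to the batches `g + 1, …, n` with capacity `b`. -/
structure Assign (n b : ℕ) (a : ℕ → ℕ) (g : ℕ) : Prop where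
  lt : ∀ j < n, g < a j
  le : ∀ j < n, a j ≤ n
  cap : ∀ k, #(batchOf n a k) ≤ b

/-- `sz` counts the jobs in the batches of `pos`. -/
def Counts (n : ℕ) (sz pos : ℕ → ℕ) : Prop :=
  ∀ k, 1 ≤ k → k ≤ n → sz k = #(batchOf n pos k)

section
variable {n b : ℕ} {p : ℕ → ℝ} {D sz pos a : ℕ → ℕ} {g : ℕ}

theorem Greedy.assign (h : Greedy n b p D sz pos) (hc : Counts n sz pos) : Assign n b pos 0 where
  lt j hj := h.one_le j hj
  le j hj := (h.le_bound j hj).trans (h.bound_le j hj)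
  cap k := by
    by_cases hk : 1 ≤ k ∧ k ≤ n
    · rw [← hc k hk.1 hk.2]
      exact h.cap k hk.1 hk.2
    · have : batchOf n pos k = ∅ := by
        rw [eq_empty_iff_forall_notMem]
        intro x hx
        rw [mem_batchOf] at hx
        have := h.one_le x hx.1
        have := h.le_bound x hx.1
        have := h.bound_le x hx.1
        omega
      simp [this]

theorem Greedy.sum_late_le (h : Greedy n b p D sz pos) (hc : Counts n sz pos)
    (hp : ∀ j, 0 ≤ p j) (ha : Assign n b a g) (haD : ∀ j < n, a j ≤ D j) (k : ℕ) :
    ∑ x ∈ range n with k ≤ a x, p x ≤ ∑ x ∈ range n with k ≤ pos x, p x := by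
  refine sum_le_sum_of_card_filter_le _ _ (fun x _ => hp x) fun t => ?_
  have key := card_late_le (J := {x ∈ range n | t ≤ p x}) (n := n) (b := b) (pos := pos) (D := D)
    (a := a) ?_ ?_ ?_ ?_ k
  · convert key using 2 <;> · ext x; simp only [mem_filter]; tauto
  · intro j hj c h1 h2
    simp only [mem_filter, mem_range] at hj
    obtain ⟨h3, h4⟩ := h.full j hj.1 c h1 h2
    have h5 := hc c (by omega) (h2.trans (h.bound_le j hj.1))
    rw [← h3, h5]
    refine card_le_card fun x hx => ?_
    rw [mem_batchOf] at hx
    simp only [mem_filter, mem_range]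
    exact ⟨⟨hx.1, hj.2.trans (h4 x hx.1 hx.2)⟩, hx.2⟩
  · intro c
    refine (card_le_card fun x hx => ?_).trans (ha.cap c)
    simp only [mem_filter, mem_range] at hx
    exact mem_batchOf.mpr ⟨hx.1.1, hx.2⟩
  · intro j hj
    simp only [mem_filter, mem_range] at hj
    exact haD j hj.1
  · intro j hj
    simp only [mem_filter, mem_range] at hj
    exact h.bound_le j hj.1

theorem Greedy.sum_early_le (h : Greedy n b p D sz pos) (hc : Counts n sz pos)
    (hp : ∀ j, 0 ≤ p j) (ha : Assign n b a g) (haD : ∀ j < n, a j ≤ D j) (i : ℕ) :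
    ∑ x ∈ range n with pos x ≤ i, p x ≤ ∑ x ∈ range n with a x ≤ i, p x := by
  have h1 := h.sum_late_le hc hp ha haD (i + 1)
  have h2 := sum_filter_add_sum_filter_not (range n) (fun x => pos x ≤ i) p
  have h3 := sum_filter_add_sum_filter_not (range n) (fun x => a x ≤ i) p
  simp only [not_le, ← Nat.succ_le_iff, Nat.succ_eq_add_one] at h2 h3
  linarith

/-- An assignment below the bounds needs at least as many batches as the greedy packing. -/
theorem Greedy.lt_of_first (h : Greedy n b p D sz pos) (hc : Counts n sz pos)
    (ha : Assign n b a g) (haD : ∀ j < n, a j ≤ D j) {j : ℕ} (hj : j < n) : g < pos j := by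
  have key := card_late_le (J := range n) (n := n) (b := b) (pos := pos) (D := D)
    (a := a) ?_ ?_ ?_ ?_ (pos j + 1)
  · have h1 : #{x ∈ range n | pos j + 1 ≤ pos x} < #(range n) := by
      refine card_lt_card (Finset.ssubset_iff_subset_ne.mpr ⟨filter_subset _ _, fun he => ?_⟩)
      have : j ∈ ({x ∈ range n | pos j + 1 ≤ pos x} : Finset ℕ) := by rw [he]; simpa using hj
      simp at this
    have h2 : ∃ x ∈ range n, ¬ pos j + 1 ≤ a x := by
      by_contra hcon
      push Not at hcon
      rw [filter_true_of_mem hcon] at key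
      omega
    obtain ⟨x, hx, hxa⟩ := h2
    have := ha.lt x (by simpa using hx)
    omega
  · intro j hj c h1 h2
    simp only [mem_range] at hj
    obtain ⟨h3, h4⟩ := h.full j hj c h1 h2
    have h5 := hc c (by omega) (h2.trans (h.bound_le j hj))
    rw [← h3, h5, batchOf]
  · exact ha.cap
  · simpa using haD
  · simpa using h.bound_le

end

/-! ### Completion times -/

/-- The completion time of batch `k` if the batches from `g + 1` to `k`, each with a setup of length
`s`, are processed without idle time, and `a` assigns the jobs to the batches. -/
noncomputable def slotTime (n : ℕ) (s : ℝ) (p : ℕ → ℝ) (a : ℕ → ℕ) (g k : ℕ) : ℝ :=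
  s * ((k - g : ℕ) : ℝ) + ∑ x ∈ range n with a x ≤ k, p x

/-- The completion time of batch `i` in the schedule without idle time, in which only nonempty
batches have a setup. -/
noncomputable def finish (n : ℕ) (s : ℝ) (p : ℕ → ℝ) (a : ℕ → ℕ) : ℕ → ℝ
  | 0 => 0
  | i + 1 => finish n s p a i + (if (batchOf n a (i + 1)).Nonempty then s else 0) +
      ∑ x ∈ batchOf n a (i + 1), p x

section
variable {n : ℕ} {s : ℝ} {p : ℕ → ℝ} {a : ℕ → ℕ} {g : ℕ}

theorem finish_mono (hs : 0 ≤ s) (hp : ∀ j, 0 ≤ p j) : Monotone (finish n s p a) := by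
  refine monotone_nat_of_le_succ fun i => ?_
  rw [finish]
  have : 0 ≤ ∑ x ∈ batchOf n a (i + 1), p x := sum_nonneg fun x _ => hp x
  split_ifs <;> linarith

theorem finish_nonneg (hs : 0 ≤ s) (hp : ∀ j, 0 ≤ p j) (i : ℕ) : 0 ≤ finish n s p a i :=
  finish_mono (a := a) hs hp (Nat.zero_le i)

theorem slotTime_mono (hs : 0 ≤ s) (hp : ∀ j, 0 ≤ p j) : Monotone (slotTime n s p a g) := by
  intro i k hik
  unfold slotTime
  refine add_le_add (mul_le_mul_of_nonneg_left (by exact_mod_cast Nat.sub_le_sub_right hik g) hs) ?_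
  refine sum_le_sum_of_subset_of_nonneg (fun x hx => ?_) fun x _ _ => hp x
  simp only [mem_filter] at hx ⊢
  exact ⟨hx.1, hx.2.trans hik⟩

theorem slotTime_nonneg (hs : 0 ≤ s) (hp : ∀ j, 0 ≤ p j) (k : ℕ) : 0 ≤ slotTime n s p a g k :=
  add_nonneg (mul_nonneg hs (Nat.cast_nonneg _)) (sum_nonneg fun x _ => hp x)

theorem sum_le_succ (n : ℕ) (p : ℕ → ℝ) (a : ℕ → ℕ) (i : ℕ) :
    ∑ x ∈ range n with a x ≤ i + 1, p x =
      ∑ x ∈ range n with a x ≤ i, p x + ∑ x ∈ batchOf n a (i + 1), p x := by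
  rw [batchOf, ← sum_union]
  · congr 1
    ext x
    simp only [mem_filter, mem_union]
    grind
  · rw [disjoint_filter]
    intro x _ h1 h2
    omega

theorem finish_eq_slotTime (hg : ∀ j < n, g < a j) {m : ℕ}
    (hne : ∀ k, g < k → k ≤ m → (batchOf n a k).Nonempty) :
    finish n s p a m = slotTime n s p a g m := by
  induction m with
  | zero =>
    have : ({x ∈ range n | a x ≤ 0} : Finset ℕ) = ∅ := by
      rw [filter_eq_empty_iff]
      intro x hx h
      have := hg x (by simpa using hx)
      omega
    simp only [finish, slotTime, this]
    simp
  | succ i ih =>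
    have ih := ih fun k h1 h2 => hne k h1 (by omega)
    rw [finish, ih, slotTime, slotTime, sum_le_succ]
    by_cases hi : g < i + 1
    · rw [if_pos (hne _ hi le_rfl), show i + 1 - g = (i - g) + 1 by omega]
      push_cast
      ring
    · have hemp : ¬ (batchOf n a (i + 1)).Nonempty := by
        rintro ⟨x, hx⟩
        rw [mem_batchOf] at hx
        have := hg x hx.1
        omega
      rw [if_neg hemp, show i + 1 - g = 0 by omega, show i - g = 0 by omega]
      ring

end

/-- The nonempty ones among the batches `1, …, n` are the last ones. -/
def Contiguous (n : ℕ) (sz : ℕ → ℕ) : Prop :=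
  ∀ k k', 1 ≤ k → k ≤ k' → k' ≤ n → 0 < sz k → 0 < sz k'

section
variable {n b : ℕ} {s : ℝ} {p : ℕ → ℝ} {D sz pos a : ℕ → ℕ} {g : ℕ}

theorem Contiguous.exists_first (hcon : Contiguous n sz) (hc : Counts n sz pos) (hn : 0 < n)
    (h1 : ∀ j < n, 1 ≤ pos j) (h2 : ∀ j < n, pos j ≤ n) :
    ∃ g, (∀ j < n, g < pos j) ∧ (∃ j < n, pos j = g + 1) ∧
      ∀ k, g < k → k ≤ n → (batchOf n pos k).Nonempty := by
  obtain ⟨j, hj, hmin⟩ := exists_min_image (range n) pos ⟨0, by simpa using hn⟩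
  simp only [mem_range] at hj hmin
  have hj1 := h1 j hj
  have hj2 := h2 j hj
  have hcard : 0 < sz (pos j) := by
    rw [hc _ hj1 hj2, card_pos]
    exact ⟨j, mem_batchOf.mpr ⟨hj, rfl⟩⟩
  refine ⟨pos j - 1, fun x hx => ?_, ⟨j, hj, by omega⟩, fun k hk hkn => ?_⟩
  · have := hmin x hx
    omega
  · rw [← card_pos, ← hc k (by omega) hkn]
    exact hcon (pos j) k hj1 (by omega) hkn hcard

/-- Greedy packing completes every batch as early as possible among the assignments below `D`. -/
theorem Greedy.finish_le (h : Greedy n b p D sz pos) (hc : Counts n sz pos)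
    (hcon : Contiguous n sz) (hn : 0 < n) (hs : 0 ≤ s) (hp : ∀ j, 0 ≤ p j) (ha : Assign n b a g)
    (haD : ∀ j < n, a j ≤ D j) {i : ℕ} (hi : i ≤ n) :
    finish n s p pos i ≤ slotTime n s p a g i := by
  obtain ⟨g', h1, ⟨j, hj, hjg⟩, h3⟩ := hcon.exists_first hc hn h.one_le
    fun j hj => (h.le_bound j hj).trans (h.bound_le j hj)
  rw [finish_eq_slotTime h1 fun k hk hki => h3 k hk (hki.trans hi), slotTime, slotTime]
  have hg : g ≤ g' := by
    have := h.lt_of_first hc ha haD hj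
    omega
  refine add_le_add (mul_le_mul_of_nonneg_left ?_ hs) (h.sum_early_le hc hp ha haD i)
  exact_mod_cast Nat.sub_le_sub_left hg i

end

/-! ### Bounds on the batch numbers of the jobs -/

/-- The processing times, indexed by natural numbers as in memory. -/
noncomputable def Instance.procTime (I : Instance) (j : ℕ) : ℝ :=
  if h : j < I.n then I.p ⟨j, h⟩ else 0

/-- The requirement `f_j(t) < y`; the bound `y` may be infinite. -/
def Instance.Meets (I : Instance) (y : WithTop ℝ) (j : ℕ) (t : ℝ) : Prop :=
  ((I.costs j t : ℝ) : WithTop ℝ) < y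

theorem Instance.procTime_nonneg (I : Instance) (j : ℕ) : 0 ≤ I.procTime j := by
  unfold Instance.procTime
  split_ifs with h
  · exact I.p_nonneg _
  · exact le_rfl

theorem Instance.costs_mono (I : Instance) (j : ℕ) {t t' : ℝ} (h0 : 0 ≤ t) (h : t ≤ t') :
    I.costs j t ≤ I.costs j t' := by
  unfold Instance.costs
  split_ifs with hj
  · exact I.f_regular _ h0 (h0.trans h) h
  · exact le_rfl

theorem Instance.Meets.anti {I : Instance} {y : WithTop ℝ} {j : ℕ} {t t' : ℝ}
    (h : I.Meets y j t') (h0 : 0 ≤ t) (hle : t ≤ t') : I.Meets y j t :=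
  lt_of_le_of_lt (WithTop.coe_le_coe.mpr (I.costs_mono j h0 hle)) h

/-- The assignment `a` to the batches `g + 1, …, n`, processed without idle time, has all costs
below `y`. -/
def Instance.Good (I : Instance) (y : WithTop ℝ) (a : ℕ → ℕ) (g : ℕ) : Prop :=
  Assign I.n I.b a g ∧ ∀ j < I.n, I.Meets y j (slotTime I.n I.s I.procTime a g (a j))

/-- What is known about the numbers `D` when the costs have to be below `y` and the current batches
complete at the times `C`.

The field `confines` says that `D` bounds the batch numbers in every assignment with costs below
`y`. It is stated for assignments that keep the costs below `y` only in the batches `1, …, l` and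
respect `D` in the later ones; the case `l = n` is the one for whole schedules, and smaller `l` are
what shows that failure with an emptied batch is justified. By `early`, the times `C` are lower
bounds for the completion times in every assignment below `D`, and by `stale`, a job misses `y` at
the completion time of every batch beyond its bound. -/
structure Instance.Bounds (I : Instance) (y : WithTop ℝ) (C : ℕ → ℝ) (D : ℕ → ℕ) : Prop where
  nonneg : ∀ k, 0 ≤ C k
  mono : Monotone C
  confines : ∀ a g l, Assign I.n I.b a g →
    (∀ j < I.n, a j ≤ l → I.Meets y j (slotTime I.n I.s I.procTime a g (a j))) →
    (∀ j < I.n, l < a j → a j ≤ D j) → ∀ j < I.n, a j ≤ D j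
  stale : ∀ j < I.n, ∀ k, D j < k → k ≤ I.n → ¬ I.Meets y j (C k)
  early : ∀ a g, Assign I.n I.b a g → (∀ j < I.n, a j ≤ D j) →
    ∀ i ≤ I.n, C i ≤ slotTime I.n I.s I.procTime a g i

/-- The state of the search for a schedule with costs below `y`. -/
structure Instance.Tentative (I : Instance) (y : WithTop ℝ) (C : ℕ → ℝ) (D sz pos : ℕ → ℕ) :
    Prop where
  bounds : I.Bounds y C D
  greedy : Greedy I.n I.b I.procTime D sz pos
  contig : Contiguous I.n sz

section
variable {I : Instance} {y : WithTop ℝ} {C : ℕ → ℝ} {D D' sz pos a : ℕ → ℕ} {g : ℕ}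

theorem Instance.n_pos (I : Instance) : 0 < I.n :=
  lt_of_le_of_lt (Nat.zero_le _) I.b_lt_n

theorem Instance.Bounds.le_of_good (h : I.Bounds y C D) (hg : I.Good y a g) :
    ∀ j < I.n, a j ≤ D j :=
  h.confines a g I.n hg.1 (fun j hj _ => hg.2 j hj)
    fun j hj hlt => absurd (hg.1.le j hj) (by omega)

/-- A bound may be lowered to `i - 1` for a job that misses `y` at the completion time of batch
`i`: in an assignment below the old bounds, batch `i` completes no earlier than it does now. -/
theorem Instance.Bounds.lower (h : I.Bounds y C D) (hle : ∀ j < I.n, D' j ≤ D j)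
    (hD : ∀ j < I.n, D' j < D j → D' j + 1 ≤ I.n ∧ ¬ I.Meets y j (C (D' j + 1))) :
    I.Bounds y C D' where
  nonneg := h.nonneg
  mono := h.mono
  confines a g l ha h1 h2 j hj := by
    have haD := h.confines a g l ha h1 fun j hj hlt => (h2 j hj hlt).trans (hle j hj)
    by_contra hcon
    rw [not_le] at hcon
    have hl : a j ≤ l := by
      by_contra hl
      have := h2 j hj (by omega)
      omega
    obtain ⟨h3, h4⟩ := hD j hj (lt_of_lt_of_le hcon (haD j hj))
    refine h4 ((h1 j hj hl).anti (h.nonneg _) ((h.early a g ha haD _ h3).trans ?_))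
    exact slotTime_mono I.s_nonneg I.procTime_nonneg hcon
  stale j hj k hk hkn := by
    by_cases hlt : D j < k
    · exact h.stale j hj k hlt hkn
    · obtain ⟨h3, h4⟩ := hD j hj (by omega)
      exact fun hm => h4 (hm.anti (h.nonneg _) (h.mono hk))
  early a g ha haD := h.early a g ha fun j hj => (haD j hj).trans (hle j hj)

theorem Instance.Meets.mono {y' : WithTop ℝ} {j : ℕ} {t : ℝ} (h : I.Meets y' j t) (hy : y' ≤ y) :
    I.Meets y j t :=
  lt_of_lt_of_le h hy

theorem Instance.Tentative.mono_bound {y' : WithTop ℝ} (h : I.Tentative y C D sz pos)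
    (hy : y' ≤ y) : I.Tentative y' C D sz pos where
  greedy := h.greedy
  contig := h.contig
  bounds :=
    { nonneg := h.bounds.nonneg
      mono := h.bounds.mono
      confines := fun a g l ha h1 h2 =>
        h.bounds.confines a g l ha (fun j hj hl => (h1 j hj hl).mono hy) h2
      stale := fun j hj k h1 h2 h3 => h.bounds.stale j hj k h1 h2 (h3.mono hy)
      early := h.bounds.early }

/-- `Greedy.finish_le` with the data of an instance. -/
theorem Greedy.finish_le_of_contiguous (h : Greedy I.n I.b I.procTime D sz pos)
    (hcon : Contiguous I.n sz) (hc : Counts I.n sz pos) (ha : Assign I.n I.b a g)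
    (haD : ∀ j < I.n, a j ≤ D j) {i : ℕ} (hi : i ≤ I.n) :
    finish I.n I.s I.procTime pos i ≤ slotTime I.n I.s I.procTime a g i :=
  h.finish_le hc hcon I.n_pos I.s_nonneg I.procTime_nonneg ha haD hi

/-- The knowledge about the bounds remains valid when the completion times are recomputed: by
`early`, applied to the current batches themselves, they can only have grown. -/
theorem Instance.Tentative.reschedule (h : I.Tentative y C D sz pos) (hc : Counts I.n sz pos) :
    I.Tentative y (finish I.n I.s I.procTime pos) D sz pos where
  greedy := h.greedy
  contig := h.contig
  bounds :=
    { nonneg := finish_nonneg I.s_nonneg I.procTime_nonneg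
      mono := finish_mono I.s_nonneg I.procTime_nonneg
      confines := h.bounds.confines
      stale := by
        intro j hj k hk hkn hm
        obtain ⟨g, h1, -, h3⟩ := h.contig.exists_first hc I.n_pos h.greedy.one_le
          fun j hj => (h.greedy.le_bound j hj).trans (h.greedy.bound_le j hj)
        refine h.bounds.stale j hj k hk hkn (hm.anti (h.bounds.nonneg k) ?_)
        rw [finish_eq_slotTime h1 fun m hm hmk => h3 m hm (hmk.trans hkn)]
        exact h.bounds.early pos g ⟨h1, (h.greedy.assign hc).le, (h.greedy.assign hc).cap⟩
          h.greedy.le_bound k hkn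
      early := fun a g ha haD i hi => h.greedy.finish_le_of_contiguous h.contig hc ha haD hi }

/-- With the trivial bounds `n` the greedy packing is a valid start of the search. -/
theorem Greedy.tentative (h : Greedy I.n I.b I.procTime (fun _ => I.n) sz pos)
    (hcon : Contiguous I.n sz) (hc : Counts I.n sz pos) :
    I.Tentative y (finish I.n I.s I.procTime pos) (fun _ => I.n) sz pos where
  greedy := h
  contig := hcon
  bounds :=
    { nonneg := finish_nonneg I.s_nonneg I.procTime_nonneg
      mono := finish_mono I.s_nonneg I.procTime_nonneg
      confines := fun a g l ha _ _ j hj => ha.le j hj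
      stale := fun j hj k hk hkn => by omega
      early := fun a g ha haD i hi => h.finish_le_of_contiguous hcon hc ha haD hi }

/-! ### Why a failure is justified -/

/-- If the jobs of the first `i - 1` full batches and one more job all have bounds below `i`, then
there is no schedule with costs below `y`, because it would have to put all of them into `i - 1`
batches. -/
theorem Instance.Bounds.not_good_of_full (h : I.Bounds y C D) (hc : Counts I.n sz pos)
    (hpos : ∀ q < I.n, 1 ≤ pos q) {i j : ℕ} (hi : i ≤ I.n) (hj : j < I.n) (hji : pos j = i)
    (hD : ∀ q < I.n, pos q < i ∨ q = j → D q < i) (hfull : ∀ k, 1 ≤ k → k < i → sz k = I.b) :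
    ¬ ∃ a g, I.Good y a g := by
  rintro ⟨a, g, hg⟩
  have haD := h.le_of_good hg
  have hmaps : ∀ (f : ℕ → ℕ) (X : Finset ℕ), (∀ q ∈ X, 1 ≤ f q ∧ f q < i) →
      #X = ∑ k ∈ Ico 1 i, #{q ∈ X | f q = k} := fun f X hX =>
    card_eq_sum_card_fiberwise fun q hq => by
      have := hX q hq
      simp only [coe_Ico, Set.mem_Ico]
      exact this
  set X : Finset ℕ := {q ∈ range I.n | pos q < i} with hX
  have hjX : j ∉ X := by simp [hX, hji]
  have h1 : #X = ∑ k ∈ Ico 1 i, I.b := by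
    rw [hmaps pos X]
    · refine sum_congr rfl fun k hk => ?_
      rw [mem_Ico] at hk
      rw [← hfull k hk.1 hk.2, hc k hk.1 (by omega), batchOf]
      congr 1
      ext q
      simp only [hX, mem_filter]
      grind
    · intro q hq
      simp only [hX, mem_filter, mem_range] at hq
      exact ⟨hpos q hq.1, hq.2⟩
  have h2 : #(insert j X) ≤ ∑ k ∈ Ico 1 i, I.b := by
    rw [hmaps a (insert j X)]
    · refine sum_le_sum fun k _ => (card_le_card fun q hq => ?_).trans (hg.1.cap k)
      simp only [hX, mem_filter, mem_insert, mem_range] at hq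
      rw [mem_batchOf]
      rcases hq with ⟨rfl | hq, hk⟩
      · exact ⟨hj, hk⟩
      · exact ⟨hq.1, hk⟩
    · intro q hq
      simp only [hX, mem_filter, mem_insert, mem_range] at hq
      have hqn : q < I.n := by
        rcases hq with rfl | hq
        · exact hj
        · exact hq.1
      have h3 := hD q hqn (by tauto)
      have h4 := haD q hqn
      have h5 := hg.1.lt q hqn
      omega
  rw [card_insert_of_notMem hjX] at h2
  omega

/-- If all jobs of the batches `1, …, i` have bounds below `i`, then there is no schedule with costs
below `y`. Otherwise, in such a schedule, move the jobs of these batches together to the right until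
the last of them is in batch `i`, and put the other jobs where they currently are, behind them. The
moved jobs keep their costs below `y`, since the same number of setups and no additional jobs
precede them. So all bounds are respected, by `confines` with `l = i`, although a job is in batch `i`: a
contradiction. -/
theorem Instance.Bounds.not_good_of_bounds_lt (h : I.Bounds y C D)
    (hpos : Assign I.n I.b pos 0) {i j : ℕ} (hi : i ≤ I.n) (hj : j < I.n) (hji : pos j = i)
    (hD : ∀ q < I.n, pos q ≤ i → D q < i) (hD' : ∀ q < I.n, i < pos q → pos q ≤ D q) :
    ¬ ∃ a g, I.Good y a g := by
  rintro ⟨a, g, hg⟩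
  have haD := h.le_of_good hg
  obtain ⟨u, hu, hmax⟩ := exists_max_image ({q ∈ range I.n | pos q ≤ i} : Finset ℕ) a
    ⟨j, by simp [hj, hji]⟩
  simp only [mem_filter, mem_range, and_imp] at hu hmax
  have hui : a u < i := lt_of_le_of_lt (haD u hu.1) (hD u hu.1 hu.2)
  have hgu := hg.1.lt u hu.1
  obtain ⟨d, hd⟩ : ∃ d, a u + d = i := ⟨i - a u, by omega⟩
  have ha' : Assign I.n I.b (fun q => if pos q ≤ i then a q + d else pos q) (g + d) := by
    refine ⟨fun q hq => ?_, fun q hq => ?_, fun k => ?_⟩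
    · have := hg.1.lt q hq
      split_ifs <;> omega
    · split_ifs with hq'
      · have := hmax q hq hq'
        omega
      · exact hpos.le q hq
    · by_cases hk : k ≤ i
      · refine (card_le_card fun q hq => ?_).trans (hg.1.cap (k - d))
        rw [mem_batchOf] at hq ⊢
        obtain ⟨hq1, hq2⟩ := hq
        refine ⟨hq1, ?_⟩
        split_ifs at hq2 <;> omega
      · refine (card_le_card fun q hq => ?_).trans (hpos.cap k)
        rw [mem_batchOf] at hq ⊢
        obtain ⟨hq1, hq2⟩ := hq
        refine ⟨hq1, ?_⟩
        split_ifs at hq2 with hq3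
        · have := hmax q hq1 hq3
          omega
        · exact hq2
  -- `u` has been moved to batch `i`, beyond its bound
  have key := h.confines _ (g + d) i ha' ?_ ?_ u hu.1
  · have := hD u hu.1 hu.2
    simp only [hu.2, if_true] at key
    omega
  · intro q hq hqi
    by_cases hq' : pos q ≤ i
    · simp only [hq', if_true] at hqi ⊢
      refine (hg.2 q hq).anti (slotTime_nonneg I.s_nonneg I.procTime_nonneg _) ?_
      rw [slotTime, slotTime, show a q + d - (g + d) = a q - g by omega]
      refine add_le_add le_rfl (sum_le_sum_of_subset_of_nonneg (fun x hx => ?_)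
        fun x _ _ => I.procTime_nonneg x)
      simp only [mem_filter] at hx ⊢
      refine ⟨hx.1, ?_⟩
      have := hx.2
      split_ifs at this <;> omega
    · simp only [hq', if_false] at hqi
  · intro q hq hqi
    by_cases hq' : pos q ≤ i
    · simp only [hq', if_true] at hqi
      have := hmax q hq hq'
      omega
    · simp only [hq', if_false]
      exact hD' q hq (by omega)

end

/-! ### Moving jobs to the left -/

open Classical in
/-- The bounds after the job `j` of batch `i` has been found to miss `y`: every job of an earlier
batch that misses `y` at the completion time of batch `i` is bounded by `i - 1` as well. -/
noncomputable def Instance.lowered (I : Instance) (y : WithTop ℝ) (C : ℕ → ℝ) (D pos : ℕ → ℕ)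
    (i j : ℕ) : ℕ → ℕ :=
  fun x => if (x = j ∨ pos x < i) ∧ ¬ I.Meets y x (C i) then min (D x) (i - 1) else D x

/-- The situation while the jobs that are handed on travel to the left. The job `cur` has no batch,
the batches to the right of `c` are settled, and `cur` will end up in batch `c` or in an earlier
one; the last batch to receive a job is batch `e`. All jobs that may come to batch `e` have length
at least `ρ`.

The fields `rest`, `hole` and `gap` are the greedy condition for the jobs that have a batch and for
batches other than `e`, for the job `cur`, and for batch `e`: that batch is short of one job, which
will have length at least `ρ`. -/
structure Chain (n b : ℕ) (p : ℕ → ℝ) (D : ℕ → ℕ) (e : ℕ) (ρ : ℝ) (sz pos : ℕ → ℕ)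
    (cur c : ℕ) : Prop where
  cur_lt : cur < n
  one_le_e : 1 ≤ e
  e_le : e ≤ c
  one_le : ∀ j < n, j ≠ cur → 1 ≤ pos j
  le_bound : ∀ j < n, j ≠ cur → pos j ≤ D j
  cur_le : c ≤ D cur
  bound_le : ∀ j < n, D j ≤ n
  cap : ∀ k, 1 ≤ k → k ≤ n → sz k ≤ b
  room : sz e < b
  mid : ∀ k, e < k → k ≤ c → sz k = b
  rest : ∀ j < n, j ≠ cur → ∀ k, k ≠ e → pos j < k → k ≤ D j →
    sz k = b ∧ ∀ x < n, x ≠ cur → pos x = k → p j ≤ p x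
  hole : ∀ k, c < k → k ≤ D cur → sz k = b ∧ ∀ x < n, x ≠ cur → pos x = k → p cur ≤ p x
  base_cur : ρ ≤ p cur
  base : ∀ x < n, x ≠ cur → e < pos x → pos x ≤ c → ρ ≤ p x
  gap : ∀ j < n, j ≠ cur → pos j < e → e ≤ D j →
    sz e + 1 = b ∧ p j ≤ ρ ∧ ∀ x < n, x ≠ cur → pos x = e → p j ≤ p x

section
variable {n b : ℕ} {p : ℕ → ℝ} {D sz pos : ℕ → ℕ} {e cur c z : ℕ} {ρ : ℝ}

/-- The travelling job is not longer than any job of batch `c` and passes by. -/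
theorem Chain.keep (h : Chain n b p D e ρ sz pos cur c) (hc : e < c)
    (hmin : ∀ x < n, x ≠ cur → pos x = c → p cur ≤ p x) :
    Chain n b p D e ρ sz pos cur (c - 1) where
  cur_lt := h.cur_lt
  one_le_e := h.one_le_e
  e_le := by omega
  one_le := h.one_le
  le_bound := h.le_bound
  cur_le := by have := h.cur_le; omega
  bound_le := h.bound_le
  cap := h.cap
  room := h.room
  mid k h1 h2 := h.mid k h1 (by omega)
  rest := h.rest
  hole k h1 h2 := by
    obtain rfl | hk : k = c ∨ c < k := by omega
    · exact ⟨h.mid k hc le_rfl, hmin⟩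
    · exact h.hole k hk h2
  base_cur := h.base_cur
  base x hx hne h1 h2 := h.base x hx hne h1 (by omega)
  gap := h.gap

/-- The travelling job is exchanged for a shortest job of batch `c`. -/
theorem Chain.swap (h : Chain n b p D e ρ sz pos cur c) (hc : e < c) (hz : z < n) (hzc : z ≠ cur)
    (hpz : pos z = c) (hmin : ∀ x < n, x ≠ cur → pos x = c → p z ≤ p x) (hlt : p z ≤ p cur) :
    Chain n b p D e ρ sz (Function.update pos cur c) z (c - 1) := by
  have hcur : Function.update pos cur c cur = c := Function.update_self ..
  have hne : ∀ x, x ≠ cur → Function.update pos cur c x = pos x :=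
    fun x hx => Function.update_of_ne hx ..
  have hfull := h.mid c hc le_rfl
  have he := h.one_le_e
  refine ⟨hz, he, by omega, ?_, ?_, ?_, h.bound_le, h.cap, h.room, ?_, ?_, ?_, ?_, ?_, ?_⟩
  · intro j hj hjz
    by_cases hjc : j = cur
    · subst hjc; omega
    · rw [hne j hjc]; exact h.one_le j hj hjc
  · intro j hj hjz
    by_cases hjc : j = cur
    · subst hjc; rw [hcur]; exact h.cur_le
    · rw [hne j hjc]; exact h.le_bound j hj hjc
  · have := h.le_bound z hz hzc
    omega
  · exact fun k h1 h2 => h.mid k h1 (by omega)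
  · intro j hj hjz k hke h1 h2
    by_cases hjc : j = cur
    · subst hjc
      rw [hcur] at h1
      obtain ⟨h3, h4⟩ := h.hole k h1 h2
      refine ⟨h3, fun x hx hxz hxk => ?_⟩
      by_cases hxc : x = j
      · rw [hxc]
      · rw [hne x hxc] at hxk
        exact h4 x hx hxc hxk
    · rw [hne j hjc] at h1
      obtain ⟨h3, h4⟩ := h.rest j hj hjc k hke h1 h2
      refine ⟨h3, fun x hx hxz hxk => ?_⟩
      by_cases hxc : x = cur
      · subst hxc
        rw [hcur] at hxk
        subst hxk
        exact (h4 z hz hzc hpz).trans hlt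
      · rw [hne x hxc] at hxk
        exact h4 x hx hxc hxk
  · intro k h1 h2
    obtain rfl | hk : k = c ∨ c < k := by omega
    · refine ⟨hfull, fun x hx hxz hxk => ?_⟩
      by_cases hxc : x = cur
      · rw [hxc]; exact hlt
      · rw [hne x hxc] at hxk
        exact hmin x hx hxc hxk
    · obtain ⟨h3, h4⟩ := h.rest z hz hzc k (by omega) (by omega) h2
      refine ⟨h3, fun x hx hxz hxk => ?_⟩
      by_cases hxc : x = cur
      · subst hxc; omega
      · rw [hne x hxc] at hxk
        exact h4 x hx hxc hxk
  · exact h.base z hz hzc (by omega) (by omega)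
  · intro x hx hxz h1 h2
    by_cases hxc : x = cur
    · subst hxc; omega
    · rw [hne x hxc] at h1 h2
      exact h.base x hx hxc h1 (by omega)
  · intro j hj hjz h1 h2
    by_cases hjc : j = cur
    · subst hjc; omega
    · rw [hne j hjc] at h1
      obtain ⟨h3, h4, h5⟩ := h.gap j hj hjc h1 h2
      refine ⟨h3, h4, fun x hx hxz hxe => ?_⟩
      by_cases hxc : x = cur
      · subst hxc; omega
      · rw [hne x hxc] at hxe
        exact h5 x hx hxc hxe

/-- When the travelling job is put into batch `e`, the packing is greedy again. -/
theorem Chain.greedy (h : Chain n b p D e ρ sz pos cur e) :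
    Greedy n b p D (Function.update sz e (sz e + 1)) (Function.update pos cur e) := by
  have hcur : Function.update pos cur e cur = e := Function.update_self ..
  have hne : ∀ x, x ≠ cur → Function.update pos cur e x = pos x :=
    fun x hx => Function.update_of_ne hx ..
  refine ⟨?_, ?_, h.bound_le, ?_, ?_⟩
  · intro j hj
    by_cases hjc : j = cur
    · subst hjc; rw [hcur]; exact h.one_le_e
    · rw [hne j hjc]; exact h.one_le j hj hjc
  · intro j hj
    by_cases hjc : j = cur
    · subst hjc; rw [hcur]; exact h.cur_le
    · rw [hne j hjc]; exact h.le_bound j hj hjc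
  · intro k h1 h2
    by_cases hk : k = e
    · subst hk; rw [Function.update_self]; exact h.room
    · rw [Function.update_of_ne hk]; exact h.cap k h1 h2
  · intro j hj k h1 h2
    by_cases hk : k = e
    · subst hk
      rw [Function.update_self]
      have hjc : j ≠ cur := by rintro rfl; omega
      rw [hne j hjc] at h1
      obtain ⟨h3, h4, h5⟩ := h.gap j hj hjc h1 h2
      refine ⟨h3, fun x hx hxk => ?_⟩
      by_cases hxc : x = cur
      · subst hxc; exact h4.trans h.base_cur
      · rw [hne x hxc] at hxk
        exact h5 x hx hxc hxk
    · rw [Function.update_of_ne hk]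
      have key : sz k = b ∧ ∀ x < n, x ≠ cur → pos x = k → p j ≤ p x := by
        by_cases hjc : j = cur
        · subst hjc; rw [hcur] at h1; exact h.hole k h1 h2
        · rw [hne j hjc] at h1; exact h.rest j hj hjc k hk h1 h2
      refine ⟨key.1, fun x hx hxk => ?_⟩
      by_cases hxc : x = cur
      · subst hxc; omega
      · rw [hne x hxc] at hxk
        exact key.2 x hx hxc hxk

end

section
variable {I : Instance} {y : WithTop ℝ} {C : ℕ → ℝ} {D sz pos : ℕ → ℕ} {i j e x : ℕ}

theorem Instance.lowered_le (q : ℕ) : I.lowered y C D pos i j q ≤ D q := by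
  unfold Instance.lowered
  split_ifs
  · exact min_le_left _ _
  · exact le_rfl

theorem Instance.lowered_self (hji : i ≤ D j) (hm : ¬ I.Meets y j (C i)) :
    I.lowered y C D pos i j j = i - 1 := by
  unfold Instance.lowered
  rw [if_pos ⟨Or.inl rfl, hm⟩]
  omega

theorem Instance.lowered_of_lt {q : ℕ} (hq : q ≠ j) (hi : i ≤ pos q) :
    I.lowered y C D pos i j q = D q := by
  unfold Instance.lowered
  rw [if_neg]
  rintro ⟨h | h, -⟩
  · exact hq h
  · omega

theorem Instance.Bounds.lowered (h : I.Bounds y C D) (hi1 : 1 ≤ i) (hi : i ≤ I.n) :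
    I.Bounds y C (I.lowered y C D pos i j) := by
  refine h.lower (fun q _ => I.lowered_le q) fun q _ hlt => ?_
  unfold Instance.lowered at hlt ⊢
  split_ifs at hlt ⊢ with hq
  · have : min (D q) (i - 1) + 1 = i := by omega
    rw [this]
    exact ⟨hi, hq.2⟩
  · omega

theorem Greedy.lowered_ge (h : Greedy I.n I.b I.procTime D sz pos) {q : ℕ} (hq : q < I.n)
    (hqj : q ≠ j) : pos q ≤ I.lowered y C D pos i j q := by
  have := h.le_bound q hq
  unfold Instance.lowered
  split_ifs with hc
  · obtain ⟨h1 | h1, -⟩ := hc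
    · exact absurd h1 hqj
    · omega
  · exact this

theorem Instance.meets_of_le_lowered {q : ℕ} (hq : q = j ∨ pos q < i) (hi : 1 ≤ i)
    (h : i ≤ I.lowered y C D pos i j q) : I.Meets y q (C i) := by
  by_contra hm
  unfold Instance.lowered at h
  rw [if_pos ⟨hq, hm⟩] at h
  omega

/-- The start of the moves to the left if no job of an earlier batch can replace `j` in batch `i`;
batch `e` is the last one before batch `i` that is not full. -/
theorem Greedy.chain_of_forall_not_meets (h : Greedy I.n I.b I.procTime D sz pos)
    (hj : j < I.n) (hji : pos j = i) (he1 : 1 ≤ e) (hei : e < i)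
    (hm : ¬ I.Meets y j (C i)) (hall : ∀ q < I.n, pos q < i → ¬ I.Meets y q (C i))
    (he : sz e < I.b) (hmid : ∀ k, e < k → k < i → sz k = I.b) :
    Chain I.n I.b I.procTime (I.lowered y C D pos i j) e 0
      (Function.update sz i (sz i - 1)) pos j (i - 1) := by
  have hle : ∀ q, I.lowered y C D pos i j q ≤ D q := fun q => I.lowered_le q
  have hDj : I.lowered y C D pos i j j = i - 1 :=
    I.lowered_self (hji ▸ h.le_bound j hj) hm
  have hsz : ∀ k, k ≠ i → Function.update sz i (sz i - 1) k = sz k :=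
    fun k hk => Function.update_of_ne hk ..
  refine ⟨hj, he1, by omega, fun q hq _ => h.one_le q hq, fun q hq hqj => h.lowered_ge hq hqj,
    hDj.ge, fun q hq => (hle q).trans (h.bound_le q hq), ?_, ?_, ?_, ?_, ?_,
    I.procTime_nonneg j, fun q _ _ _ _ => I.procTime_nonneg q, ?_⟩
  · intro k h1 h2
    by_cases hk : k = i
    · subst hk
      rw [Function.update_self]
      have := h.cap k h1 h2
      omega
    · rw [hsz k hk]; exact h.cap k h1 h2
  · rw [hsz e (by omega)]; exact he
  · intro k h1 h2
    rw [hsz k (by omega)]; exact hmid k h1 (by omega)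
  · intro q hq hqj k hke h1 h2
    obtain ⟨h3, h4⟩ := h.full q hq k h1 (h2.trans (hle q))
    -- no earlier job may enter batch `i`, so it does not matter that this batch has lost a job
    have hk : k ≠ i := by
      rintro rfl
      exact hall q hq h1 (I.meets_of_le_lowered (Or.inr h1) (by omega) h2)
    rw [hsz k hk]
    exact ⟨h3, fun x hx _ hxk => h4 x hx hxk⟩
  · intro k h1 h2
    omega
  · -- no job may enter batch `e`, since it was not full before
    intro q hq hqj h1 h2
    have := (h.full q hq e h1 (h2.trans (hle q))).1
    omega

/-- The start of the moves to the left if `x`, a longest job of the earlier batches that can replace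
`j` in batch `i`, has been moved there from its batch `e`. The jobs that travel to the left are not
shorter than `x`, because `x` could not enter their batches. -/
theorem Greedy.chain_of_meets (h : Greedy I.n I.b I.procTime D sz pos) (hstale : I.Bounds y C D)
    (hi : i ≤ I.n) (hj : j < I.n) (hji : pos j = i) (hm : ¬ I.Meets y j (C i)) (hx : x < I.n)
    (hxi : pos x < i) (hxm : I.Meets y x (C i))
    (hmax : ∀ q < I.n, pos q < i → I.Meets y q (C i) → I.procTime q ≤ I.procTime x)
    (hpos : 0 < sz (pos x)) :
    Chain I.n I.b I.procTime (I.lowered y C D pos i j) (pos x) (I.procTime x)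
      (Function.update sz (pos x) (sz (pos x) - 1)) (Function.update pos x i) j (i - 1) := by
  have hle : ∀ q, I.lowered y C D pos i j q ≤ D q := fun q => I.lowered_le q
  have hDj : I.lowered y C D pos i j j = i - 1 :=
    I.lowered_self (hji ▸ h.le_bound j hj) hm
  -- `x` is not beyond its bound in batch `i`, because a job misses `y` in all batches beyond it
  have hxD : i ≤ D x := by
    by_contra hlt
    exact hstale.stale x hx i (by omega) hi hxm
  have hxj : x ≠ j := by rintro rfl; omega
  have hDx : I.lowered y C D pos i j x = D x := by
    unfold Instance.lowered
    rw [if_neg]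
    exact fun hc => hc.2 hxm
  have hsz : ∀ k, k ≠ pos x → Function.update sz (pos x) (sz (pos x) - 1) k = sz k :=
    fun k hk => Function.update_of_ne hk ..
  have hps : ∀ q, q ≠ x → Function.update pos x i q = pos q :=
    fun q hq => Function.update_of_ne hq ..
  have hpx : Function.update pos x i x = i := Function.update_self ..
  have hx1 := h.one_le x hx
  have hcapx := h.cap (pos x) hx1 (by omega)
  refine ⟨hj, hx1, by omega, ?_, ?_, hDj.ge, fun q hq => (hle q).trans (h.bound_le q hq), ?_, ?_,
    ?_, ?_, ?_, ?_, ?_, ?_⟩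
  · intro q hq hqj
    by_cases hqx : q = x
    · subst hqx; omega
    · rw [hps q hqx]; exact h.one_le q hq
  · intro q hq hqj
    by_cases hqx : q = x
    · subst hqx; rw [hpx, hDx]; exact hxD
    · rw [hps q hqx]; exact h.lowered_ge hq hqj
  · intro k h1 h2
    by_cases hk : k = pos x
    · subst hk
      rw [Function.update_self]
      omega
    · rw [hsz k hk]; exact h.cap k h1 h2
  · rw [Function.update_self]; omega
  · intro k h1 h2
    rw [hsz k (by omega)]
    exact (h.full x hx k h1 (by omega)).1
  · intro q hq hqj k hke h1 h2
    rw [hsz k hke]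
    have hqk : pos q < k := by
      by_cases hqx : q = x
      · subst hqx; omega
      · rwa [hps q hqx] at h1
    obtain ⟨h3, h4⟩ := h.full q hq k hqk (h2.trans (hle q))
    refine ⟨h3, fun w hw hwj hwk => ?_⟩
    by_cases hwx : w = x
    · -- a job that may still enter batch `i` meets `y` there, and `x` was a longest one of these
      subst hwx
      rw [hpx] at hwk
      subst hwk
      exact hmax q hq hqk (I.meets_of_le_lowered (Or.inr hqk) (by omega) h2)
    · rw [hps w hwx] at hwk
      exact h4 w hw hwk
  · intro k h1 h2
    omega
  · exact (h.full x hx i hxi hxD).2 j hj hji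
  · intro q hq hqj h1 h2
    by_cases hqx : q = x
    · rw [hqx]
    · rw [hps q hqx] at h1 h2
      exact (h.full x hx (pos q) h1 (by omega)).2 q hq rfl
  · intro q hq hqj h1 h2
    have hqx : q ≠ x := by
      rintro rfl
      omega
    rw [hps q hqx] at h1
    obtain ⟨h3, h4⟩ := h.full q hq (pos x) h1 (h2.trans (hle q))
    refine ⟨?_, h4 x hx rfl, fun w hw hwj hwk => ?_⟩
    · rw [Function.update_self]; omega
    · by_cases hwx : w = x
      · subst hwx; omega
      · rw [hps w hwx] at hwk
        exact h4 w hw hwk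

end

/-! ### A program logic with running times -/

/-- The program `c`, started in memory `st`, halts, and the final memory and the number of
elementary operations satisfy `Q`. -/
def WP (f : ℕ → ℝ → ℝ) (c : Cmd) (st : State) (Q : State → ℕ → Prop) : Prop :=
  ∃ st' t, Exec f c st st' t ∧ Q st' t

section
variable {f : ℕ → ℝ → ℝ} {st : State} {Q : State → ℕ → Prop}

theorem WP.imp {c : Cmd} {Q' : State → ℕ → Prop} (h : WP f c st Q)
    (hQ : ∀ s t, Q s t → Q' s t) : WP f c st Q' := by
  obtain ⟨s, t, h1, h2⟩ := h
  exact ⟨s, t, h1, hQ s t h2⟩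

theorem wp_skip : WP f .skip st Q ↔ Q st 1 := by
  constructor
  · rintro ⟨s, t, h, hQ⟩
    cases h
    exact hQ
  · exact fun h => ⟨_, _, .skip st, h⟩

theorem wp_nset {v : NVar} {e : NExp} :
    WP f (.nset v e) st Q ↔ Q (st.setN v (e.eval st)) (e.ops + 1) := by
  constructor
  · rintro ⟨s, t, h, hQ⟩
    cases h
    exact hQ
  · exact fun h => ⟨_, _, .nset st v e, h⟩

theorem wp_nput {a : NArr} {i j e : NExp} :
    WP f (.nput a i j e) st Q ↔
      Q (st.putN a (i.eval st) (j.eval st) (e.eval st)) (i.ops + j.ops + e.ops + 1) := by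
  constructor
  · rintro ⟨s, t, h, hQ⟩
    cases h
    exact hQ
  · exact fun h => ⟨_, _, .nput st a i j e, h⟩

theorem wp_rset {v : RVar} {e : RExp} :
    WP f (.rset v e) st Q ↔ Q (st.setR v (e.eval f st)) (e.ops + 1) := by
  constructor
  · rintro ⟨s, t, h, hQ⟩
    cases h
    exact hQ
  · exact fun h => ⟨_, _, .rset st v e, h⟩

theorem wp_rput {a : RArr} {i j : NExp} {e : RExp} :
    WP f (.rput a i j e) st Q ↔
      Q (st.putR a (i.eval st) (j.eval st) (e.eval f st)) (i.ops + j.ops + e.ops + 1) := by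
  constructor
  · rintro ⟨s, t, h, hQ⟩
    cases h
    exact hQ
  · exact fun h => ⟨_, _, .rput st a i j e, h⟩

theorem wp_seq {c₁ c₂ : Cmd} :
    WP f (.seq c₁ c₂) st Q ↔
      WP f c₁ st fun s t => WP f c₂ s fun s' t' => Q s' (t + t') := by
  constructor
  · rintro ⟨s, t, h, hQ⟩
    cases h with
    | seq h1 h2 => exact ⟨_, _, h1, _, _, h2, hQ⟩
  · rintro ⟨s, t, h1, s', t', h2, hQ⟩
    exact ⟨_, _, .seq h1 h2, hQ⟩

theorem wp_cond {b : BExp} {c₁ c₂ : Cmd} :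
    WP f (.cond b c₁ c₂) st Q ↔
      (b.holds f st → WP f c₁ st fun s t => Q s (b.ops + 1 + t)) ∧
      (¬ b.holds f st → WP f c₂ st fun s t => Q s (b.ops + 1 + t)) := by
  constructor
  · rintro ⟨s, t, h, hQ⟩
    cases h with
    | cond_true hb h => exact ⟨fun _ => ⟨_, _, h, hQ⟩, fun h' => absurd hb h'⟩
    | cond_false hb h => exact ⟨fun h' => absurd h' hb, fun _ => ⟨_, _, h, hQ⟩⟩
  · rintro ⟨h1, h2⟩
    by_cases hb : b.holds f st
    · obtain ⟨s, t, h, hQ⟩ := h1 hb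
      exact ⟨s, _, .cond_true hb h, hQ⟩
    · obtain ⟨s, t, h, hQ⟩ := h2 hb
      exact ⟨s, _, .cond_false hb h, hQ⟩

/-- The rule for loops: `Inv s t` is the invariant when memory `s` has been reached after `t`
operations, and `m` decreases. -/
theorem WP.loop {b : BExp} {c : Cmd} (Inv : State → ℕ → Prop) (m : State → ℕ) (h0 : Inv st 0)
    (step : ∀ s t, Inv s t → b.holds f s →
      WP f c s fun s' t' => Inv s' (t + (b.ops + 1 + t')) ∧ m s' < m s)
    (exit : ∀ s t, Inv s t → ¬ b.holds f s → Q s (t + (b.ops + 1))) :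
    WP f (.loop b c) st Q := by
  have key : ∀ (k : ℕ) (s : State) (t : ℕ), m s = k → Inv s t →
      WP f (.loop b c) s fun s' t' => Q s' (t + t') := by
    intro k
    induction k using Nat.strong_induction_on with
    | _ k ih =>
      intro s t hk hI
      by_cases hb : b.holds f s
      · obtain ⟨s₁, t₁, h1, h2, h3⟩ := step s t hI hb
        obtain ⟨s₂, t₂, h4, h5⟩ := ih (m s₁) (hk ▸ h3) s₁ _ rfl h2
        refine ⟨s₂, _, .loop_step hb h1 h4, ?_⟩
        simpa only [add_assoc] using h5
      · exact ⟨s, _, .loop_done hb, exit s t hI hb⟩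
  simpa using key _ st 0 rfl h0

/-- The rule for loops without a variant: since every pass takes time, a bound on the time implies
that the loop halts. -/
theorem WP.loop_of_le {b : BExp} {c : Cmd} (Inv : State → ℕ → Prop) (T : ℕ)
    (hT : ∀ s t, Inv s t → t ≤ T) (h0 : Inv st 0)
    (step : ∀ s t, Inv s t → b.holds f s → WP f c s fun s' t' => Inv s' (t + (b.ops + 1 + t')))
    (exit : ∀ s t, Inv s t → ¬ b.holds f s → Q s (t + (b.ops + 1))) :
    WP f (.loop b c) st Q := by
  have key : ∀ (k : ℕ) (s : State) (t : ℕ), T - t = k → Inv s t →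
      WP f (.loop b c) s fun s' t' => Q s' (t + t') := by
    intro k
    induction k using Nat.strong_induction_on with
    | _ k ih =>
      intro s t hk hI
      by_cases hb : b.holds f s
      · obtain ⟨s₁, t₁, h1, h2⟩ := step s t hI hb
        have := hT _ _ h2
        obtain ⟨s₂, t₂, h4, h5⟩ := ih (T - (t + (b.ops + 1 + t₁))) (by omega) s₁ _ rfl h2
        refine ⟨s₂, _, .loop_step hb h1 h4, ?_⟩
        simpa only [add_assoc] using h5
      · exact ⟨s, _, .loop_done hb, exit s t hI hb⟩
  simpa using key _ st 0 rfl h0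

/-- The rule for "for" loops whose body takes at most `τ` operations: `Inv k` holds before the pass
with counter `k`. -/
theorem WP.forUp {v : NVar} {bound : NExp} {body : Cmd} (N τ : ℕ) (Inv : ℕ → State → Prop)
    (h0 : Inv 0 (st.setN v 0))
    (hv : ∀ k s, Inv k s → s.nv v = k ∧ bound.eval s = N)
    (step : ∀ k s, k < N → Inv k s →
      WP f body s fun s' t' => Inv (k + 1) (s'.setN v (s'.nv v + 1)) ∧ t' ≤ τ)
    (exit : ∀ s t, Inv N s → t ≤ (N + 1) * (bound.ops + τ + 7) → Q s t) :
    WP f (SBatch.forUp v bound body) st Q := by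
  rw [SBatch.forUp, wp_seq, wp_nset]
  refine WP.loop (fun s t => ∃ k ≤ N, Inv k s ∧ t ≤ k * (bound.ops + τ + 7))
    (fun s => N - s.nv v) ⟨0, Nat.zero_le _, h0, by omega⟩ ?_ ?_
  · rintro s t ⟨k, hk, hI, ht⟩ hb
    obtain ⟨h1, h2⟩ := hv k s hI
    have hkN : k < N := by
      change s.nv v < bound.eval s at hb
      omega
    rw [wp_seq]
    refine (step k s hkN hI).imp ?_
    rintro s' t' ⟨h3, h4⟩
    rw [wp_nset]
    obtain ⟨h5, h6⟩ := hv _ _ h3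
    refine ⟨⟨k + 1, hkN, h3, ?_⟩, ?_⟩
    · change t + (1 + bound.ops + 1 + 1 + (t' + (1 + 1 + 1 + 1))) ≤ _
      rw [Nat.add_mul]
      omega
    · change N - (s'.setN v (s'.nv v + 1)).nv v < _
      omega
  · rintro s t ⟨k, hk, hI, ht⟩ hb
    obtain ⟨h1, h2⟩ := hv k s hI
    have hkN : k = N := by
      change ¬ s.nv v < bound.eval s at hb
      omega
    subst hkN
    refine exit s _ hI ?_
    change 1 + 1 + (t + (1 + bound.ops + 1 + 1)) ≤ _
    rw [Nat.add_mul]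
    omega

end

theorem NExp.eval_ofNat (st : State) (m : ℕ) : NExp.eval st (OfNat.ofNat m : NExp) = m := rfl

theorem NExp.ops_ofNat (m : ℕ) : NExp.ops (OfNat.ofNat m : NExp) = 1 := rfl

attribute [simp] NExp.eval NExp.ops RExp.eval RExp.ops BExp.holds BExp.ops NExp.eval_ofNat
  NExp.ops_ofNat

section
variable (st : State)

@[simp] theorem State.setN_nv (v w : NVar) (m : ℕ) :
    (st.setN v m).nv w = if w = v then m else st.nv w := rfl
@[simp] theorem State.setN_na (v : NVar) (m : ℕ) : (st.setN v m).na = st.na := rfl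
@[simp] theorem State.setN_rv (v : NVar) (m : ℕ) : (st.setN v m).rv = st.rv := rfl
@[simp] theorem State.setN_ra (v : NVar) (m : ℕ) : (st.setN v m).ra = st.ra := rfl
@[simp] theorem State.setR_rv (v w : RVar) (m : ℝ) :
    (st.setR v m).rv w = if w = v then m else st.rv w := rfl
@[simp] theorem State.setR_nv (v : RVar) (m : ℝ) : (st.setR v m).nv = st.nv := rfl
@[simp] theorem State.setR_na (v : RVar) (m : ℝ) : (st.setR v m).na = st.na := rfl
@[simp] theorem State.setR_ra (v : RVar) (m : ℝ) : (st.setR v m).ra = st.ra := rfl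
@[simp] theorem State.putN_na (a a' : NArr) (i j i' j' m : ℕ) :
    (st.putN a i j m).na a' i' j' = if a' = a ∧ i' = i ∧ j' = j then m else st.na a' i' j' := rfl
@[simp] theorem State.putN_nv (a : NArr) (i j m : ℕ) : (st.putN a i j m).nv = st.nv := rfl
@[simp] theorem State.putN_rv (a : NArr) (i j m : ℕ) : (st.putN a i j m).rv = st.rv := rfl
@[simp] theorem State.putN_ra (a : NArr) (i j m : ℕ) : (st.putN a i j m).ra = st.ra := rfl
@[simp] theorem State.putR_ra (a a' : RArr) (i j i' j' : ℕ) (m : ℝ) :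
    (st.putR a i j m).ra a' i' j' = if a' = a ∧ i' = i ∧ j' = j then m else st.ra a' i' j' := rfl
@[simp] theorem State.putR_nv (a : RArr) (i j : ℕ) (m : ℝ) : (st.putR a i j m).nv = st.nv := rfl
@[simp] theorem State.putR_na (a : RArr) (i j : ℕ) (m : ℝ) : (st.putR a i j m).na = st.na := rfl
@[simp] theorem State.putR_rv (a : RArr) (i j : ℕ) (m : ℝ) : (st.putR a i j m).rv = st.rv := rfl

end

/-- The memory `st'` agrees with `st` except possibly for the listed registers and arrays. -/
structure Keeps (N : List NVar) (A : List NArr) (R : List RVar) (B : List RArr)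
    (st st' : State) : Prop where
  nv : ∀ v, v ∉ N → st'.nv v = st.nv v
  na : ∀ a, a ∉ A → st'.na a = st.na a
  rv : ∀ v, v ∉ R → st'.rv v = st.rv v
  ra : ∀ a, a ∉ B → st'.ra a = st.ra a

section
variable {N N' : List NVar} {A A' : List NArr} {R R' : List RVar} {B B' : List RArr}
  {st st' st'' : State}

theorem Keeps.refl (st : State) : Keeps N A R B st st :=
  ⟨fun _ _ => rfl, fun _ _ => rfl, fun _ _ => rfl, fun _ _ => rfl⟩

theorem Keeps.trans (h : Keeps N A R B st st') (h' : Keeps N A R B st' st'') :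
    Keeps N A R B st st'' :=
  ⟨fun v hv => (h'.nv v hv).trans (h.nv v hv), fun v hv => (h'.na v hv).trans (h.na v hv),
    fun v hv => (h'.rv v hv).trans (h.rv v hv), fun v hv => (h'.ra v hv).trans (h.ra v hv)⟩

theorem Keeps.mono (h : Keeps N A R B st st') (hN : N ⊆ N') (hA : A ⊆ A') (hR : R ⊆ R')
    (hB : B ⊆ B') : Keeps N' A' R' B' st st' :=
  ⟨fun v hv => h.nv v fun hv' => hv (hN hv'), fun v hv => h.na v fun hv' => hv (hA hv'),
    fun v hv => h.rv v fun hv' => hv (hR hv'), fun v hv => h.ra v fun hv' => hv (hB hv')⟩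

theorem Keeps.setN (h : Keeps N A R B st st') {v : NVar} (hv : v ∈ N) (m : ℕ) :
    Keeps N A R B st (st'.setN v m) :=
  ⟨fun w hw => by
    rw [State.setN_nv, if_neg (by rintro rfl; exact hw hv), h.nv w hw], h.na, h.rv, h.ra⟩

theorem Keeps.setR (h : Keeps N A R B st st') {v : RVar} (hv : v ∈ R) (m : ℝ) :
    Keeps N A R B st (st'.setR v m) :=
  ⟨h.nv, h.na, fun w hw => by
    rw [State.setR_rv, if_neg (by rintro rfl; exact hw hv), h.rv w hw], h.ra⟩

theorem Keeps.putN (h : Keeps N A R B st st') {a : NArr} (ha : a ∈ A) (i j m : ℕ) :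
    Keeps N A R B st (st'.putN a i j m) :=
  ⟨h.nv, fun w hw => by
    funext i' j'
    rw [State.putN_na, if_neg (by rintro ⟨rfl, -⟩; exact hw ha), h.na w hw], h.rv, h.ra⟩

theorem Keeps.putR (h : Keeps N A R B st st') {a : RArr} (ha : a ∈ B) (i j : ℕ) (m : ℝ) :
    Keeps N A R B st (st'.putR a i j m) :=
  ⟨h.nv, h.na, h.rv, fun w hw => by
    funext i' j'
    rw [State.putR_ra, if_neg (by rintro ⟨rfl, -⟩; exact hw ha), h.ra w hw]⟩

end

/-! ### The memory layout of the batches -/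

/-- The batches `1, …, n` as held in memory: batch `i` consists of the jobs `slot i r` with
`r < sz i`, and `pos` is the inverse. The job `cur` is in no batch; `cur = n` means that every job
is in a batch. -/
structure Layout (n cur : ℕ) (pos sz : ℕ → ℕ) (slot : ℕ → ℕ → ℕ) : Prop where
  mem : ∀ i, 1 ≤ i → i ≤ n → ∀ r < sz i, slot i r < n ∧ slot i r ≠ cur ∧ pos (slot i r) = i
  inj : ∀ i, 1 ≤ i → i ≤ n → ∀ r < sz i, ∀ r' < sz i, slot i r = slot i r' → r = r'
  surj : ∀ q < n, q ≠ cur → 1 ≤ pos q ∧ pos q ≤ n ∧ ∃ r < sz (pos q), slot (pos q) r = q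

/-- The table `slot` with entry `(i, r)` replaced by `m`. -/
def put2 (slot : ℕ → ℕ → ℕ) (i r m : ℕ) : ℕ → ℕ → ℕ :=
  fun i' r' => if i' = i ∧ r' = r then m else slot i' r'

theorem put2_row (slot : ℕ → ℕ → ℕ) (i r m : ℕ) :
    put2 slot i r m i = Function.update (slot i) r m := by
  funext r'
  simp [put2, Function.update_apply]

theorem put2_of_ne {slot : ℕ → ℕ → ℕ} {i i' : ℕ} (h : i' ≠ i) (r m : ℕ) :
    put2 slot i r m i' = slot i' := by
  funext r'
  simp [put2, h]

theorem put2_comm {slot : ℕ → ℕ → ℕ} {i i' : ℕ} (h : i' ≠ i) (r r' m m' : ℕ) :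
    put2 (put2 slot i r m) i' r' m' = put2 (put2 slot i' r' m') i r m := by
  funext k l
  unfold put2
  grind

theorem State.putN_table (st : State) (a : NArr) (i j m : ℕ) :
    (st.putN a i j m).na a = put2 (st.na a) i j m := by
  funext i' j'
  simp [put2]

theorem State.putN_of_ne (st : State) {a a' : NArr} (h : a' ≠ a) (i j m : ℕ) :
    (st.putN a i j m).na a' = st.na a' := by
  funext i' j'
  simp [h]

section
variable {n cur : ℕ} {pos sz : ℕ → ℕ} {slot : ℕ → ℕ → ℕ} {i r x : ℕ}

theorem Layout.card_eq (h : Layout n cur pos sz slot) {k : ℕ} (h1 : 1 ≤ k) (h2 : k ≤ n) :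
    sz k = #{x ∈ batchOf n pos k | x ≠ cur} := by
  have : ({x ∈ batchOf n pos k | x ≠ cur} : Finset ℕ) = (range (sz k)).image (slot k) := by
    ext x
    simp only [mem_filter, mem_batchOf, mem_image, mem_range]
    constructor
    · rintro ⟨⟨hx, rfl⟩, hne⟩
      exact (h.surj x hx hne).2.2
    · rintro ⟨r, hr, rfl⟩
      obtain ⟨h3, h4, h5⟩ := h.mem k h1 h2 r hr
      exact ⟨⟨h3, h5⟩, h4⟩
  rw [this, card_image_of_injOn, card_range]
  intro r hr r' hr' he
  simp only [coe_range, Set.mem_Iio] at hr hr'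
  exact h.inj k h1 h2 r hr r' hr' he

theorem Layout.counts (h : Layout n n pos sz slot) : Counts n sz pos := by
  intro k h1 h2
  rw [h.card_eq h1 h2, filter_true_of_mem]
  intro x hx
  exact (mem_batchOf.mp hx).1.ne

theorem Layout.sum_le (h : Layout n cur pos sz slot) {l m : ℕ} (hm : m ≤ n) :
    ∑ k ∈ Ioc l m, sz k ≤ n := by
  calc ∑ k ∈ Ioc l m, sz k = ∑ k ∈ Ioc l m, #{x ∈ range n | x ≠ cur ∧ pos x = k} := by
        refine sum_congr rfl fun k hk => ?_
        rw [mem_Ioc] at hk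
        rw [h.card_eq (by omega) (by omega)]
        congr 1
        ext x
        simp only [mem_filter, mem_batchOf, mem_range]
        tauto
    _ = #((Ioc l m).biUnion fun k => {x ∈ range n | x ≠ cur ∧ pos x = k}) := by
        rw [card_biUnion]
        intro k _ k' _ hne
        rw [Function.onFun, disjoint_filter]
        intro x _ h1 h2
        exact hne (h1.2.symm.trans h2.2)
    _ ≤ #(range n) := by
        refine card_le_card fun x hx => ?_
        simp only [mem_biUnion, mem_filter] at hx
        obtain ⟨k, -, hx, -⟩ := hx
        exact hx
    _ = n := card_range n

theorem Layout.le_n (h : Layout n cur pos sz slot) {k : ℕ} (h1 : 1 ≤ k) (h2 : k ≤ n) :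
    sz k ≤ n := by
  have := h.sum_le (l := k - 1) h2
  rw [show Ioc (k - 1) k = {k} by ext; simp; omega] at this
  simpa using this

/-- The job `x`, which has no batch, takes the place of another one. -/
theorem Layout.replace (h : Layout n x pos sz slot) (hx : x < n) (h1 : 1 ≤ i) (h2 : i ≤ n)
    (hr : r < sz i) :
    Layout n (slot i r) (Function.update pos x i) sz (put2 slot i r x) := by
  refine ⟨fun i' h1' h2' r' hr' => ?_, fun i' h1' h2' r₁ hr₁ r₂ hr₂ he => ?_, fun q hq hne => ?_⟩
  · obtain ⟨h3, h4, h5⟩ := h.mem i h1 h2 r hr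
    obtain ⟨h6, h7, h8⟩ := h.mem i' h1' h2' r' hr'
    unfold put2
    split_ifs with hc
    · obtain ⟨rfl, rfl⟩ := hc
      exact ⟨hx, h4.symm, Function.update_self ..⟩
    · refine ⟨h6, fun he => hc ?_, by rw [Function.update_of_ne h7]; exact h8⟩
      have hii : i' = i := by rw [← h8, he, h5]
      subst hii
      exact ⟨rfl, h.inj i' h1 h2 r' hr' r hr he⟩
  · have h3 := h.mem i' h1' h2' r₁ hr₁
    have h4 := h.mem i' h1' h2' r₂ hr₂
    unfold put2 at he
    split_ifs at he with hc1 hc2 hc2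
    · exact hc1.2.trans hc2.2.symm
    · exact absurd he.symm h4.2.1
    · exact absurd he h3.2.1
    · exact h.inj i' h1' h2' r₁ hr₁ r₂ hr₂ he
  · by_cases hqx : q = x
    · subst hqx
      rw [Function.update_self]
      exact ⟨h1, h2, r, hr, by simp [put2]⟩
    · rw [Function.update_of_ne hqx]
      obtain ⟨h3, h4, r', h5, h6⟩ := h.surj q hq hqx
      refine ⟨h3, h4, r', h5, ?_⟩
      unfold put2
      rw [if_neg, h6]
      rintro ⟨hc1, hc2⟩
      rw [hc1, hc2] at h6
      exact hne h6.symm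

/-- A job is removed; the last job of the batch takes its place. -/
theorem Layout.remove (h : Layout n n pos sz slot) (h1 : 1 ≤ i) (h2 : i ≤ n) (hr : r < sz i) :
    Layout n (slot i r) pos (Function.update sz i (sz i - 1))
      (put2 slot i r (slot i (sz i - 1))) := by
  have hsz : ∀ k r', r' < Function.update sz i (sz i - 1) k → r' < sz k ∧ (k = i → r' + 1 < sz i) := by
    intro k r' hr'
    by_cases hk : k = i
    · subst hk
      rw [Function.update_self] at hr'
      omega
    · rw [Function.update_of_ne hk] at hr'
      exact ⟨hr', fun h => absurd h hk⟩
  refine ⟨fun i' h1' h2' r' hr' => ?_, fun i' h1' h2' r₁ hr₁ r₂ hr₂ he => ?_, fun q hq hne => ?_⟩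
  · obtain ⟨hr1, hr2⟩ := hsz i' r' hr'
    obtain ⟨h3, h4, h5⟩ := h.mem i' h1' h2' r' hr1
    unfold put2
    split_ifs with hc
    · obtain ⟨rfl, rfl⟩ := hc
      have hr3 := hr2 rfl
      obtain ⟨h6, h7, h8⟩ := h.mem i' h1 h2 (sz i' - 1) (by omega)
      refine ⟨h6, fun he => ?_, h8⟩
      have := h.inj i' h1 h2 _ (by omega) _ hr he
      omega
    · refine ⟨h3, fun he => hc ?_, h5⟩
      have hii : i' = i := by rw [← h5, he, (h.mem i h1 h2 r hr).2.2]
      subst hii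
      exact ⟨rfl, h.inj i' h1 h2 r' hr1 r hr he⟩
  · obtain ⟨ha, ha'⟩ := hsz i' r₁ hr₁
    obtain ⟨hb, hb'⟩ := hsz i' r₂ hr₂
    unfold put2 at he
    split_ifs at he with hc1 hc2 hc2
    · exact hc1.2.trans hc2.2.symm
    · obtain ⟨rfl, rfl⟩ := hc1
      have := h.inj i' h1 h2 _ (by omega) _ hb he
      have := hb' rfl
      omega
    · obtain ⟨rfl, rfl⟩ := hc2
      have := h.inj i' h1 h2 _ ha _ (by omega) he
      have := ha' rfl
      omega
    · exact h.inj i' h1' h2' r₁ ha r₂ hb he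
  · obtain ⟨h3, h4, r', h5, h6⟩ := h.surj q hq hq.ne
    refine ⟨h3, h4, ?_⟩
    by_cases hi : pos q = i
    · rw [hi] at h5 h6 ⊢
      rw [Function.update_self]
      have hrr : r' ≠ r := by
        rintro rfl
        exact hne h6.symm
      by_cases hl : r' = sz i - 1
      · exact ⟨r, by omega, by simp [put2, ← hl, h6]⟩
      · exact ⟨r', by omega, by simp [put2, hrr, h6]⟩
    · rw [Function.update_of_ne hi]
      exact ⟨r', h5, by simp [put2, hi, h6]⟩

/-- The job without a batch is appended to batch `i`. -/
theorem Layout.append (h : Layout n x pos sz slot) (hx : x < n) (h1 : 1 ≤ i) (h2 : i ≤ n) :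
    Layout n n (Function.update pos x i) (Function.update sz i (sz i + 1))
      (put2 slot i (sz i) x) := by
  have hsz : ∀ k r', r' < Function.update sz i (sz i + 1) k → ¬ (k = i ∧ r' = sz i) → r' < sz k := by
    intro k r' hr' hc
    by_cases hk : k = i
    · subst hk
      rw [Function.update_self] at hr'
      have : r' ≠ sz k := fun h => hc ⟨rfl, h⟩
      omega
    · rwa [Function.update_of_ne hk] at hr'
  refine ⟨fun i' h1' h2' r' hr' => ?_, fun i' h1' h2' r₁ hr₁ r₂ hr₂ he => ?_, fun q hq hne => ?_⟩
  · unfold put2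
    split_ifs with hc
    · obtain ⟨rfl, rfl⟩ := hc
      exact ⟨hx, hx.ne, Function.update_self ..⟩
    · obtain ⟨h3, h4, h5⟩ := h.mem i' h1' h2' r' (hsz i' r' hr' hc)
      exact ⟨h3, h3.ne, by rw [Function.update_of_ne h4, h5]⟩
  · unfold put2 at he
    split_ifs at he with hc1 hc2 hc2
    · exact hc1.2.trans hc2.2.symm
    · exact absurd he.symm (h.mem i' h1' h2' r₂ (hsz i' r₂ hr₂ hc2)).2.1
    · exact absurd he (h.mem i' h1' h2' r₁ (hsz i' r₁ hr₁ hc1)).2.1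
    · exact h.inj i' h1' h2' r₁ (hsz i' r₁ hr₁ hc1) r₂ (hsz i' r₂ hr₂ hc2) he
  · by_cases hqx : q = x
    · subst hqx
      rw [Function.update_self, Function.update_self]
      exact ⟨h1, h2, sz i, by omega, by simp [put2]⟩
    · rw [Function.update_of_ne hqx]
      obtain ⟨h3, h4, r', h5, h6⟩ := h.surj q hq hqx
      refine ⟨h3, h4, r', ?_, ?_⟩
      · by_cases hi : pos q = i
        · rw [hi] at h5 ⊢
          rw [Function.update_self]
          omega
        · rwa [Function.update_of_ne hi]
      · unfold put2
        rw [if_neg, h6]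
        rintro ⟨hc1, hc2⟩
        rw [hc1] at h5
        omega

end

/-! ### Handing jobs on to the left -/

section
variable {f : ℕ → ℝ → ℝ} {st : State}

/-- The search for a shortest job of batch `c`. -/
theorem wp_shortest {c : ℕ} (hc : st.nv .c = c) (hz : st.nv .z = 0) (hpos : 0 < st.na .size 0 c) :
    WP f (forUp .q (.read .size 0 (.var .c))
      (when (.rlt (.read .p 0 (.read .slot (.var .c) (.var .q)))
        (.read .p 0 (.read .slot (.var .c) (.var .z)))) (.nset .z (.var .q)))) st
      fun s t => Keeps [.z, .q] [] [] [] st s ∧ s.nv .z < st.na .size 0 c ∧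
        (∀ r < st.na .size 0 c, st.ra .p 0 (st.na .slot c (s.nv .z)) ≤
          st.ra .p 0 (st.na .slot c r)) ∧ t ≤ 30 * (st.na .size 0 c + 1) := by
  refine WP.forUp (st.na .size 0 c) 15 (fun k s => Keeps [.z, .q] [] [] [] st s ∧ s.nv .q = k ∧
    s.nv .z < st.na .size 0 c ∧ ∀ r < k, st.ra .p 0 (st.na .slot c (s.nv .z)) ≤
          st.ra .p 0 (st.na .slot c r)) ?_ ?_ ?_ ?_
  · exact ⟨(Keeps.refl st).setN (by simp) _, by simp, by simpa [hz] using hpos, by simp⟩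
  · rintro k s ⟨hK, hq, -⟩
    refine ⟨hq, ?_⟩
    simp [hK.na .size (by simp), hK.nv .c (by simp), hc]
  · rintro k s hk ⟨hK, hq, hzs, hmin⟩
    have e1 := hK.nv .c (by simp)
    have e2 := hK.na .slot (by simp)
    have e3 := hK.ra .p (by simp)
    rw [wp_cond, wp_nset, wp_skip]
    simp only [BExp.holds, RExp.eval, NExp.eval, e1, e2, e3, hq, hc]
    refine ⟨fun hlt => ⟨⟨(hK.setN (by simp) _).setN (by simp) _, by simp [hq], by simpa using hk, ?_⟩,
      by simp⟩, fun hlt => ⟨⟨hK.setN (by simp) _, by simp, by simpa using hzs, ?_⟩, by simp⟩⟩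
    · intro r hr
      simp only [State.setN_nv, reduceCtorEq, if_false, if_true]
      obtain hr | rfl : r < k ∨ r = k := by omega
      · exact hlt.le.trans (hmin r hr)
      · exact le_rfl
    · intro r hr
      simp only [State.setN_nv, reduceCtorEq, if_false]
      obtain hr | rfl : r < k ∨ r = k := by omega
      · exact hmin r hr
      · exact not_lt.mp hlt
  · rintro s t ⟨hK, hq, hzs, hmin⟩ ht
    refine ⟨hK, hzs, hmin, ht.trans ?_⟩
    simp only [NExp.ops]
    omega

/-- Handing on completes the repair: the result is a greedy packing again, in which batch `e` has
one more job. Every batch is searched once, so the time is linear in the number of jobs in the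
batches. -/
theorem wp_shift {n b : ℕ} {p : ℕ → ℝ} {D : ℕ → ℕ} {e i j : ℕ} {ρ : ℝ} (hb : 1 ≤ b)
    (hp : ∀ q < n, st.ra .p 0 q = p q) (hi : st.nv .i = i) (hj : st.nv .j = j)
    (he : st.nv .e = e) (hin : i ≤ n)
    (hL : Layout n j (st.na .pos 0) (st.na .size 0) (st.na .slot))
    (hC : Chain n b p D e ρ (st.na .size 0) (st.na .pos 0) j (i - 1)) :
    WP f shift st fun s t => Keeps [.cur, .c, .z, .q, .tmp] [.slot, .pos, .size] [] [] st s ∧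
      Layout n n (s.na .pos 0) (s.na .size 0) (s.na .slot) ∧
      Greedy n b p D (s.na .size 0) (s.na .pos 0) ∧
      s.na .size 0 = Function.update (st.na .size 0) e (st.na .size 0 e + 1) ∧
      t ≤ 200 * (n + 1) := by
  unfold shift
  rw [wp_seq, wp_nset, wp_seq, wp_nset, wp_seq]
  have he1 := hC.one_le_e
  refine WP.loop (fun s t => ∃ c cur, s.nv .c = c ∧ s.nv .cur = cur ∧ c ≤ i - 1 ∧
    Keeps [.cur, .c, .z, .q, .tmp] [.slot, .pos] [] [] st s ∧
    Layout n cur (s.na .pos 0) (s.na .size 0) (s.na .slot) ∧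
    Chain n b p D e ρ (s.na .size 0) (s.na .pos 0) cur c ∧
    t ≤ 100 * (i - 1 - c) + 30 * ∑ k ∈ Ioc c (i - 1), st.na .size 0 k)
    (fun s => s.nv .c) ?_ ?_ ?_
  · refine ⟨i - 1, j, by simp [hi], by simp [hj], le_rfl,
      ((Keeps.refl st).setN (by simp) _).setN (by simp) _, ?_, ?_, by simp⟩
    · simpa using hL
    · simpa using hC
  · rintro s t ⟨c, cur, hc, hcur, hci, hK, hL', hC', ht⟩ hlt
    have hec : e < c := by
      have := hK.nv .e (by simp)
      simp only [BExp.holds, NExp.eval] at hlt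
      omega
    have esz := hK.na .size (by simp)
    have hmid := hC'.mid c hec le_rfl
    rw [wp_seq, wp_nset, wp_seq]
    refine (wp_shortest (c := c) (by simp [hc]) (by simp) (by simp [hmid]; omega)).imp ?_
    rintro s₁ t₁ ⟨hK₁, hz, hmin, ht₁⟩
    have g1 := hK₁.nv .c (by simp)
    have g2 := hK₁.na .slot (by simp)
    have g3 := hK₁.ra .p (by simp)
    have g4 := hK₁.nv .cur (by simp)
    have g5 := hK₁.na .pos (by simp)
    have g6 := hK₁.na .size (by simp)
    have g7 := hK.ra .p (by simp)
    have hK₂ : Keeps [.cur, .c, .z, .q, .tmp] [.slot, .pos] [] [] st s₁ :=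
      (hK.setN (by simp) _).trans (hK₁.mono (by simp) (by simp) (by simp) (by simp))
    simp only [State.setN_nv, State.setN_na, State.setN_ra, reduceCtorEq, if_false, hc, hcur,
      g7] at g1 g2 g3 g4 g5 g6 hz hmin ht₁
    rw [hmid] at hz
    have hcn : c ≤ n := by omega
    obtain ⟨hx1, hx2, hx3⟩ := hL'.mem c (by omega) hcn (s₁.nv .z) (by omega)
    have hmin' : ∀ x < n, x ≠ cur → s.na .pos 0 x = c → p (s.na .slot c (s₁.nv .z)) ≤ p x := by
      intro x hx hxc hxk
      obtain ⟨-, -, r, hr, hrx⟩ := hL'.surj x hx hxc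
      rw [hxk] at hr hrx
      have := hmin r hr
      rwa [hrx, hp _ hx1, hp _ hx] at this
    have hsum : ∑ k ∈ Ioc (c - 1) (i - 1), st.na .size 0 k =
        st.na .size 0 c + ∑ k ∈ Ioc c (i - 1), st.na .size 0 k := by
      rw [← sum_Ioc_consecutive _ (show c - 1 ≤ c by omega) hci,
        show Ioc (c - 1) c = {c} by ext; simp; omega, sum_singleton]
    rw [esz] at ht₁
    rw [wp_seq, wp_cond]
    simp only [BExp.holds, RExp.eval, NExp.eval, g1, g2, g3, g4]
    refine ⟨fun h => ?_, fun h => ?_⟩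
    · rw [hp _ hx1, hp _ hC'.cur_lt] at h
      simp only [wp_seq, wp_nset, wp_nput]
      simp only [NExp.eval, State.setN_nv, State.putN_nv, State.setN_na, g1, g2, g4,
        reduceCtorEq, if_false, if_true]
      refine ⟨⟨c - 1, s.na .slot c (s₁.nv .z), by simp, by simp, by omega, ?_, ?_, ?_, ?_⟩, ?_⟩
      · exact ((((hK₂.setN (by simp) _).putN (by simp) _ _ _).putN (by simp) _ _ _).setN
          (by simp) _).setN (by simp) _
      · have := hL'.replace hC'.cur_lt (by omega) hcn (r := s₁.nv .z) (by omega)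
        simp only [State.setN_na, State.putN_table, State.putN_of_ne, put2_row, ne_eq, reduceCtorEq,
          not_false_eq_true, g2, g5, g6]
        exact this
      · simp only [State.setN_na, State.putN_table, State.putN_of_ne, put2_row, ne_eq, reduceCtorEq,
          not_false_eq_true, g5, g6]
        exact hC'.swap hec hx1 hx2 hx3 hmin' h.le
      · simp only [BExp.ops, RExp.ops, NExp.ops]
        rw [hsum]
        omega
      · simp [hc]
        omega
    · rw [hp _ hx1, hp _ hC'.cur_lt] at h
      simp only [wp_nset, wp_skip]
      simp only [NExp.eval, g1]
      refine ⟨⟨c - 1, cur, by simp, by simp [g4], by omega, ?_, ?_, ?_, ?_⟩, ?_⟩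
      · exact hK₂.setN (by simp) _
      · rw [State.setN_na, g2, g5, g6]
        exact hL'
      · rw [State.setN_na, g5, g6]
        exact hC'.keep hec fun x hx hxc hxk => (not_lt.mp h).trans (hmin' x hx hxc hxk)
      · simp only [BExp.ops, RExp.ops, NExp.ops]
        rw [hsum]
        omega
      · simp [hc]
        omega
  · rintro s t ⟨c, cur, hc, hcur, hci, hK, hL', hC', ht⟩ hlt
    have g1 := hK.nv .e (by simp)
    have hec : c = e := by
      have := hC'.e_le
      simp only [BExp.holds, NExp.eval] at hlt
      omega
    subst hec
    have esz := hK.na .size (by simp)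
    have hsum := hL.sum_le (l := c) (show i - 1 ≤ n by omega)
    rw [wp_seq, wp_nput, wp_seq, wp_nput, wp_nput]
    simp only [NExp.eval, State.putN_nv, g1, he, hcur]
    refine ⟨?_, ?_, ?_, ?_, ?_⟩
    · exact (((hK.mono (A' := [.slot, .pos, .size]) (by simp) (by simp) (by simp) (by simp)).putN
        (by simp) _ _ _).putN (by simp) _ _ _).putN (by simp) _ _ _
    · simp only [State.putN_table, State.putN_of_ne, put2_row, ne_eq, reduceCtorEq,
          not_false_eq_true]
      exact hL'.append hC'.cur_lt he1 (by have := hC.e_le; omega)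
    · simp only [State.putN_table, State.putN_of_ne, put2_row, ne_eq, reduceCtorEq,
          not_false_eq_true]
      exact hC'.greedy
    · simp only [State.putN_table, State.putN_of_ne, put2_row, ne_eq, reduceCtorEq,
          not_false_eq_true, esz]
    · simp only [BExp.ops, NExp.ops]
      omega

end

/-! ### The repair of a violated requirement -/

/-- The input data are in memory. -/
structure Static (I : Instance) (st : State) : Prop where
  numJobs : st.nv .numJobs = I.n
  cap : st.nv .cap = I.b
  setup : st.rv .setup = I.s
  proc : st.ra .p 0 = I.procTime

theorem Static.of_keeps {I : Instance} {N : List NVar} {A : List NArr} {R : List RVar}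
    {B : List RArr} {st st' : State} (h : Static I st) (hK : Keeps N A R B st st')
    (h1 : .numJobs ∉ N) (h2 : .cap ∉ N) (h3 : .setup ∉ R) (h4 : .p ∉ B) : Static I st' :=
  ⟨(hK.nv _ h1).trans h.numJobs, (hK.nv _ h2).trans h.cap, (hK.rv _ h3).trans h.setup,
    (congrFun (hK.ra _ h4) 0).trans h.proc⟩

/-- The bound `y` held in memory. -/
noncomputable def State.bound (st : State) : WithTop ℝ :=
  if st.nv .yFin = 0 then ⊤ else (st.rv .y : ℝ)

theorem meets_iff {I : Instance} {st : State} {j : ℕ} {t : ℝ} :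
    I.Meets st.bound j t ↔ st.nv .yFin = 0 ∨ I.costs j t < st.rv .y := by
  unfold Instance.Meets State.bound
  split_ifs with h
  · simp [h]
  · simp only [WithTop.coe_lt_coe, h, false_or]

theorem Keeps.bound_eq {N : List NVar} {A : List NArr} {R : List RVar}
    {B : List RArr} {st st' : State} (hK : Keeps N A R B st st')
    (h1 : .yFin ∉ N) (h2 : .y ∉ R) : st'.bound = st.bound := by
  unfold State.bound
  rw [hK.nv _ h1, hK.rv _ h2]

/-- The batches in memory form a tentative schedule with respect to the completion times in
memory, which are those of the last time the batches were scheduled. -/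
structure Current (I : Instance) (y : WithTop ℝ) (C : ℕ → ℝ) (D : ℕ → ℕ) (st : State) : Prop where
  layout : Layout I.n I.n (st.na .pos 0) (st.na .size 0) (st.na .slot)
  tent : I.Tentative y C D (st.na .size 0) (st.na .pos 0)

section
variable {I : Instance} {st : State} {C : ℕ → ℝ} {D : ℕ → ℕ} {i r j : ℕ}

/-- The search for a longest job of the earlier batches that can be moved to batch `i`. -/
theorem wp_findReplacement (hS : Static I st) (hi : st.nv .i = i) (hf : st.nv .found = 0)
    (hC : st.ra .C 0 i = C i) :
    WP I.costs (forUp .q (.var .numJobs)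
      (when (.and (.nlt (.read .pos 0 (.var .q)) (.var .i)) (.and (okAt (.var .q) (.var .i))
        (.or (.neq (.var .found) 0) (.rlt (.read .p 0 (.var .x)) (.read .p 0 (.var .q))))))
        (.seq (.nset .found 1) (.nset .x (.var .q))))) st
      fun s t => Keeps [.q, .found, .x] [] [] [] st s ∧ t ≤ 60 * (I.n + 1) ∧
        (s.nv .found = 0 ∧ (∀ q < I.n, st.na .pos 0 q < i → ¬ I.Meets st.bound q (C i)) ∨
        s.nv .found = 1 ∧ ∃ x < I.n, s.nv .x = x ∧ st.na .pos 0 x < i ∧ I.Meets st.bound x (C i) ∧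
          ∀ q < I.n, st.na .pos 0 q < i → I.Meets st.bound q (C i) →
            I.procTime q ≤ I.procTime x) := by
  refine WP.forUp I.n 45 (fun k s => s.nv .q = k ∧ Keeps [.q, .found, .x] [] [] [] st s ∧
        (s.nv .found = 0 ∧ (∀ q < k, st.na .pos 0 q < i → ¬ I.Meets st.bound q (C i)) ∨
        s.nv .found = 1 ∧ ∃ x < I.n, s.nv .x = x ∧ st.na .pos 0 x < i ∧ I.Meets st.bound x (C i) ∧
          ∀ q < k, st.na .pos 0 q < i → I.Meets st.bound q (C i) →
            I.procTime q ≤ I.procTime x)) ?_ ?_ ?_ ?_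
  · exact ⟨by simp, (Keeps.refl st).setN (by simp) _, Or.inl ⟨by simp [hf], by simp⟩⟩
  · rintro k s ⟨hq, hK, -⟩
    exact ⟨hq, by simp [hK.nv .numJobs (by simp), hS.numJobs]⟩
  · rintro k s hk ⟨hq, hK, hs⟩
    have e1 := hK.nv .i (by simp)
    have e2 := hK.na .pos (by simp)
    have e3 := hK.ra .p (by simp)
    have e4 := hK.ra .C (by simp)
    have e5 := hK.nv .yFin (by simp)
    have e6 := hK.rv .y (by simp)
    have hm := meets_iff (I := I) (st := st) (j := k) (t := C i)
    rw [wp_cond, wp_seq, wp_nset, wp_nset, wp_skip]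
    simp only [BExp.holds, RExp.eval, NExp.eval, e1, e2, e3, e4, e5, e6, hq, hi, hC, hS.proc, ← hm]
    refine ⟨fun h => ⟨⟨?_, ?_, ?_⟩, ?_⟩, fun h => ⟨⟨?_, ?_, ?_⟩, ?_⟩⟩
    · simp [hq]
    · exact ((hK.setN (by simp) _).setN (by simp) _).setN (by simp) _
    · refine Or.inr ⟨by simp, k, hk, by simp [hq], h.1, h.2.1, fun q hqk h1 h2 => ?_⟩
      obtain hqk | rfl : q < k ∨ q = k := by omega
      · rcases hs with ⟨-, hs⟩ | ⟨hs, x, hx, hxx, h3, h4, h5⟩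
        · exact absurd h2 (hs q hqk h1)
        · have h6 := h.2.2
          rw [hs, hxx] at h6
          simp only [one_ne_zero, false_or] at h6
          exact (h5 q hqk h1 h2).trans h6.le
      · exact le_rfl
    · simp
    · simp
    · exact hK.setN (by simp) _
    · rcases hs with ⟨hs0, hs⟩ | ⟨hs1, x, hx, hxx, h3, h4, h5⟩
      · refine Or.inl ⟨by simp [hs0], fun q hqk h1 h2 => ?_⟩
        obtain hqk | rfl : q < k ∨ q = k := by omega
        · exact hs q hqk h1 h2
        · exact h ⟨h1, h2, Or.inl hs0⟩
      · refine Or.inr ⟨by simp [hs1], x, hx, by simp [hxx], h3, h4, fun q hqk h1 h2 => ?_⟩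
        obtain hqk | rfl : q < k ∨ q = k := by omega
        · exact h5 q hqk h1 h2
        · by_contra hlt
          refine h ⟨h1, h2, Or.inr ?_⟩
          rw [hxx]
          exact not_le.mp hlt
    · simp
  · rintro s t ⟨hq, hK, hs⟩ ht
    refine ⟨hK, ht.trans ?_, hs⟩
    simp only [NExp.ops]
    omega

/-- What a repair achieves. The potential `∑ D` decreases. -/
structure Repaired (I : Instance) (C : ℕ → ℝ) (D : ℕ → ℕ) (i r : ℕ) (st s : State) : Prop where
  fail : s.nv .fail = st.nv .fail
  exists_bound : ∃ D', Current I st.bound C D' s ∧ ∑ q ∈ range I.n, D' q < ∑ q ∈ range I.n, D q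
  size_eq : ∀ k, i < k → s.na .size 0 k = st.na .size 0 k
  le_size : r ≤ s.na .size 0 i

theorem Instance.sum_lowered_lt {y : WithTop ℝ} {pos : ℕ → ℕ} (hj : j < I.n) (h1 : 1 ≤ i)
    (hji : i ≤ D j) (hm : ¬ I.Meets y j (C i)) :
    ∑ q ∈ range I.n, I.lowered y C D pos i j q < ∑ q ∈ range I.n, D q := by
  refine sum_lt_sum (fun q _ => I.lowered_le q) ⟨j, by simpa using hj, ?_⟩
  rw [I.lowered_self hji hm]
  omega

/-- The part of the repair for the case that no job of an earlier batch can replace `j`. -/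
theorem wp_caseOne (hS : Static I st) (hc : Current I st.bound C D st) (hi : st.nv .i = i)
    (hr : st.nv .r = r) (hj : st.nv .j = j) (h1 : 1 ≤ i) (hin : i ≤ I.n)
    (hrs : r < st.na .size 0 i) (hjr : st.na .slot i r = j) (hm : ¬ I.Meets st.bound j (C i))
    (hall : ∀ q < I.n, st.na .pos 0 q < i → ¬ I.Meets st.bound q (C i)) :
    WP I.costs caseOne st fun s t =>
      Keeps [.e, .c, .cur, .z, .q, .tmp, .fail] [.pos, .slot, .size] [] [] st s ∧
      t ≤ 300 * (I.n + 1) ∧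
      (s.nv .fail = 1 ∧ (¬ ∃ a g, I.Good st.bound a g) ∨ Repaired I C D i r st s) := by
  obtain ⟨hjn, -, hji⟩ := hc.layout.mem i h1 hin r hrs
  rw [hjr] at hjn hji
  have hgr := hc.tent.greedy
  have hDj : i ≤ D j := hji ▸ hgr.le_bound j hjn
  have hD'j : I.lowered st.bound C D (st.na .pos 0) i j j = i - 1 := I.lowered_self hDj hm
  have hbd : I.Bounds st.bound C (I.lowered st.bound C D (st.na .pos 0) i j) :=
    hc.tent.bounds.lowered h1 hin
  have hlow : ∀ q < I.n, st.na .pos 0 q < i ∨ q = j →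
      I.lowered st.bound C D (st.na .pos 0) i j q < i := by
    intro q hq h
    by_contra hlt
    have hmq := I.meets_of_le_lowered (y := st.bound) (C := C) (D := D) (pos := st.na .pos 0)
      (q := q) (i := i) (j := j) h.symm h1 (by omega)
    rcases h with h | rfl
    · exact hall q hq h hmq
    · exact hm hmq
  have hL := hc.layout.remove h1 hin hrs
  rw [hjr] at hL
  unfold caseOne
  rw [wp_seq, wp_nput, wp_seq, wp_nput, wp_cond]
  simp only [BExp.holds, NExp.eval, State.putN_nv, State.putN_table, State.putN_of_ne, put2_row,
    ne_eq, reduceCtorEq, not_false_eq_true, hi, hr, Function.update_self]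
  refine ⟨fun h => ?_, fun h => ?_⟩
  · rw [wp_nset]
    refine ⟨?_, by simp; omega, Or.inl ⟨by simp, ?_⟩⟩
    · exact (((Keeps.refl st).putN (by simp) _ _ _).putN (by simp) _ _ _).setN (by simp) _
    · -- batch `i` consisted of `j` alone, so all jobs up to batch `i` have bounds below `i`
      refine hbd.not_good_of_bounds_lt (pos := st.na .pos 0) (hgr.assign hc.layout.counts)
        hin hjn hji (fun q hq hqi => hlow q hq ?_) fun q hq hqi => ?_
      · by_contra hcon
        have hqi' : st.na .pos 0 q = i := by omega
        obtain ⟨-, -, r', hr', hqr'⟩ := hc.layout.surj q hq hq.ne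
        rw [hqi'] at hr' hqr'
        have : r' = r := by omega
        subst this
        exact hcon (Or.inr (hqr'.symm.trans hjr))
      · rw [I.lowered_of_lt (by rintro rfl; omega) hqi.le]
        exact hgr.le_bound q hq
  · rw [wp_seq, wp_nset, wp_seq]
    simp only [NExp.eval, State.putN_nv, hi]
    set s₀ := (st.putN .slot i r (st.na .slot i (st.na .size 0 i - 1))).putN .size 0 i
      (st.na .size 0 i - 1) with hs₀
    have hK₀ : Keeps [.e] [.slot, .size] [] [] st s₀ :=
      ((Keeps.refl st).putN (by simp) _ _ _).putN (by simp) _ _ _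
    have hsz₀ : s₀.na .size 0 = Function.update (st.na .size 0) i (st.na .size 0 i - 1) := by
      simp only [hs₀, State.putN_table, State.putN_of_ne, put2_row, ne_eq, reduceCtorEq,
        not_false_eq_true]
    have hsl₀ : s₀.na .slot = put2 (st.na .slot) i r (st.na .slot i (st.na .size 0 i - 1)) := by
      simp only [hs₀, State.putN_table, State.putN_of_ne, ne_eq, reduceCtorEq, not_false_eq_true]
    refine WP.loop (fun s t => Keeps [.e] [] [] [] s₀ s ∧ s.nv .e ≤ i - 1 ∧
      (∀ k, s.nv .e < k → k < i → st.na .size 0 k = I.b) ∧ t ≤ 20 * (i - 1 - s.nv .e))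
      (fun s => s.nv .e) ?_ ?_ ?_
    · exact ⟨(Keeps.refl _).setN (by simp) _, by simp, fun k h2 h3 => by simp at h2; omega, by simp⟩
    · rintro s t ⟨hK, he, hfull, ht⟩ hb
      have e1 := hK.na .size (by simp)
      have e2 := hK.nv .cap (by simp)
      rw [hK₀.nv .cap (by simp), hS.cap] at e2
      simp only [BExp.holds, NExp.eval, e1, e2, hsz₀] at hb
      rw [Function.update_of_ne (by omega)] at hb
      rw [wp_nset]
      simp only [NExp.eval, State.setN_nv, if_true]
      refine ⟨⟨hK.setN (by simp) _, by omega, fun k h2 h3 => ?_, ?_⟩, by omega⟩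
      · obtain hk | rfl : s.nv .e < k ∨ k = s.nv .e := by omega
        · exact hfull k hk h3
        · have := hgr.cap (s.nv .e) (by omega) (by omega)
          omega
      · simp only [BExp.ops, NExp.ops]
        omega
    · rintro s t ⟨hK, he, hfull, ht⟩ hb
      have e1 := hK.na .size (by simp)
      have e2 := hK.nv .cap (by simp)
      rw [hK₀.nv .cap (by simp), hS.cap] at e2
      simp only [BExp.holds, NExp.eval, e1, e2, hsz₀] at hb
      rw [Function.update_of_ne (by omega)] at hb
      have hK₁ : Keeps [.e, .c, .cur, .z, .q, .tmp, .fail] [.pos, .slot, .size] [] [] st s :=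
        (hK₀.mono (by simp) (by simp) (by simp) (by simp)).trans
          (hK.mono (by simp) (by simp) (by simp) (by simp))
      rw [wp_cond, wp_nset]
      simp only [BExp.holds, NExp.eval]
      refine ⟨fun he0 => ⟨hK₁.setN (by simp) _, ?_, Or.inl ⟨by simp, ?_⟩⟩, fun he0 => ?_⟩
      · simp only [BExp.ops, NExp.ops]
        omega
      · exact hbd.not_good_of_full hc.layout.counts hgr.one_le hin hjn hji hlow
          fun k h2 h3 => hfull k (by omega) h3
      · have hlt : st.na .size 0 (s.nv .e) < I.b := by
          by_contra hcon
          exact hb ⟨by omega, hcon⟩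
        have hch := hgr.chain_of_forall_not_meets hjn hji (e := s.nv .e) (by omega) (by omega) hm
          hall hlt hfull
        have p1 : s.na .pos = st.na .pos := (hK.na .pos (by simp)).trans (hK₀.na .pos (by simp))
        have p2 : s.na .slot = s₀.na .slot := hK.na .slot (by simp)
        have p3 : s.ra .p = st.ra .p := (hK.ra .p (by simp)).trans (hK₀.ra .p (by simp))
        refine (wp_shift (i := i) (j := j) I.one_le_b (fun q _ => by rw [p3, hS.proc]) ?_ ?_ rfl hin
          (by rw [p1, p2, e1, hsz₀, hsl₀]; exact hL)
          (by rw [p1, e1, hsz₀]; exact hch)).imp ?_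
        · rw [hK₁.nv .i (by simp), hi]
        · rw [hK₁.nv .j (by simp), hj]
        · rintro s' t' ⟨hK', hL', hG', hsz', ht'⟩
          have hsize : ∀ k, s'.na .size 0 k = if k = s.nv .e then st.na .size 0 k + 1 else
              if k = i then st.na .size 0 i - 1 else st.na .size 0 k := by
            intro k
            rw [hsz', e1, hsz₀]
            simp only [Function.update_apply]
            split_ifs <;> first | omega | simp_all
          refine ⟨hK₁.trans (hK'.mono (by simp) (by simp) (by simp) (by simp)), ?_, Or.inr
            ⟨?_, ⟨_, ⟨hL', hbd, hG', ?_⟩, I.sum_lowered_lt hjn h1 hDj hm⟩, ?_, ?_⟩⟩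
          · simp only [BExp.ops, NExp.ops]
            omega
          · rw [hK'.nv .fail (by simp), hK.nv .fail (by simp), hK₀.nv .fail (by simp)]
          · -- batch `i` has kept a job, and batch `e` is followed by full batches up to batch `i`
            intro k k' h2 h3 h4 h5
            rw [hsize] at h5 ⊢
            have hb1 := I.one_le_b
            have := hfull k'
            have := hc.tent.contig k k' h2 h3 h4
            have := hc.tent.contig i k' h1
            split_ifs at h5 ⊢ <;> grind
          · intro k hk
            rw [hsize, if_neg (by omega), if_neg (by omega)]
          · rw [hsize, if_neg (by omega), if_pos rfl]
            omega

/-- The part of the repair for the case that the longest suitable job `x` replaces `j`. -/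
theorem wp_caseTwo (hS : Static I st) (hc : Current I st.bound C D st) (hi : st.nv .i = i)
    (hr : st.nv .r = r) (hj : st.nv .j = j) (h1 : 1 ≤ i) (hin : i ≤ I.n)
    (hrs : r < st.na .size 0 i) (hjr : st.na .slot i r = j) (hm : ¬ I.Meets st.bound j (C i))
    {x : ℕ} (hxx : st.nv .x = x) (hx : x < I.n) (hxi : st.na .pos 0 x < i)
    (hxm : I.Meets st.bound x (C i))
    (hmax : ∀ q < I.n, st.na .pos 0 q < i → I.Meets st.bound q (C i) →
      I.procTime q ≤ I.procTime x) :
    WP I.costs caseTwo st fun s t =>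
      Keeps [.e, .c, .cur, .z, .q, .tmp, .fail] [.pos, .slot, .size] [] [] st s ∧
      t ≤ 300 * (I.n + 1) ∧ Repaired I C D i r st s := by
  obtain ⟨hjn, -, hji⟩ := hc.layout.mem i h1 hin r hrs
  rw [hjr] at hjn hji
  have hgr := hc.tent.greedy
  have hDj : i ≤ D j := hji ▸ hgr.le_bound j hjn
  have hbd : I.Bounds st.bound C (I.lowered st.bound C D (st.na .pos 0) i j) :=
    hc.tent.bounds.lowered h1 hin
  obtain ⟨he1, hen, w, hw, hwx⟩ := hc.layout.surj x hx hx.ne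
  set e := st.na .pos 0 x with he
  have hei : e ≠ i := by omega
  have hch := hgr.chain_of_meets hc.tent.bounds hin hjn hji hm hx hxi hxm hmax
    (lt_of_le_of_lt (Nat.zero_le _) hw)
  rw [← he] at hch
  unfold caseTwo
  rw [wp_seq, wp_nset, wp_seq, wp_nput, wp_seq, wp_nput, wp_seq, wp_nset, wp_seq]
  simp only [NExp.eval, State.putN_nv, State.setN_nv, reduceCtorEq, if_false, hi, hr, hxx,
    ← he]
  set s₀ := (((st.setN .e e).putN .slot i r x).putN .pos 0 x i).setN .z 0 with hs₀
  have hK₀ : Keeps [.e, .z] [.slot, .pos] [] [] st s₀ :=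
    ((((Keeps.refl st).setN (by simp) _).putN (by simp) _ _ _).putN (by simp) _ _ _).setN
      (by simp) _
  have hps₀ : s₀.na .pos 0 = Function.update (st.na .pos 0) x i := by
    simp only [hs₀, State.putN_table, State.putN_of_ne, put2_row, ne_eq, reduceCtorEq,
      not_false_eq_true, State.setN_na]
  have hsl₀ : s₀.na .slot = put2 (st.na .slot) i r x := by
    simp only [hs₀, State.putN_table, State.putN_of_ne, ne_eq, reduceCtorEq, not_false_eq_true,
      State.setN_na]
  have hsz₀ : s₀.na .size = st.na .size := hK₀.na _ (by simp)
  refine WP.loop (fun s t => Keeps [.z] [] [] [] s₀ s ∧ s.nv .z ≤ w ∧ t ≤ 20 * s.nv .z)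
      (fun s => w - s.nv .z) ?_ ?_ ?_
  · exact ⟨Keeps.refl _, by simp [hs₀], by simp [hs₀]⟩
  · rintro s t ⟨hK, hz, ht⟩ hb
    have e1 := hK.nv .e (by simp)
    have e2 := hK.na .slot (by simp)
    have e3 := hK.nv .x (by simp)
    have hzw : s.nv .z ≠ w := by
      intro hzw
      simp only [BExp.holds, NExp.eval, e1, e2, e3, hsl₀, hK₀.nv .x (by simp), hxx, hzw] at hb
      refine hb ?_
      simp only [hs₀, State.setN_nv, State.putN_nv, reduceCtorEq, if_false, if_true]
      rw [put2_of_ne hei, hwx]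
    rw [wp_nset]
    simp only [NExp.eval, State.setN_nv, if_true]
    refine ⟨⟨hK.setN (by simp) _, by omega, ?_⟩, by omega⟩
    simp only [BExp.ops, NExp.ops]
    omega
  · -- the linear search has found the place of `x` in batch `e`
    rintro s t ⟨hK, hz, ht⟩ hb
    have e1 : s.nv .e = e := by
      rw [hK.nv .e (by simp)]
      simp [hs₀]
    have e2 := hK.na .slot (by simp)
    have e3 : s.nv .x = x := by rw [hK.nv .x (by simp), hK₀.nv .x (by simp), hxx]
    have e4 := hK.na .size (by simp)
    have e5 := hK.na .pos (by simp)
    have e6 : s.ra .p = st.ra .p := (hK.ra .p (by simp)).trans (hK₀.ra .p (by simp))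
    simp only [BExp.holds, NExp.eval, e1, e2, e3, hsl₀, not_not] at hb
    rw [put2_of_ne hei] at hb
    have hzs : s.nv .z < st.na .size 0 e := by omega
    have hL := (hc.layout.remove he1 hen hzs)
    rw [hb] at hL
    have hL := hL.replace hx h1 hin (r := r) (by rwa [Function.update_of_ne (Ne.symm hei)])
    rw [put2_of_ne (Ne.symm hei), hjr, put2_comm (Ne.symm hei)] at hL
    have hse := hc.layout.le_n he1 hen
    rw [wp_seq, wp_nput, wp_seq, wp_nput]
    simp only [NExp.eval, State.putN_nv, State.putN_of_ne, ne_eq, reduceCtorEq,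
      not_false_eq_true, e1, e2, e4, hsz₀, hsl₀, put2_of_ne hei]
    refine (wp_shift (p := I.procTime) (ρ := I.procTime x) (i := i) (j := j) (e := e)
      (D := I.lowered st.bound C D (st.na .pos 0) i j) I.one_le_b (fun q _ => by
      simp only [State.putN_ra, e6, hS.proc]) ?_ ?_ ?_ hin ?_ ?_).imp ?_
    · simp only [State.putN_nv, hK.nv .i (by simp), hK₀.nv .i (by simp), hi]
    · simp only [State.putN_nv, hK.nv .j (by simp), hK₀.nv .j (by simp), hj]
    · simp only [State.putN_nv, e1]
    · simp only [State.putN_table, State.putN_of_ne, ne_eq, reduceCtorEq, not_false_eq_true,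
        put2_row, e2, e4, e5, hsz₀, hsl₀, hps₀]
      exact hL
    · simp only [State.putN_table, State.putN_of_ne, ne_eq, reduceCtorEq, not_false_eq_true,
        put2_row, e4, e5, hsz₀, hps₀]
      exact hch
    · rintro s' t' ⟨hK', hL', hG', hsz', ht'⟩
      -- batch `e` has lost `x` and gained a job, and batch `i` has exchanged `j` for `x`
      have hsize : s'.na .size 0 = st.na .size 0 := by
        rw [hsz']
        simp only [State.putN_table, put2_row, State.putN_of_ne, ne_eq, reduceCtorEq,
          not_false_eq_true, e4, hsz₀]
        rw [Function.update_idem, Function.update_self, Nat.sub_add_cancel (by omega),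
          Function.update_eq_self]
      have hK₁ : Keeps [.e, .c, .cur, .z, .q, .tmp, .fail] [.pos, .slot, .size] [] [] st s :=
        (hK₀.mono (by simp) (by simp) (by simp) (by simp)).trans
          (hK.mono (by simp) (by simp) (by simp) (by simp))
      refine ⟨((hK₁.putN (by simp) _ _ _).putN (by simp) _ _ _).trans
        (hK'.mono (by simp) (by simp) (by simp) (by simp)), ?_, ?_,
        ⟨_, ⟨hL', hbd, hG', ?_⟩, I.sum_lowered_lt hjn h1 hDj hm⟩, ?_, ?_⟩
      · simp only [BExp.ops, NExp.ops]
        omega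
      · rw [hK'.nv .fail (by simp), State.putN_nv, State.putN_nv, hK.nv .fail (by simp),
          hK₀.nv .fail (by simp)]
      · rw [hsize]
        exact hc.tent.contig
      · intro k _
        rw [hsize]
      · rw [hsize]
        exact hrs.le

/-- A repair either fails, and then no schedule has costs below the bound `y`, or lowers the
potential. -/
theorem wp_repair (hS : Static I st) (hc : Current I st.bound C D st) (hi : st.nv .i = i)
    (hr : st.nv .r = r) (hj : st.nv .j = j) (h1 : 1 ≤ i) (hin : i ≤ I.n)
    (hrs : r < st.na .size 0 i) (hjr : st.na .slot i r = j) (hm : ¬ I.Meets st.bound j (C i))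
    (hC : st.ra .C 0 i = C i) :
    WP I.costs repair st fun s t =>
      Keeps [.adj, .found, .x, .e, .c, .cur, .z, .q, .tmp, .fail] [.csf, .pos, .slot, .size] [] []
        st s ∧
      s.nv .adj = 1 ∧ t ≤ 400 * (I.n + 1) ∧
      (s.nv .fail = 1 ∧ (¬ ∃ a g, I.Good st.bound a g) ∨ Repaired I C D i r st s) := by
  unfold repair
  rw [wp_seq, wp_nset, wp_seq, wp_nput, wp_seq, wp_nset, wp_seq]
  set s₀ := (((st.setN .adj (NExp.eval st 1)).putN .csf (NExp.eval (st.setN .adj (NExp.eval st 1)) 0)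
    (NExp.eval (st.setN .adj (NExp.eval st 1)) (.var .j))
    (NExp.eval (st.setN .adj (NExp.eval st 1)) (.sub (.var .i) 1))).setN .found
    (NExp.eval ((st.setN .adj (NExp.eval st 1)).putN .csf
      (NExp.eval (st.setN .adj (NExp.eval st 1)) 0)
      (NExp.eval (st.setN .adj (NExp.eval st 1)) (.var .j))
      (NExp.eval (st.setN .adj (NExp.eval st 1)) (.sub (.var .i) 1))) 0)) with hs₀
  have hK₀ : Keeps [.adj, .found] [.csf] [] [] st s₀ :=
    (((Keeps.refl st).setN (by simp) _).putN (by simp) _ _ _).setN (by simp) _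
  have hadj : s₀.nv .adj = 1 := by simp [hs₀]
  have hfound : s₀.nv .found = 0 := by simp [hs₀]
  clear_value s₀
  refine (wp_findReplacement (C := C) (i := i) (hS.of_keeps hK₀ (by simp) (by simp) (by simp)
    (by simp)) (by rw [hK₀.nv .i (by simp), hi]) hfound
    (by rw [hK₀.ra .C (by simp), hC])).imp ?_
  rintro s t ⟨hK, ht, hs⟩
  have hK₁ : Keeps [.adj, .found, .x, .q] [.csf] [] [] st s :=
    (hK₀.mono (by simp) (by simp) (by simp) (by simp)).trans
      (hK.mono (by simp) (by simp) (by simp) (by simp))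
  have hK₂ : Keeps [.adj, .found, .x, .e, .c, .cur, .z, .q, .tmp, .fail] [.csf, .pos, .slot, .size]
    [] [] st s := hK₁.mono (by simp) (by simp) (by simp) (by simp)
  have hy : s.bound = st.bound := hK₁.bound_eq (by simp) (by simp)
  have hy₀ : s₀.bound = st.bound := hK₀.bound_eq (by simp) (by simp)
  have e1 := hK₁.na .pos (by simp)
  have e2 := hK₁.na .size (by simp)
  have e3 := hK₁.na .slot (by simp)
  have hS' : Static I s := hS.of_keeps hK₁ (by simp) (by simp) (by simp) (by simp)
  have hc' : Current I s.bound C D s := by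
    rw [hy]
    exact ⟨by rw [e1, e2, e3]; exact hc.layout, by rw [e1, e2]; exact hc.tent⟩
  have f1 : s.nv .i = i := by rw [hK₁.nv .i (by simp), hi]
  have f2 : s.nv .r = r := by rw [hK₁.nv .r (by simp), hr]
  have f3 : s.nv .j = j := by rw [hK₁.nv .j (by simp), hj]
  have f4 : s.nv .adj = 1 := by rw [hK.nv .adj (by simp), hadj]
  have f5 := hK₁.nv .fail (by simp)
  have f6 : r < s.na .size 0 i := by rwa [e2]
  have f7 : s.na .slot i r = j := by rwa [e3]
  have f8 : ¬ I.Meets s.bound j (C i) := by rwa [hy]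
  have hrep : ∀ s', Repaired I C D i r s s' → Repaired I C D i r st s' := by
    rintro s' ⟨g1, g2, g3, g4⟩
    exact ⟨g1.trans f5, by rwa [hy] at g2, fun k hk => by rw [g3 k hk, e2], g4⟩
  rw [hK₀.na .pos (by simp), hy₀] at hs
  rw [wp_cond]
  simp only [BExp.holds, NExp.eval]
  refine ⟨fun h => ?_, fun h => ?_⟩
  · rcases hs with ⟨-, hall⟩ | ⟨hs, -⟩
    · refine (wp_caseOne hS' hc' f1 f2 f3 h1 hin f6 f7 f8 (by rwa [e1, hy])).imp ?_
      rintro s' t' ⟨hK', ht', hres⟩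
      refine ⟨hK₂.trans (hK'.mono (by simp) (by simp) (by simp) (by simp)), ?_, ?_, ?_⟩
      · rw [hK'.nv .adj (by simp), f4]
      · simp only [BExp.ops, NExp.ops]
        omega
      · rw [hy] at hres
        exact hres.imp_right (hrep s')
    · omega
  · rcases hs with ⟨hs, -⟩ | ⟨-, x, hx, hxx, h3, h4, h5⟩
    · omega
    · refine (wp_caseTwo hS' hc' f1 f2 f3 h1 hin f6 f7 f8 hxx hx (by rwa [e1]) (by rwa [hy])
        (by rwa [e1, hy])).imp ?_
      rintro s' t' ⟨hK', ht', hres⟩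
      refine ⟨hK₂.trans (hK'.mono (by simp) (by simp) (by simp) (by simp)), ?_, ?_,
        Or.inr (hrep s' hres)⟩
      · rw [hK'.nv .adj (by simp), f4]
      · simp only [BExp.ops, NExp.ops]
        omega

end

/-! ### One pass over the batches -/

/-- The registers that a pass over the batches may change. -/
abbrev sweepRegs : List NVar :=
  [.adj, .i, .r, .j, .found, .x, .e, .c, .cur, .z, .q, .tmp, .fail]

/-- The batch arrays and the candidate sets. -/
abbrev batchArrs : List NArr := [.csf, .pos, .slot, .size]

/-- The invariant of a pass that was started in memory `st` with the bounds `D`, when the batches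
after batch `i` and the first `r` jobs of batch `i` have been checked, after `t` operations, `w` of
which are not accounted for otherwise. A repair is paid for by the decrease of the potential
`∑ D`. -/
structure Sweep (I : Instance) (C : ℕ → ℝ) (D : ℕ → ℕ) (st : State) (w i r : ℕ) (s : State)
    (t : ℕ) : Prop where
  keeps : Keeps sweepRegs batchArrs [] [] st s
  reg_i : s.nv .i = i
  le_n : i ≤ I.n
  outcome : s.nv .fail = 1 ∧ (¬ ∃ a g, I.Good st.bound a g) ∧
      t ≤ 1000 * (I.n + 1) * (∑ q ∈ range I.n, D q) + 800 * (I.n + 1) + 50 * (I.n - i) + w ∨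
    s.nv .fail = 0 ∧ ∃ D', Current I st.bound C D' s ∧ r ≤ s.na .size 0 i ∧
      ∑ q ∈ range I.n, D' q ≤ ∑ q ∈ range I.n, D q ∧
      t + 1000 * (I.n + 1) * (∑ q ∈ range I.n, D' q) ≤ 100 * (I.n - i) +
        100 * (∑ k ∈ Ioc i I.n, s.na .size 0 k + r) + 1000 * (I.n + 1) * (∑ q ∈ range I.n, D q) +
        w ∧
      (s.nv .adj = 0 ∧ s.na = st.na ∧ (∀ q < I.n, i < st.na .pos 0 q →
          I.Meets st.bound q (C (st.na .pos 0 q))) ∧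
          (∀ r' < r, I.Meets st.bound (st.na .slot i r') (C i)) ∨
        s.nv .adj = 1 ∧ ∑ q ∈ range I.n, D' q < ∑ q ∈ range I.n, D q)

section
variable {I : Instance} {C : ℕ → ℝ} {D : ℕ → ℕ} {st s : State} {w i r t : ℕ}

theorem Layout.sum_add_le {n : ℕ} {pos sz : ℕ → ℕ} {slot : ℕ → ℕ → ℕ}
    (h : Layout n n pos sz slot) (hr : r ≤ sz i) (h1 : 1 ≤ i) (hi : i ≤ n) :
    ∑ k ∈ Ioc i n, sz k + r ≤ n := by
  have := h.sum_le (l := i - 1) (m := n) le_rfl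
  rw [← sum_Ioc_consecutive _ (show i - 1 ≤ i by omega) hi,
    show Ioc (i - 1) i = {i} by ext; simp; omega, sum_singleton] at this
  omega

theorem Sweep.time_le (h : Sweep I C D st w i r s t) (h1 : 1 ≤ i) :
    t ≤ 1000 * (I.n + 1) * (∑ q ∈ range I.n, D q) + 850 * (I.n + 1) + w := by
  rcases h.outcome with ⟨-, -, h⟩ | ⟨-, D', hc, hr, -, ht, -⟩
  · omega
  · have := hc.layout.sum_add_le hr h1 h.le_n
    omega

/-- Checking one job of batch `i`. -/
theorem wp_checkJob (hS : Static I st) (hC : ∀ k ≤ I.n, st.ra .C 0 k = C k) (h1 : 1 ≤ i)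
    (h : Sweep I C D st w i r s t) (hr : s.nv .r = r) (hrs : r < s.na .size 0 i)
    (hf : s.nv .fail = 0) :
    WP I.costs (.seq (.nset .j (.read .slot (.var .i) (.var .r)))
        (.cond (okAt (.var .j) (.var .i)) (.nset .r (.add (.var .r) 1)) repair)) s
      fun s' t' => ∃ r', s'.nv .r = r' ∧ Sweep I C D st w i r' s' (t + (10 + t')) := by
  obtain ⟨hK, hi, hin, ho⟩ := h
  rw [wp_seq, wp_nset]
  set s₁ := s.setN .j (NExp.eval s (.read .slot (.var .i) (.var .r))) with hs₁
  set j := s.na .slot i r with hj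
  have hj₁ : s₁.nv .j = j := by simp [hs₁, hi, hr, hj]
  have hK₁ : Keeps [.j] [] [] [] s s₁ := (Keeps.refl s).setN (by simp) _
  clear_value s₁
  have hK₂ : Keeps sweepRegs batchArrs [] [] st s₁ :=
    hK.trans (hK₁.mono (by simp) (by simp) (by simp) (by simp))
  have hna : s₁.na = s.na := by
    funext a
    exact hK₁.na a (by simp)
  have hi₁ : s₁.nv .i = i := by rw [hK₁.nv .i (by simp), hi]
  have hr₁ : s₁.nv .r = r := by rw [hK₁.nv .r (by simp), hr]
  have hf₁ : s₁.nv .fail = 0 := by rw [hK₁.nv .fail (by simp), hf]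
  have hy : s₁.bound = st.bound := hK₂.bound_eq (by simp) (by simp)
  have hCi : s₁.ra .C 0 i = C i := by rw [hK₂.ra .C (by simp), hC i hin]
  have hok : (okAt (.var .j) (.var .i)).holds I.costs s₁ ↔ I.Meets st.bound j (C i) := by
    rw [← hy, meets_iff]
    simp only [BExp.holds, NExp.eval, RExp.eval, hj₁, hi₁, hCi]
  rcases ho with ⟨ho, -⟩ | ⟨-, D', hc, hrs', hDD, ht, hst⟩
  · omega
  have hc₁ : Current I s₁.bound C D' s₁ := by
    rw [hy]
    exact ⟨by rw [hna]; exact hc.layout, by rw [hna]; exact hc.tent⟩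
  rw [wp_cond, hok]
  refine ⟨fun hm => ?_, fun hm => ?_⟩
  · rw [wp_nset]
    refine ⟨r + 1, by simp [hr₁], (hK₂.setN (by simp) _), by simp [hi₁], hin,
      Or.inr ⟨by simp [hf₁], D', ⟨by rw [State.setN_na, hna]; exact hc.layout, by
        rw [State.setN_na, hna]; exact hc.tent⟩, ?_, hDD, ?_, ?_⟩⟩
    · rw [State.setN_na, hna]
      exact hrs
    · rw [State.setN_na, hna]
      simp only [BExp.ops, RExp.ops, NExp.ops]
      omega
    · simp only [State.setN_nv, State.setN_na, reduceCtorEq, if_false, hna,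
        hK₁.nv .adj (by simp)]
      refine hst.imp_left ?_
      rintro ⟨h2, h3, h4, h5⟩
      refine ⟨h2, h3, h4, fun r' hr' => ?_⟩
      obtain hr' | rfl : r' < r ∨ r' = r := by omega
      · exact h5 r' hr'
      · rwa [hj, h3] at hm
  · refine (wp_repair (C := C) (D := D') (i := i) (r := r) (j := j)
      (hS.of_keeps hK₂ (by simp) (by simp) (by simp) (by simp)) hc₁ hi₁ hr₁ hj₁ h1 hin
      (by rwa [hna]) (by rw [hna]) (by rwa [hy]) hCi).imp ?_
    rintro s' t' ⟨hK', hadj, ht', hres⟩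
    have hi' : s'.nv .i = i := by rw [hK'.nv .i (by simp), hi₁]
    have hr' : s'.nv .r = r := by rw [hK'.nv .r (by simp), hr₁]
    have hsum := hc.layout.sum_add_le hrs' h1 hin
    refine ⟨r, hr', hK₂.trans (hK'.mono (by simp) (by simp) (by simp) (by simp)), hi', hin, ?_⟩
    rw [hy] at hres
    rcases hres with ⟨hfail, hng⟩ | hrep
    · refine Or.inl ⟨hfail, hng, ?_⟩
      simp only [BExp.ops, RExp.ops, NExp.ops]
      omega
    · obtain ⟨D'', hc'', hlt⟩ := hrep.exists_bound
      refine Or.inr ⟨by rw [hrep.fail, hf₁], D'', by rwa [← hy], hrep.le_size,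
        hlt.le.trans hDD, ?_, Or.inr ⟨hadj, hlt.trans_le hDD⟩⟩
      · -- the batches after `i` are unchanged, and the decrease of `∑ D` pays for the repair
        have hsz : ∑ k ∈ Ioc i I.n, s'.na .size 0 k = ∑ k ∈ Ioc i I.n, s.na .size 0 k := by
          refine sum_congr rfl fun k hk => ?_
          rw [mem_Ioc] at hk
          rw [hrep.size_eq k hk.1, hna]
        have hmul : 1000 * (I.n + 1) * (∑ q ∈ range I.n, D'' q) + 1000 * (I.n + 1) ≤
            1000 * (I.n + 1) * (∑ q ∈ range I.n, D' q) := by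
          rw [← Nat.mul_succ]
          exact Nat.mul_le_mul_left _ hlt
        rw [hsz]
        simp only [BExp.ops, RExp.ops, NExp.ops]
        omega

/-- Checking batch `i`. -/
theorem wp_checkBatch (hS : Static I st) (hC : ∀ k ≤ I.n, st.ra .C 0 k = C k) (h1 : 1 ≤ i)
    (h : Sweep I C D st w i 0 s t) (hf : s.nv .fail = 0) :
    WP I.costs (.seq (.nset .r 0) (.seq
      (.loop (.and (.nlt (.var .r) (.read .size 0 (.var .i))) (.neq (.var .fail) 0)) (.seq
        (.nset .j (.read .slot (.var .i) (.var .r)))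
        (.cond (okAt (.var .j) (.var .i)) (.nset .r (.add (.var .r) 1)) repair)))
      (.nset .i (.sub (.var .i) 1)))) s
      fun s' t' => Sweep I C D st w (i - 1) 0 s' (t + (10 + t')) := by
  obtain ⟨hK, hi, hin, ho⟩ := h
  rw [wp_seq, wp_nset, wp_seq]
  refine WP.loop_of_le
    (fun s' t' => ∃ r, s'.nv .r = r ∧ Sweep I C D st (w + 20) i r s' (t + (15 + t')))
    (1000 * (I.n + 1) * (∑ q ∈ range I.n, D q) + 850 * (I.n + 1) + (w + 20)) ?_ ?_ ?_ ?_
  · rintro s' t' ⟨r, -, h⟩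
    have := h.time_le h1
    omega
  · refine ⟨0, by simp, hK.setN (by simp) _, by simp [hi], hin, ?_⟩
    rcases ho with ⟨h2, h3, h4⟩ | ⟨h2, D', h3, h4, h5, h6, h7⟩
    · omega
    · exact Or.inr ⟨by simp [h2], D', ⟨h3.layout, h3.tent⟩, h4, h5, by
        rw [State.setN_na]; omega, by simpa using h7⟩
  · rintro s' t' ⟨r, hr, h⟩ hb
    simp only [BExp.holds, NExp.eval, hr, h.reg_i] at hb
    refine (wp_checkJob hS hC h1 h hr hb.1 hb.2).imp ?_
    rintro s'' t'' ⟨r', hr', h'⟩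
    refine ⟨r', hr', ?_⟩
    convert h' using 1
    simp only [BExp.ops, NExp.ops]
    omega
  · rintro s' t' ⟨r, hr, h⟩ hb
    simp only [BExp.holds, NExp.eval, hr, h.reg_i] at hb
    obtain ⟨hK', hi', -, ho'⟩ := h
    rw [wp_nset]
    refine ⟨hK'.setN (by simp) _, by simp [hi'], by omega, ?_⟩
    rcases ho' with ⟨h2, h3, h4⟩ | ⟨h2, D', h3, h4, h5, h6, h7⟩
    · refine Or.inl ⟨by simp [h2], h3, ?_⟩
      simp only [BExp.ops, NExp.ops]
      omega
    · have hrs : r = s'.na .size 0 i := by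
        by_contra hne
        exact hb ⟨by omega, h2⟩
      refine Or.inr ⟨by simp [h2], D', ⟨h3.layout, h3.tent⟩, Nat.zero_le _, h5, ?_, ?_⟩
      · rw [State.setN_na, ← sum_Ioc_consecutive _ (show i - 1 ≤ i by omega) hin,
          show Ioc (i - 1) i = {i} by ext; simp; omega, sum_singleton, ← hrs]
        simp only [BExp.ops, NExp.ops]
        omega
      · simp only [State.setN_nv, State.setN_na, reduceCtorEq, if_false]
        refine h7.imp_left ?_
        rintro ⟨g1, g2, g3, g4⟩
        refine ⟨g1, g2, fun q hq hqi => ?_, by simp⟩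
        obtain hqi | hqi : i < st.na .pos 0 q ∨ st.na .pos 0 q = i := by omega
        · exact g3 q hq hqi
        · obtain ⟨-, -, r', hr', hqr⟩ := h3.layout.surj q hq hq.ne
          rw [g2, hqi] at hr' hqr
          rw [hqi, ← hqr]
          refine g4 r' ?_
          rw [hrs, g2]
          exact hr'

/-- A pass over the batches either shows that there is no schedule with costs below `y`, or finds
that all requirements are met, or decreases the potential `∑ D`, which also pays for the time. -/
theorem wp_adjust (hS : Static I st) (hc : Current I st.bound C D st) (hf : st.nv .fail = 0)
    (hC : ∀ k ≤ I.n, st.ra .C 0 k = C k) :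
    WP I.costs adjust st fun s t => Keeps sweepRegs batchArrs [] [] st s ∧
      (s.nv .fail = 1 ∧ (¬ ∃ a g, I.Good st.bound a g) ∧
        t ≤ 1000 * (I.n + 1) * (∑ q ∈ range I.n, D q) + 1000 * (I.n + 1) ∨
      s.nv .fail = 0 ∧ ∃ D', Current I st.bound C D' s ∧
        t + 1000 * (I.n + 1) * (∑ q ∈ range I.n, D' q) ≤
          1000 * (I.n + 1) * (∑ q ∈ range I.n, D q) + 1000 * (I.n + 1) ∧
        (s.nv .adj = 0 ∧ s.na = st.na ∧ (∀ q < I.n,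
            I.Meets st.bound q (C (st.na .pos 0 q))) ∧
            ∑ q ∈ range I.n, D' q ≤ ∑ q ∈ range I.n, D q ∨
          s.nv .adj = 1 ∧ ∑ q ∈ range I.n, D' q < ∑ q ∈ range I.n, D q)) := by
  unfold adjust
  rw [wp_seq, wp_nset, wp_seq, wp_nset]
  refine WP.loop_of_le (fun s t => ∃ i, Sweep I C D st 0 i 0 s t)
    (1000 * (I.n + 1) * (∑ q ∈ range I.n, D q) + 850 * (I.n + 1)) ?_ ?_ ?_ ?_
  · rintro s t ⟨i, h⟩
    rcases h.outcome with ⟨-, -, h⟩ | ⟨-, D', hc, hr, -, ht, -⟩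
    · omega
    · have := hc.layout.sum_le (l := i) (m := I.n) le_rfl
      omega
  · refine ⟨I.n, ((Keeps.refl st).setN (by simp) _).setN (by simp) _, by simp [hS.numJobs], le_rfl,
      Or.inr ⟨by simp [hf], D, ⟨hc.layout, hc.tent⟩, Nat.zero_le _, le_rfl, by simp, Or.inl
      ⟨by simp, rfl, fun q hq hqn => ?_, by simp⟩⟩⟩
    have := (hc.layout.surj q hq hq.ne).2.1
    omega
  · rintro s t ⟨i, h⟩ hb
    simp only [BExp.holds, NExp.eval, h.reg_i] at hb
    refine (wp_checkBatch hS hC (by omega) h hb.2).imp ?_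
    rintro s' t' h'
    refine ⟨i - 1, ?_⟩
    obtain ⟨g1, g2, g3, g4⟩ := h'
    refine ⟨g1, g2, g3, ?_⟩
    simp only [BExp.ops, NExp.ops]
    rcases g4 with ⟨f1, f2, f3⟩ | ⟨f1, D', f2, f3, f4, f5, f6⟩
    · exact Or.inl ⟨f1, f2, by omega⟩
    · exact Or.inr ⟨f1, D', f2, f3, f4, by omega, f6⟩
  · rintro s t ⟨i, h⟩ hb
    simp only [BExp.holds, NExp.eval, h.reg_i] at hb
    refine ⟨h.keeps, ?_⟩
    simp only [BExp.ops, NExp.ops]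
    rcases h.outcome with ⟨f1, f2, f3⟩ | ⟨f1, D', f2, f3, f4, f5, f6⟩
    · exact Or.inl ⟨f1, f2, by omega⟩
    · have hi0 : i = 0 := by
        by_contra hne
        exact hb ⟨by omega, f1⟩
      subst hi0
      have := f2.layout.sum_le (l := 0) (m := I.n) le_rfl
      refine Or.inr ⟨f1, D', f2, by omega, f6.imp_left ?_⟩
      rintro ⟨g1, g2, g3, -⟩
      exact ⟨g1, g2, fun q hq => g3 q hq (hc.layout.surj q hq hq.ne).1, f4⟩

/-! ### Scheduling the batches -/

theorem Layout.sum_batch {n : ℕ} {pos sz : ℕ → ℕ} {slot : ℕ → ℕ → ℕ} (h : Layout n n pos sz slot)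
    {k : ℕ} (h1 : 1 ≤ k) (h2 : k ≤ n) (p : ℕ → ℝ) :
    ∑ r ∈ range (sz k), p (slot k r) = ∑ x ∈ batchOf n pos k, p x := by
  refine sum_bij (fun r _ => slot k r) ?_ ?_ ?_ ?_
  · intro r hr
    rw [mem_range] at hr
    obtain ⟨h3, -, h4⟩ := h.mem k h1 h2 r hr
    exact mem_batchOf.mpr ⟨h3, h4⟩
  · intro r hr r' hr' he
    rw [mem_range] at hr hr'
    exact h.inj k h1 h2 r hr r' hr' he
  · intro x hx
    rw [mem_batchOf] at hx
    obtain ⟨-, -, r, hr, hrx⟩ := h.surj x hx.1 hx.1.ne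
    rw [hx.2] at hr hrx
    exact ⟨r, by simpa using hr, hrx⟩
  · intros
    rfl

/-- The start and completion times in memory are those of the current batches without idle time. -/
structure Timed (I : Instance) (st : State) : Prop where
  compl : ∀ k ≤ I.n, st.ra .C 0 k = finish I.n I.s I.procTime (st.na .pos 0) k
  start : ∀ k, 1 ≤ k → k ≤ I.n → (batchOf I.n (st.na .pos 0) k).Nonempty →
    st.ra .S 0 k = finish I.n I.s I.procTime (st.na .pos 0) (k - 1) + I.s

/-- Scheduling takes linear time, since every job is in only one batch. -/
theorem wp_schedBatches (hS : Static I st)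
    (hL : Layout I.n I.n (st.na .pos 0) (st.na .size 0) (st.na .slot)) :
    WP I.costs schedBatches st fun s t => Keeps [.i, .r] [] [] [.S, .C] st s ∧ Timed I s ∧
      t ≤ 200 * (I.n + 1) := by
  unfold schedBatches
  rw [wp_seq, wp_rput, wp_seq, wp_nset]
  simp only [NExp.eval, RExp.eval]
  refine WP.loop_of_le (fun s t => ∃ i, s.nv .i = i ∧ 1 ≤ i ∧ i ≤ I.n + 1 ∧
    Keeps [.i, .r] [] [] [.S, .C] st s ∧
    (∀ k < i, s.ra .C 0 k = finish I.n I.s I.procTime (st.na .pos 0) k) ∧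
    (∀ k, 1 ≤ k → k < i → (batchOf I.n (st.na .pos 0) k).Nonempty →
      s.ra .S 0 k = finish I.n I.s I.procTime (st.na .pos 0) (k - 1) + I.s) ∧
    t ≤ 100 * (i - 1) + 50 * ∑ k ∈ Ioc 0 (i - 1), st.na .size 0 k) (150 * I.n) ?_ ?_ ?_ ?_
  · rintro s t ⟨i, -, h1, h2, -, -, -, ht⟩
    have := hL.sum_le (l := 0) (m := i - 1) (by omega)
    omega
  · refine ⟨1, by simp, le_rfl, by omega, ((Keeps.refl st).putR (by simp) _ _ _).setN (by simp) _,
      ?_, ?_, by simp⟩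
    · intro k hk
      obtain rfl : k = 0 := by omega
      simp [finish]
    · intro k h1 h2
      omega
  · rintro s t ⟨i, hi, h1, h2, hK, hC, hSt, ht⟩ hb
    have e1 := hK.nv .numJobs (by simp)
    have e2 := hK.na .size (by simp)
    have e3 := hK.rv .setup (by simp)
    simp only [BExp.holds, NExp.eval, e1, hS.numJobs, hi] at hb
    have hin : i ≤ I.n := by omega
    have hne : (batchOf I.n (st.na .pos 0) i).Nonempty ↔ ¬ st.na .size 0 i = 0 := by
      rw [← card_pos, ← hL.counts i h1 hin]
      omega
    set v : ℝ := finish I.n I.s I.procTime (st.na .pos 0) (i - 1) +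
      (if (batchOf I.n (st.na .pos 0) i).Nonempty then I.s else 0) with hv
    -- both branches store the start time `v`
    have hbranch : WP I.costs (.cond (.neq (.read .size 0 (.var .i)) 0)
        (.rput .S 0 (.var .i) (.read .C 0 (.sub (.var .i) 1)))
        (.rput .S 0 (.var .i) (.add (.read .C 0 (.sub (.var .i) 1)) (.var .setup)))) s
        fun s' t' => s' = s.putR .S 0 i v ∧ t' ≤ 20 := by
      rw [wp_cond, wp_rput, wp_rput]
      simp only [BExp.holds, NExp.eval, RExp.eval, e2, e3, hi, hS.setup, hC (i - 1) (by omega)]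
      refine ⟨fun h => ⟨?_, by simp⟩, fun h => ⟨?_, by simp⟩⟩
      · rw [hv, if_neg (by rw [hne]; simpa using h), add_zero]
      · rw [hv, if_pos (hne.mpr h)]
    rw [wp_seq]
    refine hbranch.imp ?_
    rintro _ t₁ ⟨rfl, ht₁⟩
    rw [wp_seq, wp_rput, wp_seq]
    simp only [NExp.eval, RExp.eval, State.putR_nv, hi]
    set s₁ := (s.putR .S 0 i v).putR .C 0 i ((s.putR .S 0 i v).ra .S 0 i) with hs₁
    have hK₁ : Keeps [.i, .r] [] [] [.S, .C] st s₁ :=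
      (hK.putR (by simp) _ _ _).putR (by simp) _ _ _
    have f1 : s₁.nv .i = i := by simp [hs₁, hi]
    have f2 : s₁.ra .C 0 i = v := by simp [hs₁]
    have f3 : s₁.ra .S 0 i = v := by simp [hs₁]
    have f4 : ∀ k, k ≠ i → s₁.ra .C 0 k = s.ra .C 0 k := fun k hk => by simp [hs₁, hk]
    have f5 : ∀ k, k ≠ i → s₁.ra .S 0 k = s.ra .S 0 k := fun k hk => by simp [hs₁, hk]
    clear_value s₁
    refine WP.forUp (st.na .size 0 i) 20 (fun k s' => s'.nv .r = k ∧ s'.nv .i = i ∧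
      Keeps [.i, .r] [] [] [.S, .C] st s' ∧
      s'.ra .C 0 i = v + ∑ r ∈ range k, I.procTime (st.na .slot i r) ∧
      s'.ra .S 0 = s₁.ra .S 0 ∧ ∀ k, k ≠ i → s'.ra .C 0 k = s.ra .C 0 k) ?_ ?_ ?_ ?_
    · exact ⟨by simp, by simp [f1], hK₁.setN (by simp) _, by simp [f2], rfl, by simpa using f4⟩
    · rintro k s' ⟨g1, g2, g3, -⟩
      exact ⟨g1, by simp [g2, g3.na .size (by simp)]⟩
    · rintro k s' hk ⟨g1, g2, g3, g4, g5, g6⟩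
      rw [wp_rput]
      have e4 := g3.na .slot (by simp)
      have e5 := g3.ra .p (by simp)
      simp only [NExp.eval, RExp.eval, g1, g2, e4, e5, hS.proc, g4]
      refine ⟨⟨by simp [g1], by simp [g2], (g3.putR (by simp) _ _ _).setN (by simp) _, ?_, ?_, ?_⟩,
        by simp⟩
      · simp [sum_range_succ, add_assoc]
      · funext k'
        simp [g5]
      · intro k' hk'
        simp [hk', g6]
    · rintro s' t' ⟨g1, g2, g3, g4, g5, g6⟩ ht'
      rw [wp_nset]
      simp only [NExp.eval]
      rw [hL.sum_batch h1 hin] at g4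
      refine ⟨i + 1, by simp [g2], by omega, by omega, g3.setN (by simp) _, ?_, ?_, ?_⟩
      · intro k hk
        rw [State.setN_ra]
        by_cases hki : k = i
        · subst hki
          obtain ⟨m, rfl⟩ : ∃ m, k = m + 1 := ⟨k - 1, by omega⟩
          rw [g4, finish, hv, Nat.add_sub_cancel]
        · rw [g6 k hki]
          exact hC k (by omega)
      · intro k h3 h4 h5
        rw [State.setN_ra, g5]
        by_cases hki : k = i
        · subst hki
          rw [f3, hv, if_pos h5]
        · rw [f5 k hki]
          exact hSt k h3 (by omega) h5
      · have hsum : ∑ k ∈ Ioc 0 (i + 1 - 1), st.na .size 0 k =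
            ∑ k ∈ Ioc 0 (i - 1), st.na .size 0 k + st.na .size 0 i := by
          rw [Nat.add_sub_cancel, ← sum_Ioc_consecutive _ (show 0 ≤ i - 1 by omega)
            (show i - 1 ≤ i by omega), show Ioc (i - 1) i = {i} by ext; simp; omega,
            sum_singleton]
        rw [hsum]
        simp only [BExp.ops, RExp.ops, NExp.ops] at ht' ⊢
        omega
  · rintro s t ⟨i, hi, h1, h2, hK, hC, hSt, ht⟩ hb
    simp only [BExp.holds, NExp.eval, hK.nv .numJobs (by simp), hS.numJobs, hi, not_not] at hb
    refine ⟨hK, ⟨?_, ?_⟩, ?_⟩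
    · intro k hk
      rw [hK.na .pos (by simp)]
      exact hC k (by omega)
    · intro k h3 h4
      rw [hK.na .pos (by simp)]
      exact hSt k h3 (by omega)
    · have := hL.sum_le (l := 0) (m := i - 1) (by omega)
      simp only [BExp.ops, NExp.ops, RExp.ops]
      omega

/-! ### Searching for a schedule with costs below the bound -/

/-- The search either finds that there is no schedule with costs below `y`, or ends with a schedule
that meets all requirements and is a greedy packing for valid bounds. -/
theorem wp_improAux (hS : Static I st) (hc : Current I st.bound C D st) (hf : st.nv .fail = 0) :
    WP I.costs improAux st fun s t => Keeps sweepRegs batchArrs [] [.S, .C] st s ∧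
      (s.nv .fail = 1 ∧ (¬ ∃ a g, I.Good st.bound a g) ∧
        t ≤ 3000 * (I.n + 1) * (∑ q ∈ range I.n, D q) + 3000 * (I.n + 1) ∨
      s.nv .fail = 0 ∧ ∃ D', Timed I s ∧
        Current I st.bound (finish I.n I.s I.procTime (s.na .pos 0)) D' s ∧
        (∀ q < I.n, I.Meets st.bound q
          (finish I.n I.s I.procTime (s.na .pos 0) (s.na .pos 0 q))) ∧
        t + 3000 * (I.n + 1) * (∑ q ∈ range I.n, D' q) ≤
          3000 * (I.n + 1) * (∑ q ∈ range I.n, D q) + 3000 * (I.n + 1) ∧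
        (s.na .pos = st.na .pos ∧ ∑ q ∈ range I.n, D' q ≤ ∑ q ∈ range I.n, D q ∨
          ∑ q ∈ range I.n, D' q < ∑ q ∈ range I.n, D q)) := by
  unfold improAux
  rw [wp_seq, wp_nset]
  refine WP.loop_of_le (fun s t => Keeps sweepRegs batchArrs [] [.S, .C] st s ∧
      (s.nv .fail = 1 ∧ (¬ ∃ a g, I.Good st.bound a g) ∧
        t ≤ 3000 * (I.n + 1) * (∑ q ∈ range I.n, D q) + 1800 * (I.n + 1) ∨
      (s.nv .fail = 0 ∧ s.nv .adj = 0 ∧ ∃ D', Timed I s ∧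
        Current I st.bound (finish I.n I.s I.procTime (s.na .pos 0)) D' s ∧
        (∀ q < I.n, I.Meets st.bound q
          (finish I.n I.s I.procTime (s.na .pos 0) (s.na .pos 0 q))) ∧
        t + 3000 * (I.n + 1) * (∑ q ∈ range I.n, D' q) ≤
          3000 * (I.n + 1) * (∑ q ∈ range I.n, D q) + 1800 * (I.n + 1) ∧
        (s.na .pos = st.na .pos ∧ ∑ q ∈ range I.n, D' q ≤ ∑ q ∈ range I.n, D q ∨
          ∑ q ∈ range I.n, D' q < ∑ q ∈ range I.n, D q)) ∨
      s.nv .fail = 0 ∧ s.nv .adj = 1 ∧ ∃ C' D', Current I st.bound C' D' s ∧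
        t + 3000 * (I.n + 1) * (∑ q ∈ range I.n, D' q) ≤
          3000 * (I.n + 1) * (∑ q ∈ range I.n, D q) ∧
        (s.na .pos = st.na .pos ∧ ∑ q ∈ range I.n, D' q ≤ ∑ q ∈ range I.n, D q ∨
          ∑ q ∈ range I.n, D' q < ∑ q ∈ range I.n, D q)))
    (3000 * (I.n + 1) * (∑ q ∈ range I.n, D q) + 1800 * (I.n + 1)) ?_ ?_ ?_ ?_
  · rintro s t ⟨-, ⟨-, -, h⟩ | ⟨-, -, D', -, -, -, h, -⟩ | ⟨-, -, C', D', -, h, -⟩⟩ <;> omega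
  · exact ⟨(Keeps.refl st).setN (by simp) _, Or.inr (Or.inr ⟨by simp [hf], by simp, C, D,
      ⟨hc.layout, hc.tent⟩, by omega, Or.inl ⟨by simp, le_rfl⟩⟩)⟩
  · rintro s t ⟨hK, h⟩ hb
    simp only [BExp.holds, NExp.eval] at hb
    rcases h with ⟨h1, -⟩ | ⟨-, h1, -⟩ | ⟨h1, h2, C', D', h3, h4, h5⟩
    · omega
    · omega
    · have hSs : Static I s := hS.of_keeps hK (by simp) (by simp) (by simp) (by simp)
      rw [wp_seq]
      refine (wp_schedBatches hSs h3.layout).imp ?_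
      rintro s₁ t₁ ⟨hK₁, hT, ht₁⟩
      have hK₂ : Keeps sweepRegs batchArrs [] [.S, .C] st s₁ :=
        hK.trans (hK₁.mono (by simp) (by simp) (by simp) (by simp))
      have hna : s₁.na = s.na := by
        funext a
        exact hK₁.na a (by simp)
      have hy : s₁.bound = st.bound := hK₂.bound_eq (by simp) (by simp)
      have hc₁ : Current I s₁.bound (finish I.n I.s I.procTime (s₁.na .pos 0)) D' s₁ := by
        rw [hy]
        refine ⟨by rw [hna]; exact h3.layout, ?_⟩
        rw [hna]
        exact h3.tent.reschedule h3.layout.counts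
      refine (wp_adjust (hS.of_keeps hK₂ (by simp) (by simp) (by simp) (by simp)) hc₁
        (by rw [hK₁.nv .fail (by simp), h1]) hT.compl).imp ?_
      rintro s₂ t₂ ⟨hK₃, hres⟩
      refine ⟨hK₂.trans (hK₃.mono (by simp) (by simp) (by simp) (by simp)), ?_⟩
      simp only [BExp.ops, NExp.ops]
      rw [hy] at hres
      have hle : ∑ q ∈ range I.n, D' q ≤ ∑ q ∈ range I.n, D q := by omega
      have htwo : ∀ m, 3000 * (I.n + 1) * m = 3 * (1000 * (I.n + 1) * m) := fun m => by ring
      simp only [htwo] at h4 ⊢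
      rcases hres with ⟨g1, g2, g3⟩ | ⟨g1, D'', g2, g3, ⟨g4, g5, g6, g7⟩ | ⟨g4, g5⟩⟩
      · exact Or.inl ⟨g1, g2, by omega⟩
      · -- nothing has been adjusted, so the computed times are those of the current batches
        refine Or.inr (Or.inl ⟨g1, g4, D'', ⟨?_, ?_⟩, ?_, ?_, ?_, ?_⟩)
        · rw [hK₃.ra .C (by simp), g5]
          exact hT.compl
        · rw [hK₃.ra .S (by simp), g5]
          exact hT.start
        · rwa [g5]
        · rwa [g5]
        · have := Nat.mul_le_mul_left (1000 * (I.n + 1)) g7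
          omega
        · rw [g5, hna]
          rcases h5 with ⟨h5, h6⟩ | h5
          · exact Or.inl ⟨h5, g7.trans h6⟩
          · exact Or.inr (lt_of_le_of_lt g7 h5)
      · refine Or.inr (Or.inr ⟨g1, g4, _, D'', g2, ?_, Or.inr (lt_of_lt_of_le g5 hle)⟩)
        have hmul := Nat.mul_le_mul_left (1000 * (I.n + 1)) (Nat.succ_le_of_lt g5)
        rw [Nat.mul_succ] at hmul
        omega
  · rintro s t ⟨hK, h⟩ hb
    simp only [BExp.holds, NExp.eval] at hb
    refine ⟨hK, ?_⟩
    simp only [BExp.ops, NExp.ops]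
    rcases h with ⟨h1, h2, h3⟩ | ⟨h1, h2, D', h3, h4, h5, h6, h7⟩ | ⟨h1, h2, C', D', h3, h4, h5⟩
    · exact Or.inl ⟨h1, h2, by omega⟩
    · exact Or.inr ⟨h1, D', h3, h4, h5, by omega, h7⟩
    · exact absurd ⟨h2, h1⟩ hb

end

/-! ### Forming the first batches -/

/-- The situation while the first batches are formed: the batches after batch `i` are complete,
batch `i` is being filled, and the jobs with `pos = 0` have not been assigned yet. -/
structure Forming (n b : ℕ) (p : ℕ → ℝ) (pos sz : ℕ → ℕ) (slot : ℕ → ℕ → ℕ) (i : ℕ) : Prop where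
  mem : ∀ k, 1 ≤ k → k ≤ n → ∀ r < sz k, slot k r < n ∧ pos (slot k r) = k
  inj : ∀ k, 1 ≤ k → k ≤ n → ∀ r < sz k, ∀ r' < sz k, slot k r = slot k r' → r = r'
  surj : ∀ q < n, pos q ≠ 0 → i ≤ pos q ∧ pos q ≤ n ∧ ∃ r < sz (pos q), slot (pos q) r = q
  cap : ∀ k, sz k ≤ b
  zero : ∀ k < i, sz k = 0
  full : ∀ j < n, ∀ k, i < k → k ≤ n → pos j < k → sz k = b ∧ ∀ x < n, pos x = k → p j ≤ p x
  part : ∀ j < n, pos j = 0 → 1 ≤ i → ∀ x < n, pos x = i → p j ≤ p x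

section
variable {n b : ℕ} {p : ℕ → ℝ} {pos sz : ℕ → ℕ} {slot : ℕ → ℕ → ℕ} {i x : ℕ}

theorem Forming.add (h : Forming n b p pos sz slot i) (h1 : 1 ≤ i) (hin : i ≤ n) (hx : x < n)
    (hx0 : pos x = 0) (hmax : ∀ q < n, pos q = 0 → p q ≤ p x) (hlt : sz i < b) :
    Forming n b p (Function.update pos x i) (Function.update sz i (sz i + 1))
      (put2 slot i (sz i) x) i := by
  have hpx : Function.update pos x i x = i := Function.update_self ..
  have hps : ∀ q, q ≠ x → Function.update pos x i q = pos q :=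
    fun q hq => Function.update_of_ne hq ..
  have hsz : ∀ k, k ≠ i → Function.update sz i (sz i + 1) k = sz k :=
    fun k hk => Function.update_of_ne hk ..
  have hsi : Function.update sz i (sz i + 1) i = sz i + 1 := Function.update_self ..
  have hnx : ∀ k, 1 ≤ k → k ≤ n → ∀ r < sz k, slot k r ≠ x := by
    rintro k h2 h3 r hr rfl
    have := (h.mem k h2 h3 r hr).2
    omega
  have hlt' : ∀ k r, r < Function.update sz i (sz i + 1) k → ¬ (k = i ∧ r = sz i) → r < sz k := by
    intro k r hr hc
    by_cases hk : k = i
    · subst hk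
      have : r ≠ sz k := fun h => hc ⟨rfl, h⟩
      omega
    · rwa [hsz k hk] at hr
  refine ⟨fun k h2 h3 r hr => ?_, fun k h2 h3 r hr r' hr' he => ?_, fun q hq hq0 => ?_,
    fun k => ?_, fun k hk => ?_, fun j hj k h2 h3 h4 => ?_, fun j hj hj0 _ w hw hwi => ?_⟩
  · unfold put2
    split_ifs with hc
    · exact ⟨hx, by rw [hpx, hc.1]⟩
    · have := hlt' k r hr hc
      obtain ⟨h5, h6⟩ := h.mem k h2 h3 r this
      exact ⟨h5, by rw [hps _ (hnx k h2 h3 r this), h6]⟩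
  · unfold put2 at he
    split_ifs at he with hc1 hc2 hc2
    · exact hc1.2.trans hc2.2.symm
    · exact absurd he.symm (hnx k h2 h3 r' (hlt' k r' hr' hc2))
    · exact absurd he (hnx k h2 h3 r (hlt' k r hr hc1))
    · exact h.inj k h2 h3 r (hlt' k r hr hc1) r' (hlt' k r' hr' hc2) he
  · by_cases hqx : q = x
    · subst hqx
      rw [hpx, hsi]
      exact ⟨le_rfl, hin, sz i, by omega, by simp [put2]⟩
    · rw [hps q hqx] at hq0 ⊢
      obtain ⟨h2, h3, r, hr, hrq⟩ := h.surj q hq hq0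
      refine ⟨h2, h3, r, ?_, ?_⟩
      · by_cases hk : pos q = i
        · rw [hk] at hr ⊢
          omega
        · rwa [hsz _ hk]
      · unfold put2
        rw [if_neg, hrq]
        rintro ⟨hc1, hc2⟩
        rw [hc1] at hr
        omega
  · by_cases hk : k = i
    · subst hk
      omega
    · rw [hsz k hk]
      exact h.cap k
  · rw [hsz k hk.ne]
    exact h.zero k hk
  · rw [hsz k (by omega)]
    have hj' : pos j < k := by
      by_cases hjx : j = x
      · subst hjx; omega
      · rwa [hps j hjx] at h4
    obtain ⟨h5, h6⟩ := h.full j hj k h2 h3 hj'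
    refine ⟨h5, fun w hw hwk => ?_⟩
    have hwx : w ≠ x := by
      rintro rfl
      omega
    exact h6 w hw (by rwa [hps w hwx] at hwk)
  · have hjx : j ≠ x := by
      rintro rfl
      omega
    rw [hps j hjx] at hj0
    by_cases hwx : w = x
    · rw [hwx]
      exact hmax j hj hj0
    · rw [hps w hwx] at hwi
      exact h.part j hj hj0 h1 w hw hwi

theorem Forming.next (h : Forming n b p pos sz slot i) (h1 : 1 ≤ i) (hin : i ≤ n)
    (hd : sz i = b ∨ ∀ q < n, pos q ≠ 0) : Forming n b p pos sz slot (i - 1) := by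
  refine ⟨h.mem, h.inj, fun q hq hq0 => ?_, h.cap, fun k hk => h.zero k (by omega),
    fun j hj k h2 h3 h4 => ?_, fun j hj hj0 h2 x hx hxi => ?_⟩
  · obtain ⟨h2, h3⟩ := h.surj q hq hq0
    exact ⟨by omega, h3⟩
  · obtain rfl | hk : k = i ∨ i < k := by omega
    · have hj0 : pos j = 0 := by
        by_contra hne
        have := (h.surj j hj hne).1
        omega
      rcases hd with hd | hd
      · exact ⟨hd, h.part j hj hj0 h1⟩
      · exact absurd hj0 (hd j hj)
    · exact h.full j hj k hk h3 h4
  · have := (h.surj x hx (by omega)).1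
    omega

theorem Forming.pos_ne_zero (h : Forming n b p pos sz slot 0) (hb : 1 ≤ b) :
    ∀ q < n, pos q ≠ 0 := by
  intro q hq hq0
  have hfull : ∀ k, 1 ≤ k → k ≤ n → 0 < sz k := fun k h2 h3 => by
    have := (h.full q hq k (by omega) h3 (by omega)).1
    omega
  have hcard := card_le_card_of_injOn (s := Icc 1 n) (t := (range n).erase q) (fun k => slot k 0)
    (fun k hk => ?_) (fun k hk k' hk' he => ?_)
  · rw [Nat.card_Icc, card_erase_of_mem (by simpa using hq), card_range] at hcard
    omega
  · rw [coe_Icc, Set.mem_Icc] at hk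
    obtain ⟨h2, h3⟩ := h.mem k hk.1 hk.2 0 (hfull k hk.1 hk.2)
    simp only [coe_erase, coe_range, Set.mem_sdiff, Set.mem_Iio, Set.mem_singleton_iff]
    refine ⟨h2, fun he => ?_⟩
    rw [he] at h3
    omega
  · rw [coe_Icc, Set.mem_Icc] at hk hk'
    have h2 := (h.mem k hk.1 hk.2 0 (hfull k hk.1 hk.2)).2
    have h3 := (h.mem k' hk'.1 hk'.2 0 (hfull k' hk'.1 hk'.2)).2
    simp only at he
    rw [← h2, he, h3]

theorem Forming.layout (h : Forming n b p pos sz slot 0) (hb : 1 ≤ b) :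
    Layout n n pos sz slot where
  mem k h1 h2 r hr := by
    obtain ⟨h3, h4⟩ := h.mem k h1 h2 r hr
    exact ⟨h3, h3.ne, h4⟩
  inj := h.inj
  surj q hq _ := by
    have h0 := h.pos_ne_zero hb q hq
    obtain ⟨-, h2⟩ := h.surj q hq h0
    exact ⟨by omega, h2⟩

theorem Forming.greedy (h : Forming n b p pos sz slot 0) (hb : 1 ≤ b) :
    Greedy n b p (fun _ => n) sz pos where
  one_le j hj := Nat.one_le_iff_ne_zero.mpr (h.pos_ne_zero hb j hj)
  le_bound j hj := (h.surj j hj (h.pos_ne_zero hb j hj)).2.1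
  bound_le _ _ := le_rfl
  cap k _ _ := h.cap k
  full j hj k h1 h2 := h.full j hj k (by omega) h2 h1

theorem Greedy.contiguous (h : Greedy n b p (fun _ => n) sz pos) (hc : Counts n sz pos)
    (hb : 1 ≤ b) : Contiguous n sz := by
  intro k k' h1 h2 h3 h4
  rw [hc k h1 (h2.trans h3), card_pos] at h4
  obtain ⟨x, hx⟩ := h4
  rw [mem_batchOf] at hx
  obtain rfl | hk : k' = k ∨ k < k' := by omega
  · rw [hc k' h1 h3, card_pos]
    exact ⟨x, mem_batchOf.mpr hx⟩
  · have := (h.full x hx.1 k' (by omega) h3).1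
    omega

end

section
variable {I : Instance} {st : State} {i : ℕ}

/-- The search for a longest job that is not assigned yet. -/
theorem wp_findUnassigned (hS : Static I st) (hi : st.nv .i = i) (hin : i ≤ I.n)
    (hf : st.nv .found = 0) (hcsf : ∀ q < I.n, st.na .csf 0 q = I.n) :
    WP I.costs (forUp .q (.var .numJobs)
        (when (.and (.neq (.read .pos 0 (.var .q)) 0) (.and
            (.not (.nlt (.read .csf 0 (.var .q)) (.var .i)))
            (.or (.neq (.var .found) 0) (.rlt (.read .p 0 (.var .x)) (.read .p 0 (.var .q))))))
          (.seq (.nset .found 1) (.nset .x (.var .q))))) st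
      fun s t => Keeps [.q, .found, .x] [] [] [] st s ∧ t ≤ 60 * (I.n + 1) ∧
        (s.nv .found = 0 ∧ (∀ q < I.n, st.na .pos 0 q ≠ 0) ∨
        s.nv .found = 1 ∧ ∃ x < I.n, s.nv .x = x ∧ st.na .pos 0 x = 0 ∧
          ∀ q < I.n, st.na .pos 0 q = 0 → I.procTime q ≤ I.procTime x) := by
  refine WP.forUp I.n 45 (fun k s => s.nv .q = k ∧ Keeps [.q, .found, .x] [] [] [] st s ∧
        (s.nv .found = 0 ∧ (∀ q < k, st.na .pos 0 q ≠ 0) ∨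
        s.nv .found = 1 ∧ ∃ x < I.n, s.nv .x = x ∧ st.na .pos 0 x = 0 ∧
          ∀ q < k, st.na .pos 0 q = 0 → I.procTime q ≤ I.procTime x)) ?_ ?_ ?_ ?_
  · exact ⟨by simp, (Keeps.refl st).setN (by simp) _, Or.inl ⟨by simp [hf], by simp⟩⟩
  · rintro k s ⟨hq, hK, -⟩
    exact ⟨hq, by simp [hK.nv .numJobs (by simp), hS.numJobs]⟩
  · rintro k s hk ⟨hq, hK, hs⟩
    have e1 := hK.nv .i (by simp)
    have e2 := hK.na .pos (by simp)
    have e3 := hK.ra .p (by simp)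
    have e4 := hK.na .csf (by simp)
    rw [wp_cond, wp_seq, wp_nset, wp_nset, wp_skip]
    simp only [BExp.holds, RExp.eval, NExp.eval, e1, e2, e3, e4, hq, hi, hS.proc, hcsf k hk]
    refine ⟨fun h => ⟨⟨?_, ?_, ?_⟩, ?_⟩, fun h => ⟨⟨?_, ?_, ?_⟩, ?_⟩⟩
    · simp [hq]
    · exact ((hK.setN (by simp) _).setN (by simp) _).setN (by simp) _
    · refine Or.inr ⟨by simp, k, hk, by simp [hq], h.1, fun q hqk h1 => ?_⟩
      obtain hqk | rfl : q < k ∨ q = k := by omega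
      · rcases hs with ⟨-, hs⟩ | ⟨hs, x, hx, hxx, h3, h5⟩
        · exact absurd h1 (hs q hqk)
        · have h6 := h.2.2
          rw [hs, hxx] at h6
          simp only [one_ne_zero, false_or] at h6
          exact (h5 q hqk h1).trans h6.le
      · exact le_rfl
    · simp
    · simp
    · exact hK.setN (by simp) _
    · rcases hs with ⟨hs0, hs⟩ | ⟨hs1, x, hx, hxx, h3, h5⟩
      · refine Or.inl ⟨by simp [hs0], fun q hqk h1 => ?_⟩
        obtain hqk | rfl : q < k ∨ q = k := by omega
        · exact hs q hqk h1
        · exact h ⟨h1, by omega, Or.inl hs0⟩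
      · refine Or.inr ⟨by simp [hs1], x, hx, by simp [hxx], h3, fun q hqk h1 => ?_⟩
        obtain hqk | rfl : q < k ∨ q = k := by omega
        · exact h5 q hqk h1
        · by_contra hlt
          refine h ⟨h1, by omega, Or.inr ?_⟩
          rw [hxx]
          exact not_le.mp hlt
    · simp
  · rintro s t ⟨hq, hK, hs⟩ ht
    refine ⟨hK, ht.trans ?_, hs⟩
    simp only [NExp.ops]
    omega

/-- Filling batch `i`. -/
theorem wp_fillBatch (hS : Static I st) (hi : st.nv .i = i) (h1 : 1 ≤ i) (hin : i ≤ I.n)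
    (hf : st.nv .found = 1) (hcsf : ∀ q < I.n, st.na .csf 0 q = I.n)
    (hF : Forming I.n I.b I.procTime (st.na .pos 0) (st.na .size 0) (st.na .slot) i) :
    WP I.costs (.loop (.and (.nlt (.read .size 0 (.var .i)) (.var .cap)) (.neq (.var .found) 1))
      (.seq (.nset .found 0) (.seq (forUp .q (.var .numJobs)
        (when (.and (.neq (.read .pos 0 (.var .q)) 0) (.and
            (.not (.nlt (.read .csf 0 (.var .q)) (.var .i)))
            (.or (.neq (.var .found) 0) (.rlt (.read .p 0 (.var .x)) (.read .p 0 (.var .q))))))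
          (.seq (.nset .found 1) (.nset .x (.var .q)))))
      (when (.neq (.var .found) 1) (.seq (.nput .pos 0 (.var .x) (.var .i)) (.seq
        (.nput .slot (.var .i) (.read .size 0 (.var .i)) (.var .x))
        (.nput .size 0 (.var .i) (.add (.read .size 0 (.var .i)) 1)))))))) st
      fun s t => Keeps [.q, .found, .x] [.pos, .slot, .size] [] [] st s ∧
        Forming I.n I.b I.procTime (s.na .pos 0) (s.na .size 0) (s.na .slot) i ∧
        (s.na .size 0 i = I.b ∨ ∀ q < I.n, s.na .pos 0 q ≠ 0) ∧
        t ≤ 100 * (I.n + 1) * (I.n + 1) := by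
  have hbn := I.b_lt_n
  refine WP.loop_of_le (fun s t => Keeps [.q, .found, .x] [.pos, .slot, .size] [] [] st s ∧
    Forming I.n I.b I.procTime (s.na .pos 0) (s.na .size 0) (s.na .slot) i ∧
    (s.nv .found = 1 ∧ t ≤ 100 * (I.n + 1) * s.na .size 0 i ∨
      s.nv .found = 0 ∧ (∀ q < I.n, s.na .pos 0 q ≠ 0) ∧
      t ≤ 100 * (I.n + 1) * (s.na .size 0 i + 1))) (100 * (I.n + 1) * I.n) ?_ ?_ ?_ ?_
  · rintro s t ⟨-, hF', ⟨-, ht⟩ | ⟨-, -, ht⟩⟩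
    · have := hF'.cap i
      exact ht.trans (Nat.mul_le_mul_left _ (by omega))
    · have := hF'.cap i
      exact ht.trans (Nat.mul_le_mul_left _ (by omega))
  · exact ⟨Keeps.refl st, hF, Or.inl ⟨hf, Nat.zero_le _⟩⟩
  · rintro s t ⟨hK, hF', hs⟩ hb
    simp only [BExp.holds, NExp.eval, hK.nv .i (by simp), hi, hK.nv .cap (by simp), hS.cap] at hb
    rcases hs with ⟨-, ht⟩ | ⟨hs, -⟩
    · rw [wp_seq, wp_nset, wp_seq]
      have hK₀ : Keeps [.q, .found, .x] [.pos, .slot, .size] [] [] st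
        (s.setN .found (NExp.eval s 0)) := hK.setN (by simp) _
      refine (wp_findUnassigned (i := i) (hS.of_keeps hK₀ (by simp) (by simp) (by simp) (by simp))
        (by rw [hK₀.nv .i (by simp), hi]) hin (by simp)
        (by rw [hK₀.na .csf (by simp)]; exact hcsf)).imp ?_
      rintro s₁ t₁ ⟨hK₁, ht₁, hres⟩
      have hK₂ : Keeps [.q, .found, .x] [.pos, .slot, .size] [] [] st s₁ :=
        hK₀.trans (hK₁.mono (by simp) (by simp) (by simp) (by simp))
      have hna : s₁.na = s.na := by
        funext a
        exact hK₁.na a (by simp)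
      have hi₁ : s₁.nv .i = i := by rw [hK₂.nv .i (by simp), hi]
      rw [wp_cond, wp_skip]
      simp only [BExp.holds, NExp.eval]
      rw [State.setN_na] at hres
      refine ⟨fun hf₁ => ?_, fun hf₁ => ?_⟩
      · rcases hres with ⟨hf₁', -⟩ | ⟨-, x, hx, hxx, hx0, hmax⟩
        · omega
        · rw [wp_seq, wp_nput, wp_seq, wp_nput, wp_nput]
          simp only [NExp.eval, State.putN_nv, State.putN_of_ne, ne_eq, reduceCtorEq,
            not_false_eq_true, hi₁, hxx, hna]
          refine ⟨((hK₂.putN (by simp) _ _ _).putN (by simp) _ _ _).putN (by simp) _ _ _, ?_,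
            Or.inl ⟨by simpa using hf₁, ?_⟩⟩
          · simp only [State.putN_table, State.putN_of_ne, ne_eq, reduceCtorEq, not_false_eq_true,
              put2_row, hna]
            exact hF'.add h1 hin hx hx0 hmax hb.1
          · simp only [State.putN_table, put2_row, Function.update_self]
            rw [Nat.mul_add]
            simp only [BExp.ops, NExp.ops]
            omega
      · rcases hres with ⟨hf₁', hall⟩ | ⟨hf₁', -⟩
        · refine ⟨hK₂, by rwa [hna], Or.inr ⟨hf₁', by rwa [hna], ?_⟩⟩
          rw [hna, Nat.mul_add]
          simp only [BExp.ops, NExp.ops]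
          omega
        · omega
    · omega
  · rintro s t ⟨hK, hF', hs⟩ hb
    simp only [BExp.holds, NExp.eval, hK.nv .i (by simp), hi, hK.nv .cap (by simp), hS.cap] at hb
    have hcap := hF'.cap i
    refine ⟨hK, hF', ?_, ?_⟩
    · rcases hs with ⟨hs, -⟩ | ⟨-, hs, -⟩
      · left
        by_contra hne
        exact hb ⟨by omega, hs⟩
      · exact Or.inr hs
    · have : t ≤ 100 * (I.n + 1) * I.n := by
        rcases hs with ⟨-, ht⟩ | ⟨-, -, ht⟩ <;> exact ht.trans (Nat.mul_le_mul_left _ (by omega))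
      rw [Nat.mul_add]
      simp only [BExp.ops, NExp.ops]
      omega

theorem wp_formBatches (hS : Static I st) (hf : st.nv .fail = 0)
    (hcsf : ∀ q < I.n, st.na .csf 0 q = I.n) (hsz : ∀ k, st.na .size 0 k = 0) :
    WP I.costs formBatches st fun s t =>
      Keeps [.j, .i, .q, .found, .x] [.pos, .slot, .size] [] [] st s ∧
      Layout I.n I.n (s.na .pos 0) (s.na .size 0) (s.na .slot) ∧
      Greedy I.n I.b I.procTime (fun _ => I.n) (s.na .size 0) (s.na .pos 0) ∧
      t ≤ 400 * (I.n + 1) * (I.n + 1) * (I.n + 1) := by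
  unfold formBatches
  rw [wp_seq]
  refine WP.forUp I.n 10 (fun k s => s.nv .j = k ∧ Keeps [.j] [.pos] [] [] st s ∧
    ∀ q < k, s.na .pos 0 q = 0) ?_ ?_ ?_ ?_
  · exact ⟨by simp, (Keeps.refl st).setN (by simp) _, by simp⟩
  · rintro k s ⟨hq, hK, -⟩
    exact ⟨hq, by simp [hK.nv .numJobs (by simp), hS.numJobs]⟩
  · rintro k s hk ⟨hq, hK, hs⟩
    rw [wp_nput]
    refine ⟨⟨by simp [hq], (hK.putN (by simp) _ _ _).setN (by simp) _, fun q hqk => ?_⟩, by simp⟩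
    simp only [State.setN_na, State.putN_na, NExp.eval, hq, true_and]
    split_ifs with hqk'
    · rfl
    · exact hs q (by omega)
  rintro s₀ t₀ ⟨-, hK₀, hpos⟩ ht₀
  rw [wp_seq, wp_nset]
  simp only [NExp.eval, hK₀.nv .numJobs (by simp), hS.numJobs]
  set B := 200 * (I.n + 1) * (I.n + 1) with hB
  have hsq : I.n + 1 ≤ (I.n + 1) * (I.n + 1) := Nat.le_mul_of_pos_left _ (by omega)
  refine WP.loop_of_le (fun s t => ∃ i ≤ I.n, s.nv .i = i ∧
    Keeps [.j, .i, .q, .found, .x] [.pos, .slot, .size] [] [] st s ∧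
    Forming I.n I.b I.procTime (s.na .pos 0) (s.na .size 0) (s.na .slot) i ∧
    s.na .size 0 i = 0 ∧ t ≤ B * (I.n - i)) (B * I.n) ?_ ?_ ?_ ?_
  · rintro s t ⟨i, hi, -, -, -, -, ht⟩
    exact ht.trans (Nat.mul_le_mul_left _ (by omega))
  · refine ⟨I.n, le_rfl, by simp, (hK₀.mono (by simp) (by simp) (by simp) (by simp)).setN
      (by simp) _, ?_, by rw [State.setN_na, hK₀.na .size (by simp)]; exact hsz _, Nat.zero_le _⟩
    have hz : ∀ k, s₀.na .size 0 k = 0 := by rw [hK₀.na .size (by simp)]; exact hsz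
    rw [State.setN_na]
    refine ⟨?_, ?_, ?_, ?_, ?_, ?_, ?_⟩
    · intro k _ _ r hr
      rw [hz] at hr
      omega
    · intro k _ _ r hr
      rw [hz] at hr
      omega
    · intro q hq hq0
      exact absurd (hpos q hq) hq0
    · intro k
      rw [hz]
      omega
    · intro k _
      exact hz k
    · intro j _ k h2 h3
      omega
    · intro j hj _ h2 x hx hxn
      rw [hpos x hx] at hxn
      omega
  · rintro s t ⟨i, hin, hi, hK, hF, hsi, ht⟩ hb
    simp only [BExp.holds, NExp.eval, hi] at hb
    rw [wp_seq, wp_nput, wp_seq, wp_nset, wp_seq]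
    simp only [NExp.eval, hi]
    set s₁ := (s.putN .size 0 i 0).setN .found 1 with hs₁
    have hK₁ : Keeps [.j, .i, .q, .found, .x] [.pos, .slot, .size] [] [] st s₁ :=
      (hK.putN (by simp) _ _ _).setN (by simp) _
    have hi₁ : s₁.nv .i = i := by simp [hs₁, hi]
    have hf₁ : s₁.nv .found = 1 := by simp [hs₁]
    have hF₁ : Forming I.n I.b I.procTime (s₁.na .pos 0) (s₁.na .size 0) (s₁.na .slot) i := by
      simp only [hs₁, State.setN_na, State.putN_table, State.putN_of_ne, ne_eq, reduceCtorEq,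
        not_false_eq_true, put2_row]
      have hup : Function.update (s.na .size 0) i 0 = s.na .size 0 := by
        funext k
        by_cases hk : k = i <;> simp [hk, hsi]
      rw [hup]
      exact hF
    clear_value s₁
    refine (wp_fillBatch (hS.of_keeps hK₁ (by simp) (by simp) (by simp) (by simp)) hi₁ hb.1 hin hf₁
      (by rw [hK₁.na .csf (by simp)]; exact hcsf) hF₁).imp ?_
    rintro s₂ t₂ ⟨hK₂, hF₂, hd, ht₂⟩
    have hK₃ : Keeps [.j, .i, .q, .found, .x] [.pos, .slot, .size] [] [] st s₂ :=
      hK₁.trans (hK₂.mono (by simp) (by simp) (by simp) (by simp))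
    have hi₂ : s₂.nv .i = i := by rw [hK₂.nv .i (by simp), hi₁]
    -- no job has a set index below `i`, so this check never fails
    have hcheck : WP I.costs (when (.neq (.read .size 0 (.var .i)) 0)
        (forUp .q (.var .numJobs) (when (.nlt (.read .csf 0 (.var .q)) (.var .i))
          (.nset .fail 1)))) s₂
        fun s t => Keeps [.q] [] [] [] s₂ s ∧ t ≤ 40 * (I.n + 1) := by
      rw [wp_cond, wp_skip]
      refine ⟨fun _ => ?_, fun _ => ⟨Keeps.refl _, by simp; omega⟩⟩
      refine WP.forUp I.n 10 (fun k s => s.nv .q = k ∧ Keeps [.q] [] [] [] s₂ s) ?_ ?_ ?_ ?_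
      · exact ⟨by simp, (Keeps.refl _).setN (by simp) _⟩
      · rintro k s ⟨hq, hK'⟩
        exact ⟨hq, by simp [hK'.nv .numJobs (by simp), hK₃.nv .numJobs (by simp), hS.numJobs]⟩
      · rintro k s hk ⟨hq, hK'⟩
        rw [wp_cond, wp_skip]
        simp only [BExp.holds, NExp.eval, hq, hK'.nv .i (by simp), hi₂, hK'.na .csf (by simp),
          hK₃.na .csf (by simp), hcsf k hk]
        exact ⟨fun h => by omega, fun _ => ⟨⟨by simp, hK'.setN (by simp) _⟩, by simp⟩⟩
      · rintro s t ⟨-, hK'⟩ ht'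
        refine ⟨hK', ?_⟩
        simp only [NExp.ops, BExp.ops] at ht' ⊢
        omega
    rw [wp_seq]
    refine hcheck.imp ?_
    rintro s₃ t₃ ⟨hK₄, ht₃⟩
    rw [wp_nset]
    have hi₃ : s₃.nv .i = i := by rw [hK₄.nv .i (by simp), hi₂]
    refine ⟨i - 1, by omega, by simp [hi₃],
      (hK₃.trans (hK₄.mono (by simp) (by simp) (by simp) (by simp))).setN (by simp) _, ?_, ?_, ?_⟩
    · rw [State.setN_na, hK₄.na .pos (by simp), hK₄.na .size (by simp), hK₄.na .slot (by simp)]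
      exact hF₂.next hb.1 hin hd
    · rw [State.setN_na, hK₄.na .size (by simp)]
      exact hF₂.zero _ (by omega)
    · rw [show I.n - (i - 1) = I.n - i + 1 by omega, Nat.mul_add]
      simp only [BExp.ops, NExp.ops]
      have : B = 2 * (100 * (I.n + 1) * (I.n + 1)) := by rw [hB]; ring
      have : 100 * (I.n + 1) * (I.n + 1) = 100 * ((I.n + 1) * (I.n + 1)) := by ring
      omega
  · rintro s t ⟨i, hin, hi, hK, hF, hsi, ht⟩ hb
    simp only [BExp.holds, NExp.eval, hi, hK.nv .fail (by simp), hf, and_true] at hb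
    obtain rfl : i = 0 := by omega
    refine ⟨hK, hF.layout I.one_le_b, hF.greedy I.one_le_b, ?_⟩
    simp only [BExp.ops, NExp.ops] at ht₀ ⊢
    rw [Nat.sub_zero] at ht
    have h2 : 400 * (I.n + 1) * (I.n + 1) * (I.n + 1) = B * I.n + B + B * (I.n + 1) := by
      rw [hB]; ring
    have h3 : I.n + 1 ≤ B * (I.n + 1) := Nat.le_mul_of_pos_left _ (by rw [hB]; positivity)
    have h4 : B = 200 * ((I.n + 1) * (I.n + 1)) := by rw [hB]; ring
    omega

end

/-! ### Evaluating and storing a schedule -/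

/-- One step of computing a maximum. -/
theorem isGreatest_image_Iio_succ {T : ℕ → ℝ} {k : ℕ} {m m' : ℝ}
    (h : 0 < k → IsGreatest (T '' Set.Iio k) m) (h1 : k = 0 ∨ m < T k → m' = T k)
    (h2 : ¬ (k = 0 ∨ m < T k) → m' = m) : IsGreatest (T '' Set.Iio (k + 1)) m' := by
  by_cases hk : k = 0 ∨ m < T k
  · rw [h1 hk]
    refine ⟨⟨k, by simp, rfl⟩, ?_⟩
    rintro _ ⟨q, hq, rfl⟩
    obtain rfl | hlt : q = k ∨ q < k := by
      simp only [Set.mem_Iio] at hq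
      omega
    · exact le_rfl
    · have h3 : m < T k := hk.resolve_left (by omega)
      exact ((h (by omega)).2 ⟨q, hlt, rfl⟩).trans h3.le
  · rw [h2 hk]
    push Not at hk
    obtain ⟨⟨x, hx, hxm⟩, hmax⟩ := h (by omega)
    simp only [Set.mem_Iio] at hx
    refine ⟨⟨x, by simp only [Set.mem_Iio]; omega, hxm⟩, ?_⟩
    rintro _ ⟨q, hq, rfl⟩
    obtain rfl | hlt : q = k ∨ q < k := by
      simp only [Set.mem_Iio] at hq
      omega
    · exact hk.2
    · exact hmax ⟨q, hlt, rfl⟩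

section
variable {I : Instance} {st : State}

/-- The program computes the largest completion time and the largest cost. -/
theorem wp_evalSched (hS : Static I st) :
    WP I.costs evalSched st fun s t => Keeps [.q] [] [.cmax, .fmax] [] st s ∧
      IsGreatest ((fun q => st.ra .C 0 (st.na .pos 0 q)) '' Set.Iio I.n) (s.rv .cmax) ∧
      IsGreatest ((fun q => I.costs q (st.ra .C 0 (st.na .pos 0 q))) '' Set.Iio I.n)
        (s.rv .fmax) ∧ t ≤ 100 * (I.n + 1) := by
  unfold evalSched
  refine WP.forUp I.n 60 (fun k s => s.nv .q = k ∧ Keeps [.q] [] [.cmax, .fmax] [] st s ∧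
    (0 < k → IsGreatest ((fun q => st.ra .C 0 (st.na .pos 0 q)) '' Set.Iio k) (s.rv .cmax)) ∧
    (0 < k → IsGreatest ((fun q => I.costs q (st.ra .C 0 (st.na .pos 0 q))) '' Set.Iio k)
        (s.rv .fmax))) ?_ ?_ ?_ ?_
  · exact ⟨by simp, (Keeps.refl _).setN (by simp) _, by simp, by simp⟩
  · rintro k s ⟨hq, hK, -, -⟩
    exact ⟨hq, by simp [hK.nv .numJobs (by simp), hS.numJobs]⟩
  · rintro k s hk ⟨hq, hK, hC, hF⟩
    rw [wp_seq]
    have h1 : WP I.costs (when (.or (.neq (.var .q) 0)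
          (.rlt (.var .cmax) (.read .C 0 (.read .pos 0 (.var .q)))))
        (.rset .cmax (.read .C 0 (.read .pos 0 (.var .q))))) s fun s' t' =>
        s'.nv .q = k ∧ Keeps [.q] [] [.cmax, .fmax] [] st s' ∧ s'.rv .fmax = s.rv .fmax ∧
        IsGreatest ((fun q => st.ra .C 0 (st.na .pos 0 q)) '' Set.Iio (k + 1)) (s'.rv .cmax) ∧
        t' ≤ 25 := by
      rw [wp_cond, wp_rset, wp_skip]
      simp only [BExp.holds, NExp.eval, RExp.eval, hq, hK.na .pos (by simp), hK.ra .C (by simp)]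
      refine ⟨fun h => ⟨by simp [hq], hK.setR (by simp) _, by simp, ?_, by simp⟩,
        fun h => ⟨trivial, hK, trivial, ?_, by simp⟩⟩
      · exact isGreatest_image_Iio_succ hC (by simp) fun h' => absurd h h'
      · exact isGreatest_image_Iio_succ hC (fun h' => absurd h' h) fun _ => rfl
    refine h1.imp ?_
    rintro s₁ t₁ ⟨hq₁, hK₁, hf₁, hC₁, ht₁⟩
    rw [wp_cond, wp_rset, wp_skip]
    rw [← hf₁] at hF
    simp only [BExp.holds, NExp.eval, RExp.eval, hq₁, hK₁.na .pos (by simp),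
      hK₁.ra .C (by simp)]
    refine ⟨fun h => ⟨⟨by simp [hq₁], (hK₁.setR (by simp) _).setN (by simp) _, fun _ => by
        simpa using hC₁, fun _ => ?_⟩, by simp; omega⟩,
      fun h => ⟨⟨by simp, hK₁.setN (by simp) _, fun _ => by simpa using hC₁,
        fun _ => ?_⟩, by simp; omega⟩⟩
    · exact isGreatest_image_Iio_succ hF (by simp) fun h' => absurd h h'
    · exact isGreatest_image_Iio_succ hF (fun h' => absurd h' h) fun _ => rfl
  · rintro s t ⟨-, hK, hC, hF⟩ ht
    refine ⟨hK, hC I.n_pos, hF I.n_pos, ?_⟩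
    simp only [NExp.ops] at ht
    omega

/-- Copying the first `N` entries of row `0` of `src` into row `R` of `dst`. -/
theorem wp_copyN {f : ℕ → ℝ → ℝ} {dst src : NArr} (hne : src ≠ dst) {row bound : NExp} {R N : ℕ}
    (he : ∀ s, Keeps [.q] [dst] [] [] st s → row.eval s = R ∧ bound.eval s = N) :
    WP f (forUp .q bound (.nput dst row (.var .q) (.read src 0 (.var .q)))) st fun s t =>
      Keeps [.q] [dst] [] [] st s ∧ (∀ q < N, s.na dst R q = st.na src 0 q) ∧
      (∀ i ≠ R, s.na dst i = st.na dst i) ∧ t ≤ (N + 1) * (bound.ops + (row.ops + 5) + 7) := by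
  refine WP.forUp N (row.ops + 5) (fun k s => s.nv .q = k ∧ Keeps [.q] [dst] [] [] st s ∧
    (∀ q < k, s.na dst R q = st.na src 0 q) ∧ (∀ i ≠ R, s.na dst i = st.na dst i)) ?_ ?_ ?_ ?_
  · exact ⟨by simp, (Keeps.refl _).setN (by simp) _, by simp, by simp⟩
  · rintro k s ⟨hq, hK, -, -⟩
    exact ⟨hq, (he s hK).2⟩
  · rintro k s hk ⟨hq, hK, h1, h2⟩
    rw [wp_nput]
    refine ⟨⟨by simp [hq], (hK.putN (by simp) _ _ _).setN (by simp) _, ?_, ?_⟩, by simp⟩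
    · intro q hqk
      simp only [State.setN_na, State.putN_na, NExp.eval, (he s hK).1, hq, true_and,
        hK.na src (by simpa using hne)]
      split_ifs with h
      · rw [h]
      · exact h1 q (by omega)
    · intro i hi
      funext j
      simp only [State.setN_na, State.putN_na, NExp.eval, (he s hK).1, hi, false_and, and_false,
        if_false, h2 i hi]
  · rintro s t ⟨-, hK, h1, h2⟩ ht
    exact ⟨hK, h1, h2, ht⟩

/-- Copying the first `N` entries of row `0` of `src` into row `R` of `dst`. -/
theorem wp_copyR {f : ℕ → ℝ → ℝ} {dst src : RArr} (hne : src ≠ dst) {row bound : NExp} {R N : ℕ}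
    (he : ∀ s, Keeps [.q] [] [] [dst] st s → row.eval s = R ∧ bound.eval s = N) :
    WP f (forUp .q bound (.rput dst row (.var .q) (.read src 0 (.var .q)))) st fun s t =>
      Keeps [.q] [] [] [dst] st s ∧ (∀ q < N, s.ra dst R q = st.ra src 0 q) ∧
      (∀ i ≠ R, s.ra dst i = st.ra dst i) ∧ t ≤ (N + 1) * (bound.ops + (row.ops + 5) + 7) := by
  refine WP.forUp N (row.ops + 5) (fun k s => s.nv .q = k ∧ Keeps [.q] [] [] [dst] st s ∧
    (∀ q < k, s.ra dst R q = st.ra src 0 q) ∧ (∀ i ≠ R, s.ra dst i = st.ra dst i)) ?_ ?_ ?_ ?_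
  · exact ⟨by simp, (Keeps.refl _).setN (by simp) _, by simp, by simp⟩
  · rintro k s ⟨hq, hK, -, -⟩
    exact ⟨hq, (he s hK).2⟩
  · rintro k s hk ⟨hq, hK, h1, h2⟩
    rw [wp_rput]
    refine ⟨⟨by simp [hq], (hK.putR (by simp) _ _ _).setN (by simp) _, ?_, ?_⟩, by simp⟩
    · intro q hqk
      simp only [State.setN_ra, State.putR_ra, NExp.eval, RExp.eval, (he s hK).1, hq, true_and,
        hK.ra src (by simpa using hne)]
      split_ifs with h
      · rw [h]
      · exact h1 q (by omega)
    · intro i hi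
      funext j
      simp only [State.setN_ra, State.putR_ra, NExp.eval, (he s hK).1, hi, false_and, and_false,
        if_false, h2 i hi]
  · rintro s t ⟨-, hK, h1, h2⟩ ht
    exact ⟨hK, h1, h2, ht⟩

/-- The current schedule is stored as the best one, and its cost becomes the bound. -/
theorem wp_keep (hS : Static I st) :
    WP I.costs keep st fun s t =>
      Keeps [.q, .yFin, .u] [.bestPos] [.prevC, .prevF, .y] [.bestS] st s ∧
      s.nv .yFin = 1 ∧ s.nv .u = st.nv .u + 1 ∧
      s.rv .prevC = st.rv .cmax ∧ s.rv .prevF = st.rv .fmax ∧ s.rv .y = st.rv .fmax ∧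
      (∀ q < I.n, s.na .bestPos 0 q = st.na .pos 0 q) ∧
      (∀ q ≤ I.n, s.ra .bestS 0 q = st.ra .S 0 q) ∧ t ≤ 100 * (I.n + 1) := by
  unfold keep
  rw [wp_seq]
  refine (wp_copyN (R := 0) (N := I.n) (by simp) fun s hK =>
    ⟨by simp, by simp [hK.nv .numJobs (by simp), hS.numJobs]⟩).imp ?_
  rintro s t ⟨hK, hpos, -, ht⟩
  rw [wp_seq]
  refine (wp_copyR (R := 0) (N := I.n + 1) (by simp) fun s' hK' =>
    ⟨by simp, by
      simp [hK'.nv .numJobs (by simp), hK.nv .numJobs (by simp), hS.numJobs]⟩).imp ?_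
  rintro s' t' ⟨hK', hS', -, ht'⟩
  have hKK : Keeps [.q, .yFin, .u] [.bestPos] [.prevC, .prevF, .y] [.bestS] st s' :=
    (hK.mono (by simp) (by simp) (by simp) (by simp)).trans
      (hK'.mono (by simp) (by simp) (by simp) (by simp))
  have e1 : s'.rv .cmax = st.rv .cmax := hKK.rv _ (by simp)
  have e2 : s'.rv .fmax = st.rv .fmax := hKK.rv _ (by simp)
  have e3 : s'.nv .u = st.nv .u := by rw [hK'.nv .u (by simp), hK.nv .u (by simp)]
  rw [wp_seq, wp_rset, wp_seq, wp_rset, wp_seq, wp_rset, wp_seq, wp_nset, wp_nset]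
  refine ⟨((((hKK.setR (by simp) _).setR (by simp) _).setR (by simp) _).setN (by simp) _).setN
    (by simp) _, by simp, by simp [e3], by simp [e1], by simp [e2], by simp [e2], ?_, ?_, ?_⟩
  · intro q hq
    simpa [hK'.na .bestPos (by simp)] using hpos q hq
  · intro q hq
    simpa [hK.ra .S (by simp)] using hS' q (by omega)
  · simp only [NExp.ops, RExp.ops] at ht ht' ⊢
    omega

/-- The stored schedule and its objective values are appended to the list of recorded triples. -/
theorem wp_record (hS : Static I st) :
    WP I.costs record st fun s t =>
      Keeps [.q, .k] [.omPos] [] [.omC, .omF, .omS] st s ∧ s.nv .k = st.nv .k + 1 ∧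
      s.omegaPoint (st.nv .k + 1) = (st.rv .prevC, st.rv .prevF) ∧
      (∀ q < I.n, s.na .omPos (st.nv .k + 1) q = st.na .bestPos 0 q) ∧
      (∀ q ≤ I.n, s.ra .omS (st.nv .k + 1) q = st.ra .bestS 0 q) ∧
      (∀ k ≠ st.nv .k + 1, s.omegaPoint k = st.omegaPoint k ∧
        s.omegaSched I.n k = st.omegaSched I.n k) ∧ t ≤ 100 * (I.n + 1) := by
  unfold record
  rw [wp_seq, wp_nset, wp_seq, wp_rput, wp_seq, wp_rput, wp_seq]
  simp only [NExp.eval, RExp.eval]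
  set s₀ := ((st.setN .k (st.nv .k + 1)).putR .omC 0
    ((st.setN .k (st.nv .k + 1)).nv .k) ((st.setN .k (st.nv .k + 1)).rv .prevC)).putR .omF 0
    (((st.setN .k (st.nv .k + 1)).putR .omC 0
    ((st.setN .k (st.nv .k + 1)).nv .k) ((st.setN .k (st.nv .k + 1)).rv .prevC)).nv .k)
    (((st.setN .k (st.nv .k + 1)).putR .omC 0
    ((st.setN .k (st.nv .k + 1)).nv .k) ((st.setN .k (st.nv .k + 1)).rv .prevC)).rv .prevF)
    with hs₀
  have hK₀ : Keeps [.q, .k] [.omPos] [] [.omC, .omF, .omS] st s₀ :=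
    (((Keeps.refl st).setN (by simp) _).putR (by simp) _ _ _).putR (by simp) _ _ _
  have hk₀ : s₀.nv .k = st.nv .k + 1 := by simp [hs₀]
  have hp₀ : ∀ k, s₀.omegaPoint k =
      if k = st.nv .k + 1 then (st.rv .prevC, st.rv .prevF) else st.omegaPoint k := by
    intro k
    unfold State.omegaPoint
    split_ifs with h <;> simp [hs₀, h]
  have hom : s₀.na .omPos = st.na .omPos ∧ s₀.ra .omS = st.ra .omS := by
    constructor <;> funext i j <;> simp [hs₀]
  clear_value s₀
  refine (wp_copyN (R := st.nv .k + 1) (N := I.n) (by simp) fun s hK =>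
    ⟨by simp [hK.nv .k (by simp), hk₀],
      by simp [hK.nv .numJobs (by simp), hK₀.nv .numJobs (by simp), hS.numJobs]⟩).imp ?_
  rintro s t ⟨hK, hpos, hpos', ht⟩
  refine (wp_copyR (R := st.nv .k + 1) (N := I.n + 1) (by simp) fun s' hK' =>
    ⟨by simp [hK'.nv .k (by simp), hK.nv .k (by simp), hk₀], by
      simp [hK'.nv .numJobs (by simp), hK.nv .numJobs (by simp), hK₀.nv .numJobs (by simp),
        hS.numJobs]⟩).imp ?_
  rintro s' t' ⟨hK', hS', hS'', ht'⟩
  have hKK : Keeps [.q, .k] [.omPos] [] [.omC, .omF, .omS] st s' :=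
    (hK₀.trans (hK.mono (by simp) (by simp) (by simp) (by simp))).trans
      (hK'.mono (by simp) (by simp) (by simp) (by simp))
  have hpt : ∀ k, s'.omegaPoint k = s₀.omegaPoint k := by
    intro k
    unfold State.omegaPoint
    rw [hK'.ra .omC (by simp), hK'.ra .omF (by simp), hK.ra .omC (by simp),
      hK.ra .omF (by simp)]
  refine ⟨hKK, by rw [hK'.nv .k (by simp), hK.nv .k (by simp), hk₀], ?_, ?_, ?_, ?_, ?_⟩
  · rw [hpt, hp₀, if_pos rfl]
  · intro q hq
    rw [hK'.na .omPos (by simp), hpos q hq, hK₀.na .bestPos (by simp)]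
  · intro q hq
    rw [hS' q (by omega), hK.ra .bestS (by simp), hK₀.ra .bestS (by simp)]
  · intro k hk
    rw [hpt, hp₀, if_neg hk]
    refine ⟨rfl, ?_⟩
    unfold State.omegaSched
    rw [hK'.na .omPos (by simp), hpos' k hk, hS'' k hk, hK.ra .omS (by simp), hom.1, hom.2]
  · simp only [NExp.ops, RExp.ops] at ht ht' ⊢
    omega

end

/-! ### Schedules and assignments of jobs to batches -/

/-- The batch numbers of a schedule, indexed by natural numbers. -/
def Schedule.assign {n : ℕ} (σ : Schedule n) (j : ℕ) : ℕ :=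
  if h : j < n then σ.batch ⟨j, h⟩ else 0

section
variable {I : Instance} {σ τ : Schedule I.n}

theorem Schedule.assign_coe {n : ℕ} (σ : Schedule n) (j : Fin n) : σ.assign j = σ.batch j := by
  simp [assign]

theorem Instance.procTime_coe (j : Fin I.n) : I.procTime j = I.p j := by
  simp [procTime]

theorem Instance.costs_coe (j : Fin I.n) (t : ℝ) : I.costs j t = I.f j t := by
  simp [costs]

theorem Schedule.ptime_eq (k : ℕ) :
    σ.ptime I k = ∑ x ∈ batchOf I.n σ.assign k, I.procTime x := by
  rw [ptime, jobs, batchOf, sum_filter, sum_filter,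
    ← Fin.sum_univ_eq_sum_range (fun x => if σ.assign x = k then I.procTime x else 0)]
  simp only [assign_coe, Instance.procTime_coe]

theorem Schedule.card_jobs_eq (k : ℕ) : #(σ.jobs k) = #(batchOf I.n σ.assign k) := by
  rw [jobs, batchOf, card_filter, card_filter,
    ← Fin.sum_univ_eq_sum_range (fun x => if σ.assign x = k then 1 else 0)]
  simp only [assign_coe]

theorem Schedule.jobs_nonempty_iff (k : ℕ) :
    (σ.jobs k).Nonempty ↔ (batchOf I.n σ.assign k).Nonempty := by
  rw [← card_pos, ← card_pos, card_jobs_eq]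

theorem Schedule.compl_le_Cmax (j : Fin I.n) : σ.compl I j ≤ σ.Cmax I :=
  le_ciSup (Set.finite_range _).bddAbove j

theorem Schedule.cost_le_fmax (j : Fin I.n) : I.f j (σ.compl I j) ≤ σ.fmax I :=
  le_ciSup (f := fun j => I.f j (σ.compl I j)) (Set.finite_range _).bddAbove j

theorem iSup_fin_eq_of_isGreatest {n : ℕ} {T : ℕ → ℝ} {m : ℝ}
    (h : IsGreatest (T '' Set.Iio n) m) : ⨆ j : Fin n, T j = m := by
  have hr : Set.range (fun j : Fin n => T j) = T '' Set.Iio n := by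
    ext x
    constructor
    · rintro ⟨j, rfl⟩
      exact ⟨j, j.2, rfl⟩
    · rintro ⟨q, hq, rfl⟩
      exact ⟨⟨q, hq⟩, rfl⟩
  rw [iSup, hr]
  exact h.csSup_eq

/-- The completion times of a feasible schedule, whose nonempty batches are `g + 1, …, n`, are at
least those without idle time. -/
theorem Schedule.Feasible.exists_assign (h : σ.Feasible I) :
    ∃ g, Assign I.n I.b σ.assign g ∧
      (∀ j : Fin I.n, slotTime I.n I.s I.procTime σ.assign g (σ.batch j) ≤ σ.compl I j) ∧
      slotTime I.n I.s I.procTime σ.assign g I.n ≤ σ.Cmax I := by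
  have : Nonempty (Fin I.n) := ⟨⟨0, I.n_pos⟩⟩
  obtain ⟨j₀, -, hmin⟩ := exists_min_image (univ : Finset (Fin I.n)) σ.batch univ_nonempty
  have hj₀ := h.batch_mem j₀
  obtain ⟨g, hg⟩ : ∃ g, σ.batch j₀ = g + 1 := ⟨σ.batch j₀ - 1, by omega⟩
  have hlt : ∀ j < I.n, g < σ.assign j := by
    intro j hj
    have := hmin ⟨j, hj⟩ (mem_univ _)
    rw [← σ.assign_coe ⟨j, hj⟩] at this
    change _ ≤ σ.assign j at this
    omega
  have hne : ∀ k, g < k → k ≤ I.n → (σ.jobs k).Nonempty := fun k h1 h2 =>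
    h.last_nonempty (g + 1) k h1 h2 ⟨j₀, by simp [jobs, hg]⟩
  have key : ∀ k, g < k → k ≤ I.n →
      slotTime I.n I.s I.procTime σ.assign g k ≤ σ.start k + σ.ptime I k := by
    intro k hgk
    induction k, hgk using Nat.le_induction with
    | base =>
      intro hk
      have h0 : ({x ∈ range I.n | σ.assign x ≤ g} : Finset ℕ) = ∅ := by
        rw [filter_eq_empty_iff]
        intro x hx h'
        have := hlt x (by simpa using hx)
        omega
      have := h.setup_first (g + 1) (hne _ (by omega) hk)
      rw [slotTime, Schedule.ptime_eq, Nat.succ_eq_add_one, sum_le_succ, h0,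
        show g + 1 - g = 1 by omega]
      simp only [Nat.cast_one, mul_one, sum_empty, zero_add]
      linarith
    | succ k hgk ih =>
      intro hk
      have h1 := ih (by omega)
      have h2 := h.setup_between k (k + 1) (by omega) (hne k (by omega) (by omega))
        (hne _ (by omega) hk)
      rw [slotTime] at h1 ⊢
      rw [sum_le_succ, ← Schedule.ptime_eq (σ := σ) (k + 1), show k + 1 - g = (k - g) + 1 by omega]
      push_cast
      linarith
  refine ⟨g, ⟨hlt, fun j hj => ?_, fun k => ?_⟩, fun j => ?_, ?_⟩
  · rw [show σ.assign j = σ.batch ⟨j, hj⟩ from σ.assign_coe ⟨j, hj⟩]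
    exact (h.batch_mem _).2
  · rw [← σ.card_jobs_eq]
    exact h.capacity k
  · have := hlt j j.2
    rw [σ.assign_coe] at this
    exact key _ this (h.batch_mem j).2
  · have hgn : g < I.n := by omega
    obtain ⟨j, hj⟩ := hne I.n hgn le_rfl
    have hj : σ.batch j = I.n := by simpa [jobs] using hj
    refine (key _ hgn le_rfl).trans ?_
    have := σ.compl_le_Cmax j
    rwa [compl, hj] at this

/-- A schedule with maximum cost below `y` gives a good assignment with no larger makespan. -/
theorem Schedule.Feasible.exists_good (h : σ.Feasible I) {y : WithTop ℝ}
    (hy : ((σ.fmax I : ℝ) : WithTop ℝ) < y) :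
    ∃ a g, I.Good y a g ∧ slotTime I.n I.s I.procTime a g I.n ≤ σ.Cmax I := by
  obtain ⟨g, ha, hc, hC⟩ := h.exists_assign
  refine ⟨σ.assign, g, ⟨ha, fun j hj => lt_of_le_of_lt (WithTop.coe_le_coe.mpr ?_) hy⟩, hC⟩
  have h1 := hc ⟨j, hj⟩
  have h2 := σ.cost_le_fmax ⟨j, hj⟩
  rw [← I.costs_coe ⟨j, hj⟩] at h2
  rw [← σ.assign_coe ⟨j, hj⟩] at h1
  exact (I.costs_mono j (slotTime_nonneg I.s_nonneg I.procTime_nonneg _) h1).trans h2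

/-- The schedule without idle time for the assignment `pos` is feasible, and the jobs complete at
the times `finish`. -/
theorem Schedule.feasible_of_noIdle {pos sz : ℕ → ℕ} (ha : Assign I.n I.b pos 0)
    (hc : Counts I.n sz pos) (hcon : Contiguous I.n sz) (hb : ∀ j : Fin I.n, σ.batch j = pos j)
    (hs : ∀ k, 1 ≤ k → k ≤ I.n → (batchOf I.n pos k).Nonempty →
      σ.start k = finish I.n I.s I.procTime pos (k - 1) + I.s) :
    σ.Feasible I ∧ ∀ j, σ.compl I j = finish I.n I.s I.procTime pos (pos j) := by
  have hmem : ∀ j : Fin I.n, 1 ≤ σ.batch j ∧ σ.batch j ≤ I.n := fun j => by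
    rw [hb]
    exact ⟨ha.lt j j.2, ha.le j j.2⟩
  have hbatch : ∀ k, batchOf I.n σ.assign k = batchOf I.n pos k := by
    intro k
    ext x
    rw [mem_batchOf, mem_batchOf]
    refine and_congr_right fun hx => ?_
    rw [show σ.assign x = σ.batch ⟨x, hx⟩ from σ.assign_coe ⟨x, hx⟩, hb]
  have hne : ∀ k, (σ.jobs k).Nonempty →
      1 ≤ k ∧ k ≤ I.n ∧ (batchOf I.n pos k).Nonempty := by
    rintro k hk
    have hk' := hk
    rw [σ.jobs_nonempty_iff, hbatch] at hk'
    obtain ⟨j, hj⟩ := hk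
    have hj : σ.batch j = k := by simpa [jobs] using hj
    exact ⟨hj ▸ (hmem j).1, hj ▸ (hmem j).2, hk'⟩
  have hfin : ∀ k, (σ.jobs k).Nonempty →
      σ.start k + σ.ptime I k = finish I.n I.s I.procTime pos k := by
    intro k hk
    obtain ⟨h1, h2, h3⟩ := hne k hk
    obtain ⟨m, rfl⟩ : ∃ m, k = m + 1 := ⟨k - 1, by omega⟩
    rw [hs _ h1 h2 h3, σ.ptime_eq, hbatch, finish, if_pos h3, Nat.add_sub_cancel]
  have hmono := finish_mono (n := I.n) (a := pos) I.s_nonneg I.procTime_nonneg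
  refine ⟨⟨hmem, ?_, ?_, ?_, ?_⟩, fun j => ?_⟩
  · intro i k hik hk hi
    obtain ⟨h1, h2, h3⟩ := hne i hi
    rw [σ.jobs_nonempty_iff, hbatch, ← card_pos, ← hc k (by omega) hk]
    rw [← card_pos, ← hc i h1 h2] at h3
    exact hcon i k h1 hik hk h3
  · intro k
    rw [σ.card_jobs_eq, hbatch]
    exact ha.cap k
  · intro i hi
    obtain ⟨h1, h2, h3⟩ := hne i hi
    rw [hs i h1 h2 h3]
    have := finish_nonneg (n := I.n) (a := pos) I.s_nonneg I.procTime_nonneg (i - 1)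
    linarith
  · intro i k hik hi hk
    obtain ⟨h1, h2, h3⟩ := hne k hk
    rw [hfin i hi, hs k h1 h2 h3]
    have := hmono (show i ≤ k - 1 by omega)
    linarith
  · rw [compl, hfin _ ⟨j, by simp [jobs]⟩, hb]

/-- The start times of batches with numbers beyond `n` are irrelevant. -/
theorem Schedule.Feasible.congr (h : σ.Feasible I) (hb : ∀ j, τ.batch j = σ.batch j)
    (hs : ∀ k ≤ I.n, τ.start k = σ.start k) :
    τ.Feasible I ∧ τ.Cmax I = σ.Cmax I ∧ τ.fmax I = σ.fmax I := by
  obtain ⟨b, s⟩ := τ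
  obtain rfl : b = σ.batch := funext hb
  have hle : ∀ k, (σ.jobs k).Nonempty → s k = σ.start k := by
    rintro k ⟨j, hj⟩
    have hj : σ.batch j = k := by simpa [jobs] using hj
    exact hs k (hj ▸ (h.batch_mem j).2)
  have hcompl : ∀ j, Schedule.compl I ⟨σ.batch, s⟩ j = σ.compl I j := fun j => by
    change s (σ.batch j) + _ = σ.start (σ.batch j) + _
    rw [hle _ ⟨j, by simp [jobs]⟩]
    rfl
  refine ⟨⟨h.batch_mem, h.last_nonempty, h.capacity, fun i hi => ?_, fun i k hik hi hk => ?_⟩,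
    ?_, ?_⟩
  · exact (h.setup_first i hi).trans (hle i hi).ge
  · have := h.setup_between i k hik hi hk
    rw [← hle i hi, ← hle k hk] at this
    exact this
  · simp only [Cmax, hcompl]
  · simp only [fmax, hcompl]

/-- Pareto optimality does not depend on the start times of batches with numbers beyond `n`. -/
theorem Schedule.ParetoOptimal.congr (h : σ.ParetoOptimal I) (hb : ∀ j, τ.batch j = σ.batch j)
    (hs : ∀ k ≤ I.n, τ.start k = σ.start k) : τ.ParetoOptimal I := by
  obtain ⟨h1, h2, h3⟩ := h.1.congr hb hs
  refine ⟨h1, ?_⟩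
  rw [h2, h3]
  exact h.2

end

/-! ### Collecting the Pareto optimal points -/

/-- The triples with numbers `1, …, K` are those of the Pareto optimal points with maximum cost
greater than `v`, each exactly once. -/
structure Archive (I : Instance) (K : ℕ) (pt : ℕ → ℝ × ℝ) (sc : ℕ → Schedule I.n) (v : ℝ) :
    Prop where
  sound : ∀ k, 1 ≤ k → k ≤ K → (sc k).ParetoOptimal I ∧
    pt k = ((sc k).Cmax I, (sc k).fmax I) ∧ v < (sc k).fmax I
  complete : ∀ τ : Schedule I.n, τ.ParetoOptimal I → v < τ.fmax I →
    ∃ k, 1 ≤ k ∧ k ≤ K ∧ pt k = (τ.Cmax I, τ.fmax I)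
  inj : ∀ k k', 1 ≤ k → k ≤ K → 1 ≤ k' → k' ≤ K → pt k = pt k' → k = k'

section
variable {I : Instance} {K : ℕ} {pt pt' : ℕ → ℝ × ℝ} {sc sc' : ℕ → Schedule I.n} {v v' : ℝ}
  {σ : Schedule I.n}

/-- The threshold may be lowered if no Pareto optimal point lies in between. -/
theorem Archive.skip (h : Archive I K pt sc v) (hv : v' ≤ v)
    (hno : ∀ τ : Schedule I.n, τ.ParetoOptimal I → v' < τ.fmax I → v < τ.fmax I) :
    Archive I K pt sc v' where
  sound k h1 h2 := by
    obtain ⟨h3, h4, h5⟩ := h.sound k h1 h2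
    exact ⟨h3, h4, hv.trans_lt h5⟩
  complete τ hτ hlt := h.complete τ hτ (hno τ hτ hlt)
  inj := h.inj

/-- Recording a Pareto optimal schedule `σ` whose maximum cost is the threshold. -/
theorem Archive.record (h : Archive I K pt sc (σ.fmax I)) (hσ : σ.ParetoOptimal I)
    (hv : v' < σ.fmax I)
    (hno : ∀ τ : Schedule I.n, τ.ParetoOptimal I → v' < τ.fmax I → τ.fmax I ≤ σ.fmax I →
      τ.Cmax I = σ.Cmax I ∧ τ.fmax I = σ.fmax I)
    (hold : ∀ k ≠ K + 1, pt' k = pt k ∧ sc' k = sc k)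
    (hb : ∀ j, (sc' (K + 1)).batch j = σ.batch j)
    (hs : ∀ k ≤ I.n, (sc' (K + 1)).start k = σ.start k)
    (hpt : pt' (K + 1) = (σ.Cmax I, σ.fmax I)) : Archive I (K + 1) pt' sc' v' := by
  have hold1 : ∀ k ≤ K, pt' k = pt k := fun k hk => (hold k (by omega)).1
  have hold2 : ∀ k ≤ K, sc' k = sc k := fun k hk => (hold k (by omega)).2
  have hne : ∀ k, 1 ≤ k → k ≤ K → pt k ≠ (σ.Cmax I, σ.fmax I) := by
    intro k h1 h2 he
    obtain ⟨-, h4, h5⟩ := h.sound k h1 h2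
    rw [h4, Prod.mk.injEq] at he
    exact h5.ne' he.2
  refine ⟨fun k h1 h2 => ?_, fun τ hτ hlt => ?_, fun k k' h1 h2 h3 h4 he => ?_⟩
  · obtain hk | rfl : k ≤ K ∨ k = K + 1 := by omega
    · rw [hold1 k hk, hold2 k hk]
      obtain ⟨h3, h4, h5⟩ := h.sound k h1 hk
      exact ⟨h3, h4, hv.trans h5⟩
    · obtain ⟨-, h4, h5⟩ := hσ.1.congr hb hs
      rw [h4, h5]
      exact ⟨hσ.congr hb hs, hpt, hv⟩
  · by_cases hc : σ.fmax I < τ.fmax I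
    · obtain ⟨k, h1, h2, h3⟩ := h.complete τ hτ hc
      exact ⟨k, h1, by omega, by rw [hold1 k h2, h3]⟩
    · obtain ⟨h1, h2⟩ := hno τ hτ hlt (not_lt.mp hc)
      exact ⟨K + 1, by omega, le_rfl, by rw [hpt, h1, h2]⟩
  · obtain hk | rfl : k ≤ K ∨ k = K + 1 := by omega
    · obtain hk' | rfl : k' ≤ K ∨ k' = K + 1 := by omega
      · rw [hold1 k hk, hold1 k' hk'] at he
        exact h.inj k k' h1 hk h3 hk' he
      · rw [hold1 k hk, hpt] at he
        exact absurd he (hne k h1 hk)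
    · obtain hk' | rfl : k' ≤ K ∨ k' = K + 1 := by omega
      · rw [hold1 k' hk', hpt] at he
        exact absurd he.symm (hne k' h3 hk')
      · rfl

end

/-! ### One iteration of the main loop -/

section
variable {I : Instance} {σ σ' : Schedule I.n}

/-- A schedule that is at least as good in both objectives has the same objective values. -/
theorem Schedule.ParetoOptimal.not_dominated {τ : Schedule I.n} (h : τ.ParetoOptimal I)
    (hσ : σ.Feasible I) (h1 : σ.Cmax I ≤ τ.Cmax I) (h2 : σ.fmax I ≤ τ.fmax I) :
    τ.Cmax I = σ.Cmax I ∧ τ.fmax I = σ.fmax I := by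
  by_contra hne
  refine h.2 ⟨σ, hσ, h1, h2, ?_⟩
  by_contra hcon
  push Not at hcon
  exact hne ⟨le_antisymm hcon.1 h1, le_antisymm hcon.2 h2⟩

/-- `σ` has minimum makespan among the schedules with cost at most its own, and all cheaper
schedules have larger makespan: then `σ` is Pareto optimal. -/
theorem Schedule.Feasible.paretoOptimal (hσ : σ.Feasible I)
    (hopt : ∀ τ : Schedule I.n, τ.Feasible I → τ.fmax I ≤ σ.fmax I → σ.Cmax I ≤ τ.Cmax I)
    (hlt : ∀ τ : Schedule I.n, τ.Feasible I → τ.fmax I < σ.fmax I → σ.Cmax I < τ.Cmax I) :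
    σ.ParetoOptimal I := by
  refine ⟨hσ, ?_⟩
  rintro ⟨τ, hτ, h1, h2, h3⟩
  have h4 := hopt τ hτ h2
  obtain h3 | h3 := h3
  · exact absurd h3 h4.not_gt
  · exact absurd (hlt τ hτ h3) h1.not_gt

end

/-- The best schedule found so far is in memory, together with its objective values; it has minimum
makespan among the schedules with no larger maximum cost, and all Pareto optimal points with larger
maximum cost have been recorded. -/
structure Stored (I : Instance) (st : State) : Prop where
  feasible : (st.piStar I.n).Feasible I
  cmax_eq : (st.piStar I.n).Cmax I = st.rv .prevC
  fmax_eq : (st.piStar I.n).fmax I = st.rv .prevF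
  opt : ∀ τ : Schedule I.n, τ.Feasible I → τ.fmax I ≤ (st.piStar I.n).fmax I →
    (st.piStar I.n).Cmax I ≤ τ.Cmax I
  archive : Archive I (st.nv .k) st.omegaPoint (st.omegaSched I.n) ((st.piStar I.n).fmax I)

section
variable {I : Instance} {st : State} {D : ℕ → ℕ}

theorem Stored.of_keeps {st' : State} (h : Stored I st)
    (hK : Keeps sweepRegs batchArrs [.cmax, .fmax] [.S, .C] st st') : Stored I st' := by
  have h1 : st'.piStar I.n = st.piStar I.n := by
    unfold State.piStar
    rw [hK.na .bestPos (by simp), hK.ra .bestS (by simp)]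
  have h2 : st'.omegaPoint = st.omegaPoint := by
    funext k
    unfold State.omegaPoint
    rw [hK.ra .omC (by simp), hK.ra .omF (by simp)]
  have h3 : st'.omegaSched I.n = st.omegaSched I.n := by
    funext k
    unfold State.omegaSched
    rw [hK.na .omPos (by simp), hK.ra .omS (by simp)]
  refine ⟨?_, ?_, ?_, ?_, ?_⟩
  · rw [h1]
    exact h.feasible
  · rw [h1, hK.rv .prevC (by simp)]
    exact h.cmax_eq
  · rw [h1, hK.rv .prevF (by simp)]
    exact h.fmax_eq
  · rw [h1]
    exact h.opt
  · rw [h1, h2, h3, hK.nv .k (by simp)]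
    exact h.archive

/-- Recording the stored schedule, when it is known to be Pareto optimal. -/
theorem wp_record_stored (hS : Static I st) (h : Stored I st) {v : ℝ}
    (hσ : (st.piStar I.n).ParetoOptimal I) (hv : v < (st.piStar I.n).fmax I)
    (hno : ∀ τ : Schedule I.n, τ.ParetoOptimal I → v < τ.fmax I →
      τ.fmax I ≤ (st.piStar I.n).fmax I →
      τ.Cmax I = (st.piStar I.n).Cmax I ∧ τ.fmax I = (st.piStar I.n).fmax I) :
    WP I.costs record st fun s t =>
      Keeps [.q, .k] [.omPos] [] [.omC, .omF, .omS] st s ∧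
      Archive I (s.nv .k) s.omegaPoint (s.omegaSched I.n) v ∧ t ≤ 100 * (I.n + 1) := by
  refine (wp_record hS).imp ?_
  rintro s t ⟨hK, hk, hpt, hpos, hst, hold, ht⟩
  refine ⟨hK, ?_, ht⟩
  rw [hk]
  refine h.archive.record hσ hv hno hold (fun j => hpos j j.2) (fun k hk => hst k hk) ?_
  rw [hpt, h.cmax_eq, h.fmax_eq]

/-- The schedule just found, which has minimum makespan among those with costs below the bound,
replaces the stored one. The latter is recorded exactly if it is Pareto optimal. -/
theorem wp_improve (hS : Static I st) (hT : Timed I st)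
    (hc : Current I st.bound (finish I.n I.s I.procTime (st.na .pos 0)) D st)
    (hm : ∀ q < I.n, I.Meets st.bound q (finish I.n I.s I.procTime (st.na .pos 0)
      (st.na .pos 0 q)))
    (h : st.nv .u = 0 ∧ st.nv .k = 0 ∧ st.bound = ⊤ ∨
      0 < st.nv .u ∧ Stored I st ∧ st.bound = (((st.piStar I.n).fmax I : ℝ) : WithTop ℝ)) :
    WP I.costs (evalSched ;;
        when (.and (.nlt 0 (.var .u)) (.rlt (.var .prevC) (.var .cmax))) record ;; keep) st
      fun s t => Keeps [.q, .k, .yFin, .u] [.bestPos, .omPos] [.cmax, .fmax, .prevC, .prevF, .y]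
          [.bestS, .omC, .omF, .omS] st s ∧
        0 < s.nv .u ∧ Stored I s ∧ s.bound = (((s.piStar I.n).fmax I : ℝ) : WithTop ℝ) ∧
        s.bound ≤ st.bound ∧
        (∃ q < I.n, s.bound = ((I.costs q (finish I.n I.s I.procTime (st.na .pos 0)
          (st.na .pos 0 q)) : ℝ) : WithTop ℝ)) ∧
        t ≤ 400 * (I.n + 1) := by
  set pos := st.na .pos 0 with hpos
  have hcnt := hc.layout.counts
  have hA := hc.tent.greedy.assign hcnt
  -- the schedule in memory
  set σ : Schedule I.n := ⟨fun j => pos j, st.ra .S 0⟩ with hσ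
  obtain ⟨hfeas, hcompl⟩ := Schedule.feasible_of_noIdle (σ := σ) hA hcnt hc.tent.contig
    (fun j => rfl) hT.start
  have hopt : ∀ τ : Schedule I.n, τ.Feasible I → ((τ.fmax I : ℝ) : WithTop ℝ) < st.bound →
      σ.Cmax I ≤ τ.Cmax I := by
    intro τ hτ hlt
    obtain ⟨a, g, hg, hC⟩ := hτ.exists_good hlt
    have h1 := hc.tent.greedy.finish_le_of_contiguous hc.tent.contig hcnt hg.1
      (hc.tent.bounds.le_of_good hg) le_rfl
    have : Nonempty (Fin I.n) := ⟨⟨0, I.n_pos⟩⟩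
    refine (ciSup_le fun j => ?_).trans (h1.trans hC)
    rw [hcompl]
    exact finish_mono I.s_nonneg I.procTime_nonneg (hA.le j j.2)
  have hcl : ∀ q < I.n, st.ra .C 0 (pos q) = finish I.n I.s I.procTime pos (pos q) :=
    fun q hq => hT.compl _ (hA.le q hq)
  rw [wp_seq]
  refine (wp_evalSched hS).imp ?_
  rintro s₁ t₁ ⟨hK₁, hC₁, hF₁, ht₁⟩
  have hC₁ : IsGreatest ((fun q => finish I.n I.s I.procTime pos (pos q)) '' Set.Iio I.n)
      (s₁.rv .cmax) := by
    rwa [← Set.image_congr fun q (hq : q ∈ Set.Iio I.n) => hcl q hq]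
  have hF₁ : IsGreatest ((fun q => I.costs q (finish I.n I.s I.procTime pos (pos q))) ''
      Set.Iio I.n) (s₁.rv .fmax) := by
    rwa [← Set.image_congr fun q (hq : q ∈ Set.Iio I.n) =>
      congrArg (I.costs q) (hcl q hq)]
  have hCσ : σ.Cmax I = s₁.rv .cmax := by
    rw [Schedule.Cmax]
    simp only [hcompl]
    exact iSup_fin_eq_of_isGreatest (T := fun q => finish I.n I.s I.procTime pos (pos q)) hC₁
  have hFσ : σ.fmax I = s₁.rv .fmax := by
    rw [Schedule.fmax]
    simp only [hcompl, ← I.costs_coe]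
    exact iSup_fin_eq_of_isGreatest
      (T := fun q => I.costs q (finish I.n I.s I.procTime pos (pos q))) hF₁
  obtain ⟨q₀, hq₀, hq₀F⟩ := hF₁.1
  simp only [Set.mem_Iio] at hq₀ hq₀F
  have hσy : ((σ.fmax I : ℝ) : WithTop ℝ) < st.bound := by
    rw [hFσ, ← hq₀F]
    exact hm q₀ hq₀
  have hS₁ := hS.of_keeps hK₁ (by simp) (by simp) (by simp) (by simp)
  rw [wp_seq]
  have hrec : WP I.costs
      (when (.and (.nlt 0 (.var .u)) (.rlt (.var .prevC) (.var .cmax))) record) s₁ fun s t =>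
      Keeps [.q, .k] [.omPos] [] [.omC, .omF, .omS] s₁ s ∧
      Archive I (s.nv .k) s.omegaPoint (s.omegaSched I.n) (σ.fmax I) ∧
      t ≤ 120 * (I.n + 1) := by
    rw [wp_cond, wp_skip]
    simp only [BExp.holds, BExp.ops, NExp.eval, RExp.eval, NExp.ops, RExp.ops]
    obtain ⟨hu, hk, hy⟩ | ⟨hu, hst, hy⟩ := h
    · refine ⟨fun hb => ?_, fun _ => ⟨Keeps.refl _, ⟨fun k h1 h2 => ?_, fun τ hτ hlt => ?_,
        fun k k' h1 h2 => ?_⟩, by omega⟩⟩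
      · have := hb.1
        rw [hK₁.nv .u (by simp), hu] at this
        exact absurd this (lt_irrefl _)
      · rw [hK₁.nv .k (by simp), hk] at h2
        omega
      · -- the first schedule has minimum makespan, so no Pareto optimal point is more expensive
        have h1 := hopt τ hτ.1 (by rw [hy]; exact WithTop.coe_lt_top _)
        exact absurd (hτ.not_dominated hfeas h1 hlt.le).2 hlt.ne'
      · rw [hK₁.nv .k (by simp), hk] at h2
        omega
    · have hst₁ := hst.of_keeps (hK₁.mono (by simp) (by simp) (by simp) (by simp))
      have hpi : s₁.piStar I.n = st.piStar I.n := by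
        unfold State.piStar
        rw [hK₁.na .bestPos (by simp), hK₁.ra .bestS (by simp)]
      rw [hy, ← hpi, WithTop.coe_lt_coe] at hσy
      have hopt' : ∀ τ : Schedule I.n, τ.Feasible I → τ.fmax I < (s₁.piStar I.n).fmax I →
          σ.Cmax I ≤ τ.Cmax I := fun τ hτ hlt =>
        hopt τ hτ (by rw [hy, ← hpi]; exact WithTop.coe_lt_coe.mpr hlt)
      refine ⟨fun hb => ?_, fun hb => ⟨Keeps.refl _, hst₁.archive.skip hσy.le ?_, by omega⟩⟩
      · have hlt := hb.2
        rw [← hst₁.cmax_eq, ← hCσ] at hlt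
        refine (wp_record_stored hS₁ hst₁ (v := σ.fmax I)
          (hst₁.feasible.paretoOptimal hst₁.opt fun τ hτ h1 => hlt.trans_le (hopt' τ hτ h1)) hσy
          fun τ hτ h1 h2 => hτ.not_dominated hst₁.feasible (hst₁.opt τ hτ.1 h2) ?_).imp ?_
        · by_contra hcon
          have h3 := hopt' τ hτ.1 (not_le.mp hcon)
          exact absurd (hτ.not_dominated hfeas h3 h1.le).2 h1.ne'
        · rintro s t ⟨h1, h2, h3⟩
          exact ⟨h1, h2, by omega⟩
      · -- the new schedule is cheaper and has no larger makespan, so it dominates all between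
        intro τ hτ h1
        by_contra hcon
        push Not at hcon
        rw [hK₁.nv .u (by simp), ← hst₁.cmax_eq, ← hCσ] at hb
        have hle : σ.Cmax I ≤ (s₁.piStar I.n).Cmax I := not_lt.mp fun h' => hb ⟨hu, h'⟩
        have h3 := hle.trans (hst₁.opt τ hτ.1 hcon)
        exact absurd (hτ.not_dominated hfeas h3 h1.le).2 h1.ne'
  refine hrec.imp ?_
  rintro s₂ t₂ ⟨hK₂, harch, ht₂⟩
  refine (wp_keep (hS₁.of_keeps hK₂ (by simp) (by simp) (by simp) (by simp))).imp ?_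
  rintro s₃ t₃ ⟨hK₃, hy₃, hu₃, hpc, hpf, hyr, hbp, hbs, ht₃⟩
  have e1 : s₂.na .pos = st.na .pos := by rw [hK₂.na .pos (by simp), hK₁.na .pos (by simp)]
  have e2 : s₂.ra .S = st.ra .S := by rw [hK₂.ra .S (by simp), hK₁.ra .S (by simp)]
  have e3 : s₂.rv .cmax = σ.Cmax I := by rw [hK₂.rv .cmax (by simp), hCσ]
  have e4 : s₂.rv .fmax = σ.fmax I := by rw [hK₂.rv .fmax (by simp), hFσ]
  obtain ⟨f1, f2, f3⟩ := hfeas.congr (τ := s₃.piStar I.n)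
    (fun j => (hbp j j.2).trans (by rw [e1])) (fun k hk => (hbs k hk).trans (by rw [e2]))
  have hbound : s₃.bound = ((σ.fmax I : ℝ) : WithTop ℝ) := by
    rw [State.bound, hy₃, if_neg one_ne_zero, hyr, e4]
  have g1 : s₃.omegaPoint = s₂.omegaPoint := by
    funext k
    unfold State.omegaPoint
    rw [hK₃.ra .omC (by simp), hK₃.ra .omF (by simp)]
  have g2 : s₃.omegaSched I.n = s₂.omegaSched I.n := by
    funext k
    unfold State.omegaSched
    rw [hK₃.na .omPos (by simp), hK₃.ra .omS (by simp)]
  refine ⟨((hK₁.mono (by simp) (by simp) (by simp) (by simp)).trans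
      (hK₂.mono (by simp) (by simp) (by simp) (by simp))).trans
      (hK₃.mono (by simp) (by simp) (by simp) (by simp)), by omega,
    ⟨f1, by rw [f2, hpc, e3], by rw [f3, hpf, e4], fun τ hτ hle => ?_, ?_⟩, by rw [hbound, f3],
    by rw [hbound]; exact hσy.le, ⟨q₀, hq₀, by rw [hbound, hFσ, ← hq₀F]⟩, by omega⟩
  · rw [f3] at hle
    rw [f2]
    exact hopt τ hτ ((WithTop.coe_le_coe.mpr hle).trans_lt hσy)
  · rw [f3, g1, g2, hK₃.nv .k (by simp)]
    exact harch

/-- When no cheaper schedule exists, the stored one is the last to be recorded. -/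
theorem wp_conclude (hS : Static I st) (h : Stored I st)
    (hno : ∀ τ : Schedule I.n, τ.Feasible I → (st.piStar I.n).fmax I ≤ τ.fmax I) :
    WP I.costs (record ;; .nset .done 1) st fun s t => s.nv .done = 1 ∧ IsParetoSet I s ∧
      IsMaxCostOptimum I s ∧ t ≤ 200 * (I.n + 1) := by
  rw [wp_seq]
  -- any threshold below the minimum cost shows that all Pareto optimal points are recorded
  refine (wp_record_stored hS h (v := (st.piStar I.n).fmax I - 1)
    (h.feasible.paretoOptimal h.opt fun τ hτ hlt => absurd (hno τ hτ) hlt.not_ge)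
    (by linarith) fun τ hτ _ h2 => hτ.not_dominated h.feasible (h.opt τ hτ.1 h2)
      (hno τ hτ.1)).imp ?_
  rintro s t ⟨hK, harch, ht⟩
  rw [wp_nset]
  have hpi : (s.setN .done 1).piStar I.n = st.piStar I.n := by
    unfold State.piStar
    rw [State.setN_na, State.setN_ra, hK.na .bestPos (by simp), hK.ra .bestS (by simp)]
  refine ⟨by simp, ⟨fun k h1 h2 => ?_, fun τ hτ => ?_⟩, ?_, by simp; omega⟩
  · obtain ⟨h3, h4, -⟩ := harch.sound k h1 h2
    exact ⟨h3, h4⟩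
  · obtain ⟨k, h1, h2, h3⟩ := harch.complete τ hτ (by have := hno τ hτ.1; linarith)
    exact ⟨k, ⟨h1, h2, h3⟩, fun k' ⟨h1', h2', h3'⟩ =>
      harch.inj k' k h1' h2' h1 h2 (h3'.trans h3.symm)⟩
  · rw [IsMaxCostOptimum, NExp.eval_ofNat, hpi]
    exact ⟨h.feasible, hno⟩

end

/-! ### The whole algorithm -/

section
variable {I : Instance} {st : State}

/-- The situation before an iteration of the main loop, after `t` operations. From the second
iteration on, the bound is attained by the current schedule, so that the next iteration lowers some
candidate bound; this pays for the iteration. -/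
structure MainInv (I : Instance) (s : State) (t : ℕ) : Prop where
  done_eq : s.nv .done = 0
  fail_eq : s.nv .fail = 0
  static : Static I s
  cur : ∃ D, Current I s.bound (finish I.n I.s I.procTime (s.na .pos 0)) D s ∧
    (s.nv .u = 0 ∧ s.nv .k = 0 ∧ s.bound = ⊤ ∧ t = 0 ∧ ∑ q ∈ range I.n, D q = I.n * I.n ∨
      0 < s.nv .u ∧ Stored I s ∧ s.bound = (((s.piStar I.n).fmax I : ℝ) : WithTop ℝ) ∧
      (∃ q < I.n, s.bound =
        ((I.costs q (finish I.n I.s I.procTime (s.na .pos 0) (s.na .pos 0 q)) : ℝ) :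
          WithTop ℝ)) ∧
      t + 6500 * ((I.n + 1) * ∑ q ∈ range I.n, D q) ≤
        6500 * ((I.n + 1) * (I.n * I.n)) + 3500 * (I.n + 1))

/-- One iteration of the main loop, including the four operations of the loop test: either the
invariant holds again, or the algorithm is done. -/
theorem MainInv.step {s : State} {t : ℕ} (h : MainInv I s t) :
    WP I.costs (improAux ;;
      .cond (.neq (.var .fail) 0)
        (evalSched ;;
          when (.and (.nlt 0 (.var .u)) (.rlt (.var .prevC) (.var .cmax))) record ;; keep)
        (record ;; .nset .done 1)) s fun s' t' =>
      MainInv I s' (t + (4 + t')) ∨ s'.nv .done = 1 ∧ IsParetoSet I s' ∧ IsMaxCostOptimum I s' ∧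
        t + (4 + t') ≤ 6500 * ((I.n + 1) * (I.n * I.n)) + 7000 * (I.n + 1) := by
  obtain ⟨D, hc, hcase⟩ := h.cur
  rw [wp_seq]
  refine (wp_improAux h.static hc h.fail_eq).imp ?_
  rintro s₁ t₁ ⟨hK, ⟨hfail, hno, ht₁⟩ | ⟨hfail, D', hT, hc', hm, ht₁, hdec⟩⟩
  · rw [wp_cond]
    refine ⟨fun hb => ?_, fun _ => ?_⟩
    · simp [hfail] at hb
    have hS₁ := h.static.of_keeps hK (by simp) (by simp) (by simp) (by simp)
    obtain ⟨-, -, hy, -⟩ | ⟨-, hst, hy, -, ht⟩ := hcase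
    · -- without a bound, the current assignment itself is good, so the search cannot fail
      refine absurd ⟨s.na .pos 0, 0, hc.tent.greedy.assign hc.layout.counts, fun j _ => ?_⟩ hno
      rw [hy]
      exact WithTop.coe_lt_top _
    · have hst₁ := hst.of_keeps (hK.mono (by simp) (by simp) (by simp) (by simp))
      have hpi : s₁.piStar I.n = s.piStar I.n := by
        unfold State.piStar
        rw [hK.na .bestPos (by simp), hK.ra .bestS (by simp)]
      refine (wp_conclude hS₁ hst₁ fun τ hτ => ?_).imp ?_
      · by_contra hcon
        push Not at hcon
        rw [hpi] at hcon
        obtain ⟨a, g, hg, -⟩ := hτ.exists_good (y := s.bound)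
          (by rw [hy]; exact WithTop.coe_lt_coe.mpr hcon)
        exact hno ⟨a, g, hg⟩
      · rintro s₂ t₂ ⟨h1, h2, h3, h4⟩
        refine Or.inr ⟨h1, h2, h3, ?_⟩
        rw [Nat.mul_assoc] at ht₁
        simp only [BExp.ops, NExp.ops]
        have : NExp.ops 0 = 1 := rfl
        omega
  · rw [wp_cond]
    refine ⟨fun _ => ?_, fun hb => ?_⟩
    swap
    · simp [hfail] at hb
    have hS₁ := h.static.of_keeps hK (by simp) (by simp) (by simp) (by simp)
    have hby : s₁.bound = s.bound := hK.bound_eq (by simp) (by simp)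
    have hpi : s₁.piStar I.n = s.piStar I.n := by
      unfold State.piStar
      rw [hK.na .bestPos (by simp), hK.ra .bestS (by simp)]
    rw [← hby] at hc' hm
    refine (wp_improve hS₁ hT hc' hm ?_).imp ?_
    · rw [hK.nv .u (by simp), hK.nv .k (by simp), hby, hpi]
      obtain ⟨h1, h2, h3, -⟩ | ⟨h1, h2, h3, -⟩ := hcase
      · exact Or.inl ⟨h1, h2, h3⟩
      · exact Or.inr ⟨h1, h2.of_keeps (hK.mono (by simp) (by simp) (by simp) (by simp)), h3⟩
    rintro s₂ t₂ ⟨hK₂, hu, hst, hy, hle, hex, ht₂⟩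
    left
    have epos : s₂.na .pos = s₁.na .pos := hK₂.na .pos (by simp)
    refine ⟨?_, ?_, hS₁.of_keeps hK₂ (by simp) (by simp) (by simp) (by simp), D', ?_, Or.inr
      ⟨hu, hst, hy, by rw [epos]; exact hex, ?_⟩⟩
    · rw [hK₂.nv .done (by simp), hK.nv .done (by simp), h.done_eq]
    · rw [hK₂.nv .fail (by simp), hfail]
    · refine ⟨?_, ?_⟩
      · rw [epos, hK₂.na .size (by simp), hK₂.na .slot (by simp)]
        exact hc'.layout
      · rw [epos, hK₂.na .size (by simp)]
        exact hc'.tent.mono_bound hle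
    · rw [Nat.mul_assoc, Nat.mul_assoc] at ht₁
      simp only [BExp.ops, NExp.ops]
      have e0 : NExp.ops 0 = 1 := rfl
      obtain ⟨-, -, -, h0, hsum⟩ | ⟨-, -, -, ⟨q, hq, hqy⟩, ht⟩ := hcase
      · have hle' : ∑ q ∈ range I.n, D' q ≤ I.n * I.n := by
          rw [← hsum]
          obtain ⟨-, h1⟩ | h1 := hdec
          · exact h1
          · exact h1.le
        rw [hsum] at ht₁
        have := Nat.mul_le_mul_left (I.n + 1) hle'
        omega
      · have hlt : ∑ q ∈ range I.n, D' q + 1 ≤ ∑ q ∈ range I.n, D q := by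
          obtain ⟨h1, -⟩ | h1 := hdec
          · -- an unchanged schedule would have all costs below its own maximum cost
            have h2 := hm q hq
            rw [h1, Instance.Meets, hby, hqy] at h2
            exact absurd h2 (lt_irrefl _)
          · exact h1
        have := Nat.mul_le_mul_left (I.n + 1) hlt
        rw [Nat.mul_succ] at this
        omega

/-- Both specifications are met by one and the same run. -/
theorem wp_main1 (I : Instance) : WP I.costs main1 I.load fun s t =>
    IsParetoSet I s ∧ IsMaxCostOptimum I s ∧ t ≤ 20000 * (I.n + 1) ^ 3 := by
  unfold main1
  rw [wp_seq, wp_nset, wp_seq, wp_nset, wp_seq, wp_nset, wp_seq, wp_nset, wp_seq, wp_nset, wp_seq]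
  set s₀ := ((((I.load.setN .u 0).setN .yFin 0).setN .k 0).setN .fail 0).setN .done 0 with hs₀
  change WP I.costs _ s₀ _
  have hS₀ : Static I s₀ := by
    refine ⟨by simp [hs₀, Instance.load], by simp [hs₀, Instance.load],
      by simp [hs₀, Instance.load], ?_⟩
    funext j
    simp [hs₀, Instance.load, Instance.procTime]
  have hz : s₀.nv .u = 0 ∧ s₀.nv .yFin = 0 ∧ s₀.nv .k = 0 ∧ s₀.nv .fail = 0 ∧ s₀.nv .done = 0 := by
    simp [hs₀]
  have hsz : ∀ k, s₀.na .size 0 k = 0 := fun k => by simp [hs₀, Instance.load]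
  clear_value s₀
  obtain ⟨hu, hyf, hk, hf, hd⟩ := hz
  refine WP.forUp I.n 5 (fun k s => s.nv .q = k ∧ Keeps [.q] [.csf] [] [] s₀ s ∧
    ∀ q < k, s.na .csf 0 q = I.n) ?_ ?_ ?_ ?_
  · exact ⟨by simp, (Keeps.refl _).setN (by simp) _, by simp⟩
  · rintro k s ⟨hq, hK, -⟩
    exact ⟨hq, by simp [hK.nv .numJobs (by simp), hS₀.numJobs]⟩
  · rintro k s hk ⟨hq, hK, h1⟩
    rw [wp_nput]
    refine ⟨⟨by simp [hq], (hK.putN (by simp) _ _ _).setN (by simp) _, fun q hqk => ?_⟩, by simp⟩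
    simp only [State.setN_na, State.putN_na, NExp.eval, hq, true_and,
      hK.nv .numJobs (by simp), hS₀.numJobs]
    split_ifs with h
    · rfl
    · exact h1 q (by omega)
  rintro s₁ t₁ ⟨-, hK₁, hcsf⟩ ht₁
  have hS₁ := hS₀.of_keeps hK₁ (by simp) (by simp) (by simp) (by simp)
  rw [wp_seq]
  refine (wp_formBatches hS₁ (by rw [hK₁.nv .fail (by simp), hf]) hcsf
    (by rw [hK₁.na .size (by simp)]; exact hsz)).imp ?_
  rintro s₂ t₂ ⟨hK₂, hL, hG, ht₂⟩
  have hS₂ := hS₁.of_keeps hK₂ (by simp) (by simp) (by simp) (by simp)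
  have hbound : s₂.bound = ⊤ := by
    rw [State.bound, hK₂.nv .yFin (by simp), hK₁.nv .yFin (by simp), hyf, if_pos rfl]
  have hinv : MainInv I s₂ 0 := by
    refine ⟨by rw [hK₂.nv .done (by simp), hK₁.nv .done (by simp), hd],
      by rw [hK₂.nv .fail (by simp), hK₁.nv .fail (by simp), hf], hS₂, fun _ => I.n,
      ⟨hL, hG.tentative (hG.contiguous hL.counts I.one_le_b) hL.counts⟩, Or.inl
      ⟨by rw [hK₂.nv .u (by simp), hK₁.nv .u (by simp), hu],
        by rw [hK₂.nv .k (by simp), hK₁.nv .k (by simp), hk], hbound, rfl, by simp⟩⟩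
  refine WP.loop_of_le (fun s t => MainInv I s t ∨ s.nv .done = 1 ∧ IsParetoSet I s ∧
    IsMaxCostOptimum I s ∧ t ≤ 6500 * ((I.n + 1) * (I.n * I.n)) + 7000 * (I.n + 1))
    (6500 * ((I.n + 1) * (I.n * I.n)) + 7000 * (I.n + 1)) ?_ (Or.inl hinv) ?_ ?_
  · rintro s t (h | ⟨-, -, -, h⟩)
    · obtain ⟨D, -, ⟨-, -, -, h, -⟩ | ⟨-, -, -, -, h⟩⟩ := h.cur <;> omega
    · exact h
  · rintro s t (h | ⟨h, -⟩) hb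
    · exact h.step
    · simp [h] at hb
  · rintro s t (h | ⟨-, h1, h2, h3⟩) hb
    · simp [h.done_eq] at hb
    · refine ⟨h1, h2, ?_⟩
      simp only [BExp.ops, NExp.ops] at ht₁ ⊢
      have e0 : NExp.ops 0 = 1 := rfl
      have h4 : (I.n + 1) * (I.n * I.n) ≤ (I.n + 1) ^ 3 := by
        rw [pow_succ', sq]
        gcongr <;> omega
      have h5 : I.n + 1 ≤ (I.n + 1) ^ 3 := Nat.le_self_pow (by omega) _
      have h6 : 400 * (I.n + 1) * (I.n + 1) * (I.n + 1) = 400 * (I.n + 1) ^ 3 := by ring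
      rw [h6] at ht₂
      omega

end

end SBatch

theorem theorem2 :
    SBatch.SolvesInCubicTime SBatch.main1 SBatch.IsParetoSet ∧
      SBatch.SolvesInCubicTime SBatch.main1 SBatch.IsMaxCostOptimum := by
  have key : ∀ I : SBatch.Instance, ∃ (out : SBatch.State) (t : ℕ),
      SBatch.Exec I.costs SBatch.main1 I.load out t ∧ t ≤ 160000 * I.n ^ 3 ∧
        SBatch.IsParetoSet I out ∧ SBatch.IsMaxCostOptimum I out := by
    intro I
    obtain ⟨out, t, hex, h1, h2, ht⟩ := SBatch.wp_main1 I
    refine ⟨out, t, hex, ht.trans ?_, h1, h2⟩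
    -- `n + 1 ≤ 2 n`, since `n` is positive
    have := I.n_pos
    calc 20000 * (I.n + 1) ^ 3 ≤ 20000 * (2 * I.n) ^ 3 := by gcongr; omega
      _ = 160000 * I.n ^ 3 := by ring
  refine ⟨⟨160000, fun I => ?_⟩, ⟨160000, fun I => ?_⟩⟩ <;>
    obtain ⟨out, t, hex, ht, h1, h2⟩ := key I
  · exact ⟨out, t, hex, ht, h1⟩
  · exact ⟨out, t, hex, ht, h2⟩
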